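/- **Setting.** A database consists of finite relations $S_1,\dots,S_r$. Relation $S_i$ has a set $X_i$ of key attributes, with values of any type, and $n_i\ge 0$ real-valued data columns $Y_i$. The key attributes are exactly the join attributes, i.e. the attributes that occur in at least two relations; each data column belongs to exactly one relation. The matrix $\mathbf S_i$ lists the tuples of $S_i$, each once, in any order. $\mathbf A$ is the matrix of the natural join (rows in any order) and $\mathbf A[:Y]$ consists of its $N=\sum_i n_i$ data columns. The relations are fully reduced if every input tuple is the projection of a tuple of the natural join. A join tree $\tau$ is a (rooted) tree whose nodes are the $r$ relations such that every node on the path between $S_i$ and $S_j$ has a key containing $X_i\cap X_j$. Let $M=\sum_i|S_i|$. **FiGaRo.** For a matrix $\mathbf B$ with rows $B_1,\dots,B_m$ and a vector $v\in\mathbb R_{>0}^m$ let the head be $\mathcal H(\mathbf B,v)=\frac1{\|v\|}\sum_i v_iB_i$ and let the tail $\mathcal T(\mathbf B,v)$ have the $m-1$ rows $\frac{1}{\|v_{1..j+1}\|}\big(\|v_{1..j}\|B_{j+1}-\frac{v_{j+1}\sum_{i\le j}v_iB_i}{\|v_{1..j}\|}\big)$. For a key tuple $x$, let $\Phi_i^\circ(x)$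 be the number of tuples with key values $x$ on $X_i$ in the join of all relations except $S_i$, and for a value $x$ of the key attributes shared by $S_i$ and its parent let $\Phi_i^\downarrow(x)$ and $\Phi_i^\uparrow(x)$ be the number of tuples with this value in the join of the relations inside, respectively outside, the subtree of $S_i$. FiGaRo first computes these counts in one bottom-up and one top-down pass over $\tau$. Then it proceeds recursively from the root. At node $S_i$: 1. For each key tuple $x$ of $S_i$, let $\mathbf S_i^{x}$ be the data part of the rows of $S_i$ with key $x$. Output $\sqrt{\Phi_i^\circ(x)}\,\mathcal T(\mathbf S_i^x,\mathbf 1)$, padded with zeros; set $\mathrm{Data}[x:Y_i]=\mathcal H(\mathbf S_i^x,\mathbf 1)$ and $\mathrm{scales}[x]=\sqrt{|\mathbf S_i^x|}$. 2. If $S_i$ is not a leaf, process its children $S_j$, obtaining $\mathrm{Data}_j,\mathrm{scales}_j$. For each $x$, with projections $x_{ij}$ to $X_i\cap X_j$: for all $S_k$ in the subtree of $S_j$ set $\mathrm{Data}[x:Y_k]=\mathrm{Data}_j[x_{ij}:Y_k]\cdot\mathrm{scales}[x]\cdot\prod_{j'\ne j}\mathrm{scales}_{j'}[x_{ij'}]$;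 multiply $\mathrm{Data}[x:Y_i]$ and $\mathrm{scales}[x]$ by $\prod_j\mathrm{scales}_j[x_{ij}]$ (products over children of $S_i$). 3. If $S_i$ is neither a leaf nor the root, then for each value $x_p$ of the key attributes shared with the parent, output the tail, multiplied by $\sqrt{\Phi_i^\uparrow(x_p)}$, of the rows of $\mathrm{Data}$ whose keys project to $x_p$, weighted by $\mathrm{scales}$; replace these rows by their weighted head, with new scale $\sqrt{\Phi_i^\downarrow(x_p)}$. 4. At the root, output the rows of $\mathrm{Data}$. $\mathbf R_0$ is the matrix of all output rows. Time is counted on a real random access machine with dictionaries: arithmetic operations and square roots on reals, operations on single key tuples, reading and writing of dictionary and array entries, list appends, loop iterations and recursive calls have unit cost. **Theorem.** There is an absolute constant $C$ such that for all fully reduced relations $S_1,\dots,S_r$ and every join tree $\tau$ of their natural join, FiGaRo returns a matrix $\mathbf R_0$ with the following properties. (0) If $M>0$, the running time is at most $C\,M(N+r)$. It is at most $C\,MN$ if every relation has at least one data column, and at most $C\,r\,MN$ if $N>0$; so it is $\mathcal O(MN)$. (1) $\mathbf R_0$ has at most $M$ rows. (2) $\mathbf R_0$ has at most $|\mathbf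 A|$ rows and there is an orthogonal $|\mathbf A|\times|\mathbf A|$ matrix $\mathbf Q$ with $\mathbf A[:Y]=\mathbf Q\begin{bmatrix}\mathbf R_0\\ \mathbf 0\end{bmatrix}$. (3) There is a finite sequence of Givens rotations whose application to $\mathbf A[:Y]$ produces the matrix $\begin{bmatrix}\mathbf R_0\\ \mathbf 0\end{bmatrix}$ up to a permutation of its rows. -/

import Mathlib

namespace Figaro

/-! ## Schemas, relations, natural join -/

/-- The schema of `r` relations over a set `κ` of key attributes. Relation `i` has the key
attributes `key i` and `width i` data columns. The key attributes are exactly the join attributes,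
that is, the attributes that occur in at least two relations; every data column belongs to
exactly one relation. -/
structure Schema (r : ℕ) (κ : Type) where
  key : Fin r → Finset κ
  width : Fin r → ℕ
  shared : ∀ a, ∃ i j, i ≠ j ∧ a ∈ key i ∧ a ∈ key j

variable {r : ℕ} {κ V : Type}

/-- The tuples `(x, y)` of relation `i`: key values of an arbitrary type `V`, and real data. -/
abbrev Schema.Tuple (σ : Schema r κ) (V : Type) (i : Fin r) : Type :=
  (σ.key i → V) × (Fin (σ.width i) → ℝ)

/-- The input matrices: for every relation the list of its rows, in an arbitrary order. -/
abbrev Schema.Database (σ : Schema r κ) (V : Type) : Type :=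
  ∀ i, List (σ.Tuple V i)

/-- A row over all data columns of all relations. -/
abbrev Schema.Row (σ : Schema r κ) : Type :=
  ∀ i : Fin r, Fin (σ.width i) → ℝ

/-- The data columns of all relations. -/
abbrev Schema.Col (σ : Schema r κ) : Type :=
  Σ i : Fin r, Fin (σ.width i)

/-- Tuples over all key attributes and all data columns. -/
abbrev Schema.JoinTuple (σ : Schema r κ) (V : Type) : Type :=
  (κ → V) × σ.Row

/-- The projection of a tuple onto the attributes of relation `i`. -/
def Schema.JoinTuple.proj {σ : Schema r κ} (t : σ.JoinTuple V) (i : Fin r) : σ.Tuple V i :=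
  (fun a => t.1 a, t.2 i)

/-- The natural join of all relations. -/
def natJoin {σ : Schema r κ} (S : σ.Database V) : Set (σ.JoinTuple V) :=
  {t | ∀ i, Schema.JoinTuple.proj t i ∈ S i}

/-- The natural join is finite, so its rows can be enumerated. -/
theorem natJoin_finite {σ : Schema r κ} (S : σ.Database V) : (natJoin S).Finite := by
  classical
  let f : natJoin S → ∀ i, {t // t ∈ S i} := fun t i => ⟨Schema.JoinTuple.proj t.1 i, t.2 i⟩
  have hf : Function.Injective f := by
    intro s t h
    have h' : ∀ i, Schema.JoinTuple.proj s.1 i = Schema.JoinTuple.proj t.1 i := fun i =>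
      congrArg Subtype.val (congrFun h i)
    apply Subtype.ext
    apply Prod.ext
    · funext a
      obtain ⟨i, _, _, hi, _⟩ := σ.shared a
      exact congrFun (congrArg Prod.fst (h' i)) ⟨a, hi⟩
    · funext i
      exact congrArg Prod.snd (h' i)
  have : ∀ i, Finite {t // t ∈ S i} := fun i => (List.finite_toSet (S i)).to_subtype
  exact Set.finite_coe_iff.mp (Finite.of_injective f hf)

/-- No input tuple is dangling: each one is the projection of a tuple in the join output. -/
def FullyReduced {σ : Schema r κ} (S : σ.Database V) : Prop :=
  ∀ i, ∀ t ∈ S i, ∃ u ∈ natJoin S, Schema.JoinTuple.proj u i = t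

/-- `M`: the overall number of input rows. -/
def numRows {σ : Schema r κ} (S : σ.Database V) : ℕ := ∑ i, (S i).length

/-- `N`: the overall number of data columns. -/
def numCols (σ : Schema r κ) : ℕ := ∑ i, σ.width i

/-- The matrix `A[: Y]`: the data columns of the join output, whose rows are listed by `e`. -/
def joinMatrix {σ : Schema r κ} {S : σ.Database V} {m : ℕ} (e : Fin m ≃ natJoin S) :
    Matrix (Fin m) σ.Col ℝ :=
  Matrix.of fun a c => (e a).1.2 c.1 c.2

/-- The matrix with `m` rows that consists of the rows in the list `R`, followed by zero rows. -/
def stackZero {σ : Schema r κ} (R : List σ.Row) (m : ℕ) : Matrix (Fin m) σ.Col ℝ :=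
  Matrix.of fun a c => if h : (a : ℕ) < R.length then R[(a : ℕ)] c.1 c.2 else 0

/-- The Givens rotation in the coordinates `i`, `j` by the angle `θ`. -/
noncomputable def givens {m : ℕ} (i j : Fin m) (θ : ℝ) : Matrix (Fin m) (Fin m) ℝ :=
  Matrix.of fun a b =>
    if a = i ∧ b = i then Real.cos θ
    else if a = j ∧ b = j then Real.cos θ
    else if a = i ∧ b = j then -Real.sin θ
    else if a = j ∧ b = i then Real.sin θ
    else if a = b then 1 else 0

/-! ## Join trees -/

/-- Finite ordered forests: `node a children siblings` is the forest whose first tree has the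
root label `a` and the subtrees `children`, and whose other trees are `siblings`. -/
inductive Forest (α : Type) : Type where
  | nil : Forest α
  | node (a : α) (children siblings : Forest α) : Forest α

namespace Forest

/-- The labels of the roots of the trees of a forest. -/
def roots {α : Type} : Forest α → List α
  | nil => []
  | node a _ rest => a :: rest.roots

/-- All labels of a forest. -/
def labels {α : Type} : Forest α → List α
  | nil => []
  | node a cs rest => a :: (cs.labels ++ rest.labels)

/-- The pairs (parent, child), where `p` is the parent of the roots of the forest. -/
def edges {α : Type} : α → Forest α → List (α × α)
  | _, nil => []
  | p, node a cs rest => (p, a) :: (edges a cs ++ edges p rest)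

end Forest

/-- Rooted trees. -/
structure RootedTree (α : Type) where
  root : α
  children : Forest α

/-- The labels of all nodes. -/
def RootedTree.labels {α : Type} (τ : RootedTree α) : List α := τ.root :: τ.children.labels

/-- The undirected graph of a rooted tree. -/
def RootedTree.graph {α : Type} (τ : RootedTree α) : SimpleGraph α :=
  SimpleGraph.fromRel fun a b => (a, b) ∈ τ.children.edges τ.root

/-- `τ` is a join tree: each relation is exactly one node, and all nodes on the path between
relations `i` and `j` contain the key attributes that `i` and `j` have in common. -/
structure IsJoinTree [DecidableEq κ] (σ : Schema r κ) (τ : RootedTree (Fin r)) : Prop where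
  nodup : τ.labels.Nodup
  mem_labels : ∀ i, i ∈ τ.labels
  path : ∀ (i j : Fin r) (w : τ.graph.Walk i j), w.IsPath →
    ∀ k ∈ w.support, σ.key i ∩ σ.key j ⊆ σ.key k

/-! ## Computations with a step count

The cost model is a real random access machine with dictionaries: arithmetic operations and
square roots on real numbers, reading, projecting and storing a key tuple, reading and writing a
dictionary entry, reading and writing a cell of an array, appending an entry to a list, every
iteration of a loop (and leaving the loop) and every recursive call take one step each. Only
passing on references (pairs, constants, pattern matching) is free. -/

/-- A result together with the number of steps that were made to compute it. -/
structure Timed (α : Type) : Type where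
  val : α
  steps : ℕ

instance : Monad Timed where
  pure a := ⟨a, 0⟩
  bind x f := ⟨(f x.val).val, x.steps + (f x.val).steps⟩

/-- One step without a result. -/
def tick : Timed Unit := ⟨(), 1⟩

def add (a b : ℝ) : Timed ℝ := ⟨a + b, 1⟩

noncomputable def sub (a b : ℝ) : Timed ℝ := ⟨a - b, 1⟩

def mul (a b : ℝ) : Timed ℝ := ⟨a * b, 1⟩

noncomputable def div (a b : ℝ) : Timed ℝ := ⟨a / b, 1⟩

noncomputable def sqrt (a : ℝ) : Timed ℝ := ⟨Real.sqrt a, 1⟩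

/-- Append an entry at the end of a list. -/
def push {α : Type} (l : List α) (a : α) : Timed (List α) := ⟨l ++ [a], 1⟩

/-- Read a cell of a row. -/
def cell {σ : Schema r κ} (v : σ.Row) (i : Fin r) (c : Fin (σ.width i)) : Timed ℝ := ⟨v i c, 1⟩

/-- Replace the block of a row that belongs to relation `i` by (a reference to) the array `b`. -/
def setBlock {σ : Schema r κ} (v : σ.Row) (i : Fin r) (b : Fin (σ.width i) → ℝ) :
    Timed σ.Row := ⟨Function.update v i b, 1⟩

/-- Go through a list, changing a state. -/
def loop {α β : Type} (f : β → α → Timed β) : List α → β → Timed β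
  | [], b => ⟨b, 1⟩
  | a :: l, b => do
    tick
    let b' ← f b a
    loop f l b'

/-- Fill an array, one entry after the other. -/
def tabulate {n : ℕ} {α : Fin n → Type} (f : ∀ i, Timed (α i)) : Timed (∀ i, α i) :=
  ⟨fun i => (f i).val, 1 + ∑ i, (1 + (f i).steps)⟩

/-- Key tuples over any set of key attributes, `none` at the attributes outside this set. -/
abbrev KeyTuple (κ V : Type) : Type := κ → Option V

/-- The key tuple of a row of relation `i`. -/
def keyOf [DecidableEq κ] {σ : Schema r κ} {i : Fin r} (t : σ.Tuple V i) :
    Timed (KeyTuple κ V) :=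
  ⟨fun a => if h : a ∈ σ.key i then some (t.1 ⟨a, h⟩) else none, 1⟩

/-- The projection of a key tuple onto those of its attributes that are in `X`. -/
def project [DecidableEq κ] (X : Finset κ) (x : KeyTuple κ V) : Timed (KeyTuple κ V) :=
  ⟨fun a => if a ∈ X then x a else none, 1⟩

/-- Dictionaries: the list of the keys that have been written so far, in the order of their first
occurrence, and the value of each key (a default value for the other keys). -/
structure Dict (K β : Type) : Type where
  keys : List K
  get : K → β

namespace Dict

/-- The empty dictionary with default value `b`. -/
def empty {K β : Type} (b : β) : Dict K β := ⟨[], fun _ => b⟩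

def lookup {K β : Type} (d : Dict K β) (k : K) : Timed β := ⟨d.get k, 1⟩

def insert {K β : Type} [DecidableEq K] (d : Dict K β) (k : K) (b : β) : Timed (Dict K β) :=
  ⟨⟨if k ∈ d.keys then d.keys else d.keys ++ [k], Function.update d.get k b⟩, 1⟩

end Dict

/-- Dictionaries that are indexed by key tuples. -/
abbrev KeyDict (κ V β : Type) : Type := Dict (KeyTuple κ V) β

/-! ## The count queries -/

/-- What the first pass stores for relation `idx`: the number of its rows per key tuple, the size
of the join of the relations in its subtree per key tuple (`theta`), and the same size per value
of the attributes that are shared with its parent (`down`; unused at the root). -/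
structure Counts₁ (r : ℕ) (κ V : Type) : Type where
  idx : Fin r
  rowsPerKey : KeyDict κ V ℝ
  theta : KeyDict κ V ℝ
  down : KeyDict κ V ℝ

/-- What the second pass stores in addition: the size of the join of the relations outside the
subtree of relation `idx` per value of the attributes that are shared with its parent (`up`;
unused at the root), and the size of the join of all other relations per key tuple (`circ`). -/
structure Counts₂ (r : ℕ) (κ V : Type) : Type where
  idx : Fin r
  rowsPerKey : KeyDict κ V ℝ
  down : KeyDict κ V ℝ
  up : KeyDict κ V ℝ
  circ : KeyDict κ V ℝ

section Program

variable [Fintype κ] [DecidableEq κ] [DecidableEq V]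

/-- Counts the rows of relation `i` per key tuple. -/
noncomputable def countRows {σ : Schema r κ} (S : σ.Database V) (i : Fin r) :
    Timed (KeyDict κ V ℝ) :=
  loop (fun d t => do
    let x ← keyOf t
    let c ← d.lookup x
    let c' ← add c 1
    d.insert x c') (S i) (Dict.empty 0)

/-- `theta x = rowsPerKey x * ∏ down_j (projection of x)`, the product over the children `j`. -/
noncomputable def computeTheta (σ : Schema r κ) (rowsPerKey : KeyDict κ V ℝ)
    (children : List (Counts₁ r κ V)) : Timed (KeyDict κ V ℝ) :=
  loop (fun d x => do
    let c ← rowsPerKey.lookup x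
    let c' ← loop (fun c b => do
      let y ← project (σ.key b.idx) x
      let f ← b.down.lookup y
      mul c f) children c
    d.insert x c') rowsPerKey.keys (Dict.empty 0)

/-- Sums up the values of a dictionary over all keys with the same projection onto `X`. -/
noncomputable def sumOver (X : Finset κ) (d : KeyDict κ V ℝ) : Timed (KeyDict κ V ℝ) :=
  loop (fun e x => do
    let y ← project X x
    let c ← d.lookup x
    let s ← e.lookup y
    let s' ← add s c
    e.insert y s') d.keys (Dict.empty 0)

/-- First pass (bottom-up) over the subtrees of the children of relation `p`. -/
noncomputable def pass₁ {σ : Schema r κ} (S : σ.Database V) :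
    Fin r → Forest (Fin r) → Timed (Forest (Counts₁ r κ V))
  | _, .nil => do
    tick
    pure .nil
  | p, .node i cs rest => do
    tick
    let cs' ← pass₁ S i cs
    let rowsPerKey ← countRows S i
    let theta ← computeTheta σ rowsPerKey cs'.roots
    let down ← sumOver (σ.key p) theta
    let rest' ← pass₁ S p rest
    pure (.node ⟨i, rowsPerKey, theta, down⟩ cs' rest')

/-- Multiplies `theta x` by the count `up` of the projection of `x` onto `X`. -/
noncomputable def applyUp (X : Finset κ) (up theta : KeyDict κ V ℝ) : Timed (KeyDict κ V ℝ) :=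
  loop (fun d x => do
    let y ← project X x
    let u ← up.lookup y
    let c ← theta.lookup x
    let f ← mul c u
    d.insert x f) theta.keys (Dict.empty 0)

/-- Pointwise quotient of two dictionaries. -/
noncomputable def divide (d e : KeyDict κ V ℝ) : Timed (KeyDict κ V ℝ) :=
  loop (fun q x => do
    let a ← d.lookup x
    let b ← e.lookup x
    let c ← div a b
    q.insert x c) d.keys (Dict.empty 0)

/-- Second pass (top-down) over the subtrees of the children of relation `p`, where `full` is the
size of the join of all relations per key tuple of `p`. -/
noncomputable def pass₂ (σ : Schema r κ) :
    Fin r → KeyDict κ V ℝ → Forest (Counts₁ r κ V) → Timed (Forest (Counts₂ r κ V))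
  | _, _, .nil => do
    tick
    pure .nil
  | p, full, .node b cs rest => do
    tick
    let sums ← sumOver (σ.key b.idx) full
    let up ← divide sums b.down
    let full' ← applyUp (σ.key p) up b.theta
    let circ ← divide full' b.rowsPerKey
    let cs' ← pass₂ σ b.idx full' cs
    let rest' ← pass₂ σ p full rest
    pure (.node ⟨b.idx, b.rowsPerKey, b.down, up, circ⟩ cs' rest')

/-- All count queries, stored at the nodes of the join tree. -/
noncomputable def computeCounts {σ : Schema r κ} (S : σ.Database V) (τ : RootedTree (Fin r)) :
    Timed (RootedTree (Counts₂ r κ V)) := do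
  tick
  let cs₁ ← pass₁ S τ.root τ.children
  let rowsPerKey ← countRows S τ.root
  let theta ← computeTheta σ rowsPerKey cs₁.roots
  let circ ← divide theta rowsPerKey
  let cs₂ ← pass₂ σ τ.root theta cs₁
  pure ⟨⟨τ.root, rowsPerKey, Dict.empty 0, Dict.empty 0, circ⟩, cs₂⟩

/-! ## Heads and tails -/

/-- The loop of `headTail`. Here `q` is the sum of the squares of the weights of the rows that
have been read, and `s` is the weighted sum of these rows. With weights `v₁, v₂, …` and rows
`A₁, A₂, …`, the head is `(∑ i, vᵢ Aᵢ) / ‖v‖` and row `j` of the tail is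
`(‖(v₁, …, vⱼ)‖ Aⱼ₊₁ - vⱼ₊₁ (∑ i ≤ j, vᵢ Aᵢ) / ‖(v₁, …, vⱼ)‖) / ‖(v₁, …, vⱼ₊₁)‖`. -/
noncomputable def headTailLoop {σ : Schema r κ} (k : ℝ) :
    List (ℝ × σ.Row) → ℝ → σ.Row → List σ.Row → Timed (σ.Row × List σ.Row)
  | [], q, s, out => do
    tick
    let n ← sqrt q
    let h ← tabulate fun i => tabulate fun c => do
      let a ← cell s i c
      div a n
    pure (h, out)
  | (v, w) :: l, q, s, out => do
    tick
    let n ← sqrt q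
    let v2 ← mul v v
    let q' ← add q v2
    let n' ← sqrt q'
    let t ← tabulate fun i => tabulate fun c => do
      let a ← cell w i c
      let b ← cell s i c
      let na ← mul n a
      let vb ← mul v b
      let vbn ← div vb n
      let d ← sub na vbn
      let e ← div d n'
      mul k e
    let out' ← push out t
    let s' ← tabulate fun i => tabulate fun c => do
      let a ← cell w i c
      let b ← cell s i c
      let va ← mul v a
      add b va
    headTailLoop k l q' s' out'

/-- The generalized head of the matrix whose rows, with positive weights, are listed in the first
argument after `k`; the rows of its generalized tail, scaled by `k`, are appended to `out`. -/
noncomputable def headTail {σ : Schema r κ} (k : ℝ) :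
    List (ℝ × σ.Row) → List σ.Row → Timed (σ.Row × List σ.Row)
  | [], out => do
    tick
    pure (fun _ _ => 0, out)
  | (v, w) :: l, out => do
    tick
    let q ← mul v v
    let s ← tabulate fun i => tabulate fun c => do
      let a ← cell w i c
      mul v a
    headTailLoop k l q s out

/-! ## The algorithm -/

/-- The working state at a node: the matrix `data` and the vector `scales`, with one row (one
entry) per key tuple, and the matrix `out`. The rows of `data` are zero outside of the columns of
the relations in the subtree of the node. The matrix `out` is passed on through the recursive
calls, which append their rows to it. -/
structure State (σ : Schema r κ) (V : Type) : Type where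
  data : KeyDict κ V σ.Row
  scales : KeyDict κ V ℝ
  out : List σ.Row

/-- What remains of a processed subtree: its root, the relations in it, `data` and `scales`. -/
structure Result (σ : Schema r κ) (V : Type) : Type where
  idx : Fin r
  nodes : List (Fin r)
  data : KeyDict κ V σ.Row
  scales : KeyDict κ V ℝ

/-- The data values of a row of relation `i`, in a row with zeros in all other columns. -/
noncomputable def padRow {σ : Schema r κ} {i : Fin r} (t : σ.Tuple V i) : Timed σ.Row := do
  let z ← tabulate fun j => tabulate fun _ : Fin (σ.width j) => pure (0 : ℝ)
  let b ← tabulate fun c => (⟨t.2 c, 1⟩ : Timed ℝ)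
  setBlock z i b

/-- The rows of relation `i`, with weight one, grouped by key tuple. -/
noncomputable def groupRows {σ : Schema r κ} (S : σ.Database V) (i : Fin r) :
    Timed (KeyDict κ V (List (ℝ × σ.Row))) :=
  loop (fun d t => do
    let x ← keyOf t
    let w ← padRow t
    let g ← d.lookup x
    let g' ← push g (1, w)
    d.insert x g') (S i) (Dict.empty [])

/-- Replaces every group of weighted rows by its generalized head and appends its generalized
tail, scaled by the square root of `tailCount`, to `out`; the new scales are the square roots
of `headCount`. With all weights one these are the head and the tail of the group. -/
noncomputable def reduceGroups {σ : Schema r κ} (groups : KeyDict κ V (List (ℝ × σ.Row)))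
    (tailCount headCount : KeyDict κ V ℝ) (out : List σ.Row) : Timed (State σ V) :=
  loop (fun st x => do
    let g ← groups.lookup x
    let c ← tailCount.lookup x
    let k ← sqrt c
    let ht ← headTail k g st.out
    let data ← st.data.insert x ht.1
    let c' ← headCount.lookup x
    let s ← sqrt c'
    let scales ← st.scales.insert x s
    pure ⟨data, scales, ht.2⟩) groups.keys ⟨Dict.empty (fun _ _ => 0), Dict.empty 0, out⟩

/-- Heads and tails of the rows of a relation, grouped by key tuple. -/
noncomputable def headsAndTails {σ : Schema r κ} (S : σ.Database V) (b : Counts₂ r κ V)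
    (out : List σ.Row) : Timed (State σ V) := do
  let groups ← groupRows S b.idx
  reduceGroups groups b.circ b.rowsPerKey out

/-- Joins `data` with the results for the children of relation `i` and applies the scaling
factors. The product of the scales of all children but one is computed as a quotient. -/
noncomputable def joinChildren {σ : Schema r κ} (i : Fin r) (children : List (Result σ V))
    (st : State σ V) : Timed (State σ V) :=
  loop (fun st x => do
    let s ← st.scales.lookup x
    let w ← st.data.lookup x
    let p ← loop (fun p (b : Result σ V) => do
      let y ← project (σ.key b.idx) x
      let f ← b.scales.lookup y
      mul p f) children 1
    let sp ← mul s p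
    let own ← tabulate fun c => do
      let a ← cell w i c
      mul a p
    let w₁ ← setBlock w i own
    let w₂ ← loop (fun w (b : Result σ V) => do
      let y ← project (σ.key b.idx) x
      let f ← b.scales.lookup y
      let g ← div sp f
      let u ← b.data.lookup y
      loop (fun w k => do
        let blk ← tabulate fun c => do
          let a ← cell u k c
          mul a g
        setBlock w k blk) b.nodes w) children w₁
    let data ← st.data.insert x w₂
    let scales ← st.scales.insert x sp
    pure ⟨data, scales, st.out⟩) st.data.keys st

/-- Reduces `data` to one row per value of the attributes shared with the parent `p`. -/
noncomputable def projectAway {σ : Schema r κ} (p : Fin r) (b : Counts₂ r κ V)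
    (st : State σ V) : Timed (State σ V) := do
  let groups ← loop (fun d x => do
    let y ← project (σ.key p) x
    let v ← st.scales.lookup x
    let w ← st.data.lookup x
    let g ← d.lookup y
    let g' ← push g (v, w)
    d.insert y g') st.data.keys (Dict.empty ([] : List (ℝ × σ.Row)))
  reduceGroups groups b.up b.down st.out

/-- The relations in the subtree with root `i`. -/
def collectNodes {σ : Schema r κ} (i : Fin r) (children : List (Result σ V)) :
    Timed (List (Fin r)) :=
  loop (fun l (b : Result σ V) => loop (fun l k => push l k) b.nodes l) children [i]

/-- The recursive calls for the children of relation `p`. -/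
noncomputable def processForest {σ : Schema r κ} (S : σ.Database V) :
    Fin r → Forest (Counts₂ r κ V) → List σ.Row → Timed (List (Result σ V) × List σ.Row)
  | _, .nil, out => do
    tick
    pure ([], out)
  | p, .node b cs rest, out => do
    tick
    let st ← headsAndTails S b out
    let sub ← processForest S b.idx cs st.out
    let nodes ← collectNodes b.idx sub.1
    let st' ← match sub.1 with
      | [] => pure st
      | _ :: _ => do
        let st₁ ← joinChildren b.idx sub.1 ⟨st.data, st.scales, sub.2⟩
        projectAway p b st₁
    let others ← processForest S p rest st'.out
    pure (⟨b.idx, nodes, st'.data, st'.scales⟩ :: others.1, others.2)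

/-- FiGaRo, called for the root of the join tree `τ`: the rows of the matrix `R₀`. -/
noncomputable def figaro {σ : Schema r κ} (S : σ.Database V) (τ : RootedTree (Fin r)) :
    Timed (List σ.Row) := do
  tick
  let t ← computeCounts S τ
  let st ← headsAndTails S t.root []
  let sub ← processForest S t.root.idx t.children st.out
  let st' ← joinChildren t.root.idx sub.1 ⟨st.data, st.scales, sub.2⟩
  loop (fun out x => do
    let w ← st'.data.lookup x
    push out w) st'.data.keys st'.out

end Program

end Figaro

/-!
For a linear functional `f` on rows, the sum of the squares of the values of `f` on a finite family
`T` of rows is `(f (∑ T))² / |T|`, the square of `f` at the head, plus `|T|` times the variance of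
`f` on `T`, the contribution of the tail. Rows of different relations have disjoint supports, so the
row of a join is the sum of the zero-padded rows it consists of, and the join of two families
without a common key is their Minkowski sum. Variances are additive under Minkowski sums, hence the
variance of each factor is counted once for every choice of the other factors: these multiplicities
are the `Φ` in the factors `√Φ` of the tails. Summing over the tree, `R₀` and the data matrix of the
join give the same value at every `f`, that is, they have the same Gram matrix.

Two matrices of the same shape with equal Gram matrices differ by an orthogonal factor. Givens
rotations turn the columns of an orthogonal matrix one after the other into unit vectors, except for
a possible sign `-1` in the last one, which a quarter turn changes into a transposition. This needs
two rows; if the join has a single row, then `R₀` consists of this row.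
-/

namespace Figaro

variable {r : ℕ} {κ V : Type}

/-! ## Timed computations and dictionaries -/

namespace Timed

variable {α β : Type}

@[simp] theorem val_bind (x : Timed α) (f : α → Timed β) : (x >>= f).val = (f x.val).val := rfl

@[simp] theorem steps_bind (x : Timed α) (f : α → Timed β) :
    (x >>= f).steps = x.steps + (f x.val).steps := rfl

@[simp] theorem val_pure (a : α) : (pure a : Timed α).val = a := rfl

@[simp] theorem steps_pure (a : α) : (pure a : Timed α).steps = 0 := rfl

theorem bind_assoc {γ : Type} (x : Timed α) (f : α → Timed β) (g : β → Timed γ) :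
    (x >>= f) >>= g = x >>= fun a => f a >>= g :=
  congrArg (Timed.mk _) (Nat.add_assoc _ _ _)

end Timed

@[simp] theorem steps_tick : tick.steps = 1 := rfl
@[simp] theorem val_add (a b : ℝ) : (add a b).val = a + b := rfl
@[simp] theorem steps_add (a b : ℝ) : (add a b).steps = 1 := rfl
@[simp] theorem val_sub (a b : ℝ) : (sub a b).val = a - b := rfl
@[simp] theorem steps_sub (a b : ℝ) : (sub a b).steps = 1 := rfl
@[simp] theorem val_mul (a b : ℝ) : (mul a b).val = a * b := rfl
@[simp] theorem steps_mul (a b : ℝ) : (mul a b).steps = 1 := rfl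
@[simp] theorem val_div (a b : ℝ) : (div a b).val = a / b := rfl
@[simp] theorem steps_div (a b : ℝ) : (div a b).steps = 1 := rfl
@[simp] theorem val_sqrt (a : ℝ) : (sqrt a).val = Real.sqrt a := rfl
@[simp] theorem steps_sqrt (a : ℝ) : (sqrt a).steps = 1 := rfl

@[simp] theorem val_push {α : Type} (l : List α) (a : α) : (push l a).val = l ++ [a] := rfl
@[simp] theorem steps_push {α : Type} (l : List α) (a : α) : (push l a).steps = 1 := rfl

@[simp] theorem val_cell {σ : Schema r κ} (v : σ.Row) (i : Fin r) (c : Fin (σ.width i)) :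
    (cell v i c).val = v i c := rfl
@[simp] theorem steps_cell {σ : Schema r κ} (v : σ.Row) (i : Fin r) (c : Fin (σ.width i)) :
    (cell v i c).steps = 1 := rfl

@[simp] theorem val_setBlock {σ : Schema r κ} (v : σ.Row) (i : Fin r)
    (b : Fin (σ.width i) → ℝ) : (setBlock v i b).val = Function.update v i b := rfl
@[simp] theorem steps_setBlock {σ : Schema r κ} (v : σ.Row) (i : Fin r)
    (b : Fin (σ.width i) → ℝ) : (setBlock v i b).steps = 1 := rfl

@[simp] theorem val_tabulate {n : ℕ} {α : Fin n → Type} (f : ∀ i, Timed (α i)) :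
    (tabulate f).val = fun i => (f i).val := rfl
@[simp] theorem steps_tabulate {n : ℕ} {α : Fin n → Type} (f : ∀ i, Timed (α i)) :
    (tabulate f).steps = 1 + ∑ i, (1 + (f i).steps) := rfl

@[simp] theorem Dict.val_lookup {K β : Type} (d : Dict K β) (k : K) :
    (d.lookup k).val = d.get k := rfl
@[simp] theorem Dict.steps_lookup {K β : Type} (d : Dict K β) (k : K) :
    (d.lookup k).steps = 1 := rfl
@[simp] theorem Dict.steps_insert {K β : Type} [DecidableEq K] (d : Dict K β) (k : K) (b : β) :
    (d.insert k b).steps = 1 := rfl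
@[simp] theorem Dict.get_insert {K β : Type} [DecidableEq K] (d : Dict K β) (k : K) (b : β) :
    (d.insert k b).val.get = Function.update d.get k b := rfl
@[simp] theorem Dict.get_empty {K β : Type} (b : β) (k : K) :
    (Dict.empty b : Dict K β).get k = b := rfl
@[simp] theorem Dict.keys_empty {K β : Type} (b : β) :
    (Dict.empty b : Dict K β).keys = [] := rfl

@[simp] theorem steps_keyOf [DecidableEq κ] {σ : Schema r κ} {i : Fin r} (t : σ.Tuple V i) :
    (keyOf t).steps = 1 := rfl
@[simp] theorem steps_project [DecidableEq κ] (X : Finset κ) (x : KeyTuple κ V) :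
    (project X x).steps = 1 := rfl

theorem loop_val {α β : Type} (f : β → α → Timed β) (l : List α) (b : β) :
    (loop f l b).val = l.foldl (fun b a => (f b a).val) b := by
  induction l generalizing b with
  | nil => rfl
  | cons _ _ ih => exact ih _

theorem loop_steps_le_sum {α β : Type} (c : α → ℕ) (f : β → α → Timed β) (l : List α) (b : β)
    (h : ∀ a ∈ l, ∀ b, (f b a).steps ≤ c a) :
    (loop f l b).steps ≤ 1 + (l.map fun a => 1 + c a).sum := by
  induction l generalizing b with
  | nil => simp [loop]
  | cons a _ ih =>
    have h_head := h a (by simp) b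
    have h_tail := ih (f b a).val fun a' ha' => h a' (by simp [ha'])
    simp only [loop, Timed.steps_bind, steps_tick, List.map_cons, List.sum_cons]
    omega

theorem loop_steps_le_const {α β : Type} (c : ℕ) (f : β → α → Timed β) (l : List α) (b : β)
    (h : ∀ a ∈ l, ∀ b, (f b a).steps ≤ c) :
    (loop f l b).steps ≤ 1 + l.length * (1 + c) := by
  simpa using loop_steps_le_sum (fun _ => c) f l b h

theorem steps_tabulate_tabulate {σ : Schema r κ} (f : ∀ i, Fin (σ.width i) → Timed ℝ) (k : ℕ)
    (h : ∀ i c, (f i c).steps = k) :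
    (tabulate fun i => tabulate (f i)).steps = 1 + 2 * r + (1 + k) * numCols σ := by
  simp only [steps_tabulate, h, Finset.sum_const, Finset.card_univ, Fintype.card_fin, numCols,
    Finset.sum_add_distrib, smul_eq_mul, Finset.mul_sum]
  simp only [mul_comm, mul_one, add_mul, Finset.sum_add_distrib]
  ring

theorem foldl_add_eq_add_sum_map {α M : Type*} [AddMonoid M] (f : α → M) (l : List α) (c : M) :
    l.foldl (fun b a => b + f a) c = c + (l.map f).sum := by
  induction l generalizing c with
  | nil => simp
  | cons a l ih => simp [ih, add_assoc]

theorem foldl_append_singleton {α β : Type*} (f : α → β) (l : List α) (b : List β) :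
    l.foldl (fun b a => b ++ [f a]) b = b ++ l.map f := by
  induction l generalizing b with
  | nil => simp
  | cons a l ih => simp [ih]

theorem sum_length_filter_eq {α K : Type*} [DecidableEq K] (key : α → K) (l : List α) :
    ∑ k ∈ (l.map key).toFinset, (l.filter (key · = k)).length = l.length := by
  have h_card := Multiset.sum_count_eq_card (s := (l.map key).toFinset)
    (m := (l.map key : Multiset K)) (by simp)
  rw [Multiset.coe_card, List.length_map] at h_card
  rw [← h_card]
  refine Finset.sum_congr rfl fun k _ => ?_
  rw [Multiset.coe_count, List.count, List.countP_map, List.countP_eq_length_filter]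
  congr 2

namespace Dict

variable {K β : Type}

/-- The abstract content of a dictionary: the keys that have been written form the set `s`, and
every key, written or not, has the value `g k`. The order of the keys is irrelevant. -/
structure Represents (d : Dict K β) (s : Finset K) (g : K → β) : Prop where
  nodup : d.keys.Nodup
  mem_keys : ∀ k, k ∈ d.keys ↔ k ∈ s
  get_eq : ∀ k, d.get k = g k

theorem represents_empty (b : β) : (empty b : Dict K β).Represents ∅ fun _ => b :=
  ⟨by simp, by simp, by simp⟩

theorem Represents.congr {d : Dict K β} {s t : Finset K} {f g : K → β} (h : d.Represents s f)
    (hst : s = t) (hfg : ∀ k, f k = g k) : d.Represents t g :=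
  ⟨h.nodup, hst ▸ h.mem_keys, fun k => (h.get_eq k).trans (hfg k)⟩

theorem Represents.toFinset [DecidableEq K] {d : Dict K β} {s : Finset K} {g : K → β}
    (h : d.Represents s g) : d.keys.toFinset = s := by
  ext k
  simp [h.mem_keys]

theorem Represents.sum_keys {d : Dict K β} {s : Finset K} {g : K → β} (h : d.Represents s g)
    {M : Type*} [AddCommMonoid M] (f : K → M) : (d.keys.map f).sum = ∑ k ∈ s, f k := by
  classical
  rw [← h.toFinset, List.sum_toFinset _ h.nodup]

theorem Represents.length_keys {d : Dict K β} {s : Finset K} {g : K → β}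
    (h : d.Represents s g) : d.keys.length = s.card := by
  classical
  rw [← h.toFinset, List.toFinset_card_of_nodup h.nodup]

variable [DecidableEq K]

theorem Represents.insert {d : Dict K β} {s : Finset K} {g : K → β} (h : d.Represents s g)
    (k : K) (b : β) :
    (d.insert k b).val.Represents (s ∪ {k}) (Function.update g k b) := by
  refine ⟨?_, fun a => ?_, fun a => ?_⟩
  · change (if k ∈ d.keys then d.keys else d.keys ++ [k]).Nodup
    split_ifs with hk
    · exact h.nodup
    · exact h.nodup.append (by simp) (by simpa using hk)
  · change (a ∈ if k ∈ d.keys then d.keys else d.keys ++ [k]) ↔ _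
    split_ifs with hk
    · have := (h.mem_keys k).1 hk
      simp only [h.mem_keys, Finset.mem_union, Finset.mem_singleton]
      constructor
      · exact Or.inl
      · rintro (h | rfl) <;> assumption
    · simp [h.mem_keys, or_comm]
  · simp [Function.update_apply, h.get_eq]

theorem Represents.foldl_insert {α : Type} (key : α → K) (upd : α → β → β) (l : List α)
    {d : Dict K β} {s : Finset K} {g : K → β} (h : d.Represents s g) :
    (l.foldl (fun d a => (d.insert (key a) (upd a (d.get (key a)))).val) d).Represents
      (s ∪ (l.map key).toFinset)
      fun k => (l.filter (key · = k)).foldl (fun b a => upd a b) (g k) := by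
  induction l generalizing d s g with
  | nil => exact h.congr (by simp) (by simp)
  | cons a l ih =>
    refine (ih (h.insert (key a) (upd a (d.get (key a))))).congr ?_ fun k => ?_
    · ext
      simp
    · by_cases hk : key a = k
      · subst hk
        simp [h.get_eq]
      · simp [hk, Function.update_of_ne (Ne.symm hk)]

theorem represents_foldl_set (l : List K) (hl : l.Nodup) (c : K → β) (b : β) (s : Finset K)
    (hs : ∀ k, k ∈ l ↔ k ∈ s) (hc : ∀ k, k ∉ s → c k = b) :
    (l.foldl (fun d a => (d.insert a (c a)).val) (empty b)).Represents s c := by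
  refine ((represents_empty b).foldl_insert id (fun a _ => c a) l).congr ?_ fun k => ?_
  · ext k
    simp [hs]
  · by_cases hk : k ∈ l
    · have : l.filter (fun a => decide (a = k)) = [k] := by
        rw [List.filter_eq, List.count_eq_one_of_mem hl hk]
        rfl
      simp [this]
    · have : l.filter (fun a => decide (a = k)) = [] := by
        rw [List.filter_eq, List.count_eq_zero_of_not_mem hk]
        rfl
      simp only [id, this, List.foldl_nil]
      exact (hc k fun h => hk ((hs k).2 h)).symm

end Dict

/-! ## Quadratic forms of heads and tails -/

section Moments

variable {E : Type*} [AddCommMonoid E]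

/-- The Minkowski sum of two multisets, with multiplicities. A row of a join is the sum of the
zero-padded rows that are joined, so `sumset` is the Cartesian product of two joins. -/
def sumset (S T : Multiset E) : Multiset E := S.bind fun a => T.map (a + ·)

@[simp] theorem zero_sumset (T : Multiset E) : sumset 0 T = 0 := by simp [sumset]

@[simp] theorem cons_sumset (a : E) (S T : Multiset E) :
    sumset (a ::ₘ S) T = T.map (a + ·) + sumset S T := by simp [sumset]

@[simp] theorem card_sumset (S T : Multiset E) : (sumset S T).card = S.card * T.card := by
  simp [sumset, Multiset.card_bind]

@[simp] theorem sumset_singleton_zero (S : Multiset E) : sumset S {0} = S := by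
  simp only [sumset, Multiset.map_singleton, add_zero]
  exact (Multiset.bind_singleton S id).trans (Multiset.map_id S)

theorem sum_map_const_add (a : E) (T : Multiset E) :
    (T.map (a + ·)).sum = T.card • a + T.sum := by
  induction T using Multiset.induction with
  | empty => simp
  | cons b T ih =>
    simp only [Multiset.map_cons, Multiset.sum_cons, ih, Multiset.card_cons]
    module

theorem sum_sumset (S T : Multiset E) :
    (sumset S T).sum = T.card • S.sum + S.card • T.sum := by
  induction S using Multiset.induction with
  | empty => simp
  | cons a S ih =>
    simp only [cons_sumset, Multiset.sum_add, ih, sum_map_const_add, Multiset.sum_cons,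
      Multiset.card_cons]
    module

section SumSq

variable {R : Type*} [CommSemiring R] [Module R E]

/-- The sum of the squares of the values of a linear functional. As a function of `f` it is the
quadratic form of the Gram matrix of `T`. -/
def sumSq (f : E →ₗ[R] R) (T : Multiset E) : R := (T.map fun w => f w ^ 2).sum

@[simp] theorem sumSq_zero (f : E →ₗ[R] R) : sumSq f 0 = 0 := by simp [sumSq]

@[simp] theorem sumSq_add (f : E →ₗ[R] R) (S T : Multiset E) :
    sumSq f (S + T) = sumSq f S + sumSq f T := by simp [sumSq]

@[simp] theorem sumSq_cons (f : E →ₗ[R] R) (a : E) (T : Multiset E) :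
    sumSq f (a ::ₘ T) = f a ^ 2 + sumSq f T := by simp [sumSq]

theorem sumSq_sum (f : E →ₗ[R] R) {ι : Type*} (s : Finset ι) (T : ι → Multiset E) :
    sumSq f (∑ i ∈ s, T i) = ∑ i ∈ s, sumSq f (T i) := by
  classical
  induction s using Finset.induction_on with
  | empty => simp
  | insert a s ha ih => simp [Finset.sum_insert ha, ih]

theorem sumSq_map_const_add (f : E →ₗ[R] R) (a : E) (T : Multiset E) :
    sumSq f (T.map (a + ·)) = T.card * f a ^ 2 + 2 * f a * f T.sum + sumSq f T := by
  induction T using Multiset.induction with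
  | empty => simp
  | cons b T ih =>
    simp only [Multiset.map_cons, sumSq_cons, ih, Multiset.card_cons, Multiset.sum_cons, map_add]
    push_cast
    ring

theorem sumSq_sumset (f : E →ₗ[R] R) (S T : Multiset E) :
    sumSq f (sumset S T) =
      T.card * sumSq f S + 2 * f S.sum * f T.sum + S.card * sumSq f T := by
  induction S using Multiset.induction with
  | empty => simp
  | cons a S ih =>
    simp only [cons_sumset, sumSq_add, sumSq_cons, ih, sumSq_map_const_add, Multiset.sum_cons,
      Multiset.card_cons, map_add]
    push_cast
    ring

end SumSq

variable {F : Type*} [Field F] [CharZero F] [Module F E]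

/-- The variance of the values of a linear functional on a finite family; it is additive along
joins. -/
def variance (f : E →ₗ[F] F) (T : Multiset E) : F :=
  sumSq f T / T.card - (f T.sum / T.card) ^ 2

theorem variance_sumset (f : E →ₗ[F] F) {S T : Multiset E} (hS : S.card ≠ 0) (hT : T.card ≠ 0) :
    variance f (sumset S T) = variance f S + variance f T := by
  have hS₀ : (S.card : F) ≠ 0 := by exact_mod_cast hS
  have hT₀ : (T.card : F) ≠ 0 := by exact_mod_cast hT
  simp only [variance, sumSq_sumset, sum_sumset, card_sumset, map_add, map_nsmul, nsmul_eq_mul]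
  push_cast
  field_simp
  ring

theorem card_mul_variance (f : E →ₗ[F] F) (T : Multiset E) :
    T.card * variance f T = sumSq f T - f T.sum ^ 2 / T.card := by
  by_cases h : T.card = 0
  · simp [Multiset.card_eq_zero.1 h, variance]
  · have hT₀ : (T.card : F) ≠ 0 := by exact_mod_cast h
    simp only [variance]
    field_simp

end Moments

section HeadTail

variable {E : Type*} [AddCommGroup E] [Module ℝ E]

/-- The squared norm of the weights of a list of weighted rows. -/
def weightSq {E : Type*} (l : List (ℝ × E)) : ℝ := (l.map fun p => p.1 ^ 2).sum

/-- The weighted sum of a list of weighted rows. -/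
def weightedSum (l : List (ℝ × E)) : E := (l.map fun p => p.1 • p.2).sum

/-- The rows of a list of weighted rows, without the weights. -/
def unweighted {E : Type*} (l : List (ℝ × E)) : Multiset E := l.map Prod.snd

/-- The row `w` of weight `v` contributes this row to a generalized tail that is scaled by `k`,
where `q` is the squared norm of the weights of the preceding rows and `s` their weighted sum. -/
noncomputable def tailRow (k q : ℝ) (s : E) (v : ℝ) (w : E) : E :=
  (k / √(q + v * v)) • (√q • w - (v / √q) • s)

theorem weightSq_cons {E : Type*} (v : ℝ) (w : E) (l : List (ℝ × E)) :
    weightSq ((v, w) :: l) = v * v + weightSq l := by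
  simp [weightSq, sq]

theorem weightedSum_cons (v : ℝ) (w : E) (l : List (ℝ × E)) :
    weightedSum ((v, w) :: l) = v • w + weightedSum l := by
  simp [weightedSum]

theorem sumSq_unweighted_cons (f : E →ₗ[ℝ] ℝ) (v : ℝ) (w : E) (l : List (ℝ × E)) :
    sumSq f (unweighted ((v, w) :: l)) = f w ^ 2 + sumSq f (unweighted l) := by
  simp [unweighted, ← Multiset.cons_coe]

theorem map_tailRow_sq (f : E →ₗ[ℝ] ℝ) (k : ℝ) {q : ℝ} (hq : 0 < q) (s : E) (v : ℝ) (w : E) :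
    f (tailRow k q s v w) ^ 2 =
      k ^ 2 * (f w ^ 2 + f s ^ 2 / q - f (s + v • w) ^ 2 / (q + v * v)) := by
  have hqv : 0 < q + v * v := add_pos_of_pos_of_nonneg hq (mul_self_nonneg v)
  have hnum : √q * f w - v / √q * f s = (q * f w - v * f s) / √q := by
    have : √q ≠ 0 := (Real.sqrt_pos.2 hq).ne'
    field_simp
    rw [Real.sq_sqrt hq.le]
    ring
  simp only [tailRow, map_smul, map_sub, map_add, smul_eq_mul]
  rw [hnum, mul_pow, div_pow, div_pow, Real.sq_sqrt hq.le, Real.sq_sqrt hqv.le]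
  field_simp
  ring

/-- The list `out'` arises from `out` by appending `n` vectors whose Gram form is `Q`. This is all
that matters about the output of each phase of the algorithm. -/
def Appends (out out' : List E) (n : ℕ) (Q : (E →ₗ[ℝ] ℝ) → ℝ) : Prop :=
  ∃ new : List E, out' = out ++ new ∧ new.length = n ∧ ∀ f, sumSq f (new : Multiset E) = Q f

namespace Appends

variable {out out' out'' : List E} {m n : ℕ} {P Q : (E →ₗ[ℝ] ℝ) → ℝ}

theorem refl (out : List E) : Appends out out 0 fun _ => 0 :=
  ⟨[], by simp, rfl, by simp⟩

theorem push (out : List E) (w : E) : Appends out (out ++ [w]) 1 fun f => f w ^ 2 :=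
  ⟨[w], rfl, rfl, by simp [sumSq]⟩

theorem trans (h : Appends out out' m P) (h' : Appends out' out'' n Q) :
    Appends out out'' (m + n) fun f => P f + Q f := by
  obtain ⟨new, rfl, rfl, hP⟩ := h
  obtain ⟨new', rfl, rfl, hQ⟩ := h'
  exact ⟨new ++ new', by simp, by simp, fun f => by rw [← Multiset.coe_add, sumSq_add, hP, hQ]⟩

theorem congr (h : Appends out out' m P) (hmn : m = n) (hPQ : ∀ f, P f = Q f) :
    Appends out out' n Q := by
  obtain rfl : P = Q := funext hPQ
  exact hmn ▸ h

end Appends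

variable {σ : Schema r κ}

theorem headTailLoop_cons_val (k v : ℝ) (w : σ.Row) (l : List (ℝ × σ.Row)) (q : ℝ) (s : σ.Row)
    (out : List σ.Row) :
    (headTailLoop k ((v, w) :: l) q s out).val =
      (headTailLoop k l (q + v * v) (s + v • w) (out ++ [tailRow k q s v w])).val := by
  have hrow : tailRow k q s v w =
      fun i c => k * ((√q * w i c - v * s i c / √q) / √(q + v * v)) := by
    funext i c
    simp only [tailRow, Pi.smul_apply, Pi.sub_apply, smul_eq_mul]
    ring
  rw [hrow]
  rfl

theorem headTailLoop_val_fst (k : ℝ) (l : List (ℝ × σ.Row)) (q : ℝ) (s : σ.Row)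
    (out : List σ.Row) :
    (headTailLoop k l q s out).val.1 = (√(q + weightSq l))⁻¹ • (s + weightedSum l) := by
  induction l generalizing q s out with
  | nil =>
    funext i c
    simp [headTailLoop, weightedSum, weightSq, div_eq_inv_mul]
  | cons p l ih =>
    rw [headTailLoop_cons_val, ih, weightSq_cons, weightedSum_cons, add_assoc, add_assoc]

theorem headTailLoop_appends (k : ℝ) (l : List (ℝ × σ.Row)) {q : ℝ} (hq : 0 < q) (s : σ.Row)
    (out : List σ.Row) :
    Appends out (headTailLoop k l q s out).val.2 l.length fun f =>
      k ^ 2 * (sumSq f (unweighted l) + f s ^ 2 / q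
        - f (s + weightedSum l) ^ 2 / (q + weightSq l)) := by
  induction l generalizing q s out with
  | nil =>
    exact (Appends.refl out).congr rfl fun f => by simp [weightedSum, weightSq, unweighted]
  | cons p l ih =>
    obtain ⟨v, w⟩ := p
    rw [headTailLoop_cons_val]
    have hqv : 0 < q + v * v := add_pos_of_pos_of_nonneg hq (mul_self_nonneg v)
    refine ((Appends.push out _).trans (ih hqv (s + v • w) _)).congr (add_comm _ _) fun f => ?_
    rw [map_tailRow_sq f k hq, weightSq_cons, weightedSum_cons, sumSq_unweighted_cons, add_assoc,
      add_assoc q]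
    ring

theorem headTail_val_fst (k : ℝ) (l : List (ℝ × σ.Row)) (out : List σ.Row) :
    (headTail k l out).val.1 = (√(weightSq l))⁻¹ • weightedSum l := by
  cases l with
  | nil => exact (smul_zero (M := ℝ) (A := σ.Row) _).symm
  | cons p l =>
    obtain ⟨v, w⟩ := p
    rw [weightSq_cons, weightedSum_cons]
    exact headTailLoop_val_fst k l (v * v) (v • w) out

theorem headTail_appends (k : ℝ) (l : List (ℝ × σ.Row)) (hl : ∀ p ∈ l, 0 < p.1)
    (out : List σ.Row) :
    Appends out (headTail k l out).val.2 (l.length - 1) fun f =>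
      k ^ 2 * (sumSq f (unweighted l) - f (weightedSum l) ^ 2 / weightSq l) := by
  cases l with
  | nil =>
    exact (Appends.refl out).congr rfl fun f => by simp [weightedSum, weightSq, unweighted]
  | cons p l =>
    obtain ⟨v, w⟩ := p
    have hv : 0 < v := hl (v, w) (by simp)
    refine (headTailLoop_appends k l (mul_pos hv hv) (v • w) out).congr (by simp) fun f => ?_
    rw [weightSq_cons, weightedSum_cons, sumSq_unweighted_cons, map_smul, smul_eq_mul, mul_pow,
      ← sq v, mul_div_cancel_left₀ _ (pow_ne_zero 2 hv.ne')]
    ring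

end HeadTail

/-! ## Joins along the tree and their counts -/

section Joins

variable [DecidableEq κ] {σ : Schema r κ}

/-- The key tuple of a row, without the cost of computing it. -/
def keyTuple {i : Fin r} (t : σ.Tuple V i) : KeyTuple κ V := (keyOf t).val

/-- The projection of a key tuple onto its attributes in `X`, without the cost of computing it. -/
def restrict (X : Finset κ) (x : KeyTuple κ V) : KeyTuple κ V := (project X x).val

@[simp] theorem val_keyOf {i : Fin r} (t : σ.Tuple V i) : (keyOf t).val = keyTuple t := rfl

@[simp] theorem val_project (X : Finset κ) (x : KeyTuple κ V) :
    (project X x).val = restrict X x := rfl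

/-- The data of a row, padded with zeros in the columns of the other relations. A row of a join
is the sum of the padded rows that are joined. -/
def embed {i : Fin r} (t : σ.Tuple V i) : σ.Row := Pi.single i t.2

variable [Fintype κ] [DecidableEq V] (S : σ.Database V)

/-- The set of the key tuples that occur in relation `i`. -/
def keyTuples (i : Fin r) : Finset (KeyTuple κ V) := ((S i).map keyTuple).toFinset

/-- The padded data of the rows of relation `i` with key tuple `x`: the matrix `S_i^x`. -/
def group (i : Fin r) (x : KeyTuple κ V) : Multiset σ.Row :=
  ((S i).filter (keyTuple · = x)).map embed

/-- The data of the rows in the join of the relations in a forest that match the key tuple `x` of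
the parent `p` of the roots. Only matches along the edges of the forest are required. -/
def joinForest : Fin r → KeyTuple κ V → Forest (Fin r) → Multiset σ.Row
  | _, _, .nil => {0}
  | p, x, .node i cs rest =>
    sumset (∑ x' ∈ keyTuples S i with restrict (σ.key p) x' = restrict (σ.key i) x,
      sumset (group S i x') (joinForest i x' cs)) (joinForest p x rest)

/-- The data of the rows with key tuple `x` at the root `i` in the join of the relations in the tree
with root `i` and subtrees `cs`. -/
def joinTree (i : Fin r) (cs : Forest (Fin r)) (x : KeyTuple κ V) : Multiset σ.Row :=
  sumset (group S i x) (joinForest S i x cs)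

/-- The data of the rows with values `y` in the attributes shared with the parent `p` in the join of
the relations in the tree with root `i` and subtrees `cs`; its size is `Φ_i^↓(y)`. -/
def joinShared (p i : Fin r) (cs : Forest (Fin r)) (y : KeyTuple κ V) : Multiset σ.Row :=
  ∑ x ∈ keyTuples S i with restrict (σ.key p) x = y, joinTree S i cs x

theorem joinForest_nil (p : Fin r) (x : KeyTuple κ V) : joinForest S p x .nil = {0} := rfl

theorem joinForest_node (p i : Fin r) (x : KeyTuple κ V) (cs rest : Forest (Fin r)) :
    joinForest S p x (.node i cs rest) =
      sumset (joinShared S p i cs (restrict (σ.key i) x)) (joinForest S p x rest) := rfl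

/-- The values of the attributes that relation `i` shares with its parent `p`. -/
def sharedTuples (p i : Fin r) : Finset (KeyTuple κ V) :=
  (keyTuples S i).image (restrict (σ.key p))

theorem mem_keyTuples {i : Fin r} {x : KeyTuple κ V} :
    x ∈ keyTuples S i ↔ ∃ t ∈ S i, keyTuple t = x := by
  simp only [keyTuples, List.mem_toFinset, List.mem_map]

theorem group_eq_zero {i : Fin r} {x : KeyTuple κ V} (h : x ∉ keyTuples S i) :
    group S i x = 0 := by
  have : (S i).filter (keyTuple · = x) = [] := by
    simp only [List.filter_eq_nil_iff, decide_eq_true_eq]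
    exact fun t ht hx => h ((mem_keyTuples S).2 ⟨t, ht, hx⟩)
  simp [group, this]

theorem card_group_pos {i : Fin r} {x : KeyTuple κ V} (h : x ∈ keyTuples S i) :
    0 < (group S i x).card := by
  obtain ⟨t, ht, hx⟩ := (mem_keyTuples S).1 h
  rw [Multiset.card_pos_iff_exists_mem]
  refine ⟨embed t, ?_⟩
  simp only [group, Multiset.mem_coe, List.mem_map, List.mem_filter, decide_eq_true_eq]
  exact ⟨t, ⟨ht, hx⟩, rfl⟩

theorem sum_card_group (i : Fin r) :
    ∑ x ∈ keyTuples S i, (group S i x).card = (S i).length := by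
  simpa [group] using! sum_length_filter_eq (keyTuple (σ := σ) (i := i)) (S i)

theorem card_keyTuples_le (i : Fin r) : (keyTuples S i).card ≤ (S i).length := by
  simpa [keyTuples] using List.toFinset_card_le ((S i).map keyTuple)

theorem joinTree_eq_zero {i : Fin r} (cs : Forest (Fin r)) {x : KeyTuple κ V}
    (h : x ∉ keyTuples S i) : joinTree S i cs x = 0 := by
  simp [joinTree, group_eq_zero S h]

end Joins

theorem divide_val [Fintype κ] [DecidableEq V] {d e : KeyDict κ V ℝ} {s : Finset (KeyTuple κ V)}
    {f g : KeyTuple κ V → ℝ} (hd : d.Represents s f) (hf : ∀ x, x ∉ s → f x = 0)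
    (he : ∀ x, e.get x = g x) :
    (divide d e).val.Represents s fun x => f x / g x := by
  rw [divide, loop_val]
  refine (Dict.represents_foldl_set d.keys hd.nodup (fun x => d.get x / e.get x) 0 s hd.mem_keys
    fun x hx => ?_).congr rfl fun x => ?_
  · simp [hd.get_eq, hf x hx]
  · simp [hd.get_eq, he]

section Counts

variable [Fintype κ] [DecidableEq κ] [DecidableEq V] {σ : Schema r κ} (S : σ.Database V)

theorem countRows_val (i : Fin r) :
    (countRows S i).val.Represents (keyTuples S i) fun x => ((group S i x).card : ℝ) := by
  rw [countRows, loop_val]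
  refine ((Dict.represents_empty (0 : ℝ)).foldl_insert (keyTuple (σ := σ) (i := i))
    (fun _ b => b + 1) (S i)).congr (by simp [keyTuples]) fun x => ?_
  rw [foldl_add_eq_add_sum_map (fun _ : σ.Tuple V i => (1 : ℝ))]
  simp [group]

theorem sumOver_val (X : Finset κ) {d : KeyDict κ V ℝ} {s : Finset (KeyTuple κ V)}
    {g : KeyTuple κ V → ℝ} (h : d.Represents s g) :
    (sumOver X d).val.Represents (s.image (restrict X))
      fun y => ∑ x ∈ s with restrict X x = y, g x := by
  rw [sumOver, loop_val]
  refine ((Dict.represents_empty (0 : ℝ)).foldl_insert (restrict X)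
    (fun x b => b + d.get x) d.keys).congr ?_ fun y => ?_
  · rw [← h.toFinset]
    ext
    simp
  · rw [foldl_add_eq_add_sum_map, zero_add, ← List.sum_toFinset _ (h.nodup.filter _),
      List.toFinset_filter, h.toFinset]
    simp [h.get_eq]

theorem applyUp_val (X : Finset κ) {up theta : KeyDict κ V ℝ} {s : Finset (KeyTuple κ V)}
    {f g : KeyTuple κ V → ℝ} (ht : theta.Represents s f) (hf : ∀ x, x ∉ s → f x = 0)
    (hu : ∀ x, up.get x = g x) :
    (applyUp X up theta).val.Represents s fun x => f x * g (restrict X x) := by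
  rw [applyUp, loop_val]
  refine (Dict.represents_foldl_set theta.keys ht.nodup
    (fun x => theta.get x * up.get (restrict X x)) 0 s ht.mem_keys
    fun x hx => ?_).congr rfl fun x => ?_
  · simp [ht.get_eq, hf x hx]
  · simp [ht.get_eq, hu]

/-- The result `G` of the first pass on the forest `F` with parent `p` stores the correct counts at
every node. -/
inductive CountsSpec₁ : Fin r → Forest (Fin r) → Forest (Counts₁ r κ V) → Prop
  | nil (p : Fin r) : CountsSpec₁ p .nil .nil
  | node {p i : Fin r} {cs rest : Forest (Fin r)} {b : Counts₁ r κ V}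
      {cs' rest' : Forest (Counts₁ r κ V)} (idx : b.idx = i)
      (rowsPerKey : b.rowsPerKey.Represents (keyTuples S i) fun x => ((group S i x).card : ℝ))
      (theta : b.theta.Represents (keyTuples S i) fun x => ((joinTree S i cs x).card : ℝ))
      (down : b.down.Represents (sharedTuples S p i) fun y => ((joinShared S p i cs y).card : ℝ))
      (children : CountsSpec₁ i cs cs') (siblings : CountsSpec₁ p rest rest') :
      CountsSpec₁ p (.node i cs rest) (.node b cs' rest')

variable {S} in
theorem CountsSpec₁.foldl_roots {p : Fin r} {F : Forest (Fin r)} {G : Forest (Counts₁ r κ V)}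
    (h : CountsSpec₁ S p F G) (x : KeyTuple κ V) (c : ℝ) :
    G.roots.foldl (fun c b => c * b.down.get (restrict (σ.key b.idx) x)) c =
      c * (joinForest S p x F).card := by
  induction h generalizing c with
  | nil => simp [Forest.roots, joinForest_nil]
  | node idx _ _ down _ _ _ ih =>
    simp only [Forest.roots, List.foldl_cons, ih, down.get_eq, idx, joinForest_node, card_sumset]
    push_cast
    ring

theorem computeTheta_val {i : Fin r} {cs : Forest (Fin r)} {cs' : Forest (Counts₁ r κ V)}
    (h : CountsSpec₁ S i cs cs') {d : KeyDict κ V ℝ}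
    (hd : d.Represents (keyTuples S i) fun x => ((group S i x).card : ℝ)) :
    (computeTheta σ d cs'.roots).val.Represents (keyTuples S i)
      fun x => ((joinTree S i cs x).card : ℝ) := by
  rw [computeTheta, loop_val]
  simp only [Timed.val_bind, loop_val, Dict.val_lookup, val_mul, val_project, h.foldl_roots]
  refine (Dict.represents_foldl_set d.keys hd.nodup
    (fun x => d.get x * (joinForest S i x cs).card) 0 _ hd.mem_keys
    fun x hx => ?_).congr rfl fun x => ?_
  · simp [hd.get_eq, group_eq_zero S hx]
  · simp [hd.get_eq, joinTree]

theorem pass₁_val (p : Fin r) (F : Forest (Fin r)) : CountsSpec₁ S p F (pass₁ S p F).val := by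
  induction F generalizing p with
  | nil => exact .nil p
  | node i cs rest ih_children ih_siblings =>
    have theta := computeTheta_val S (ih_children i) (countRows_val S i)
    exact .node rfl (countRows_val S i) theta
      ((sumOver_val (σ.key p) theta).congr rfl fun y => by simp [joinShared])
      (ih_children i) (ih_siblings p)

/-- The count `Φ_i^↑` of the join of the relations outside the subtree of `i`, where `full` is the
size of the complete join per key tuple of the parent `p`. At values `y` that do not occur in `i`
the quotient is `0 / 0 = 0`. -/
noncomputable def upCount (p i : Fin r) (cs : Forest (Fin r)) (full : KeyTuple κ V → ℝ)
    (y : KeyTuple κ V) : ℝ :=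
  (∑ x ∈ keyTuples S p with restrict (σ.key i) x = y, full x) / (joinShared S p i cs y).card

/-- The size of the complete join per key tuple of `i`, where `full` is the same for the parent
`p`. -/
noncomputable def fullCount (p i : Fin r) (cs : Forest (Fin r)) (full : KeyTuple κ V → ℝ)
    (x : KeyTuple κ V) : ℝ :=
  (joinTree S i cs x).card * upCount S p i cs full (restrict (σ.key p) x)

/-- The result `G` of the second pass on the forest `F` with parent `p` stores the correct counts at
every node, where `full` is the size of the complete join per key tuple of `p`. -/
inductive CountsSpec₂ :
    Fin r → (KeyTuple κ V → ℝ) → Forest (Fin r) → Forest (Counts₂ r κ V) → Prop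
  | nil (p : Fin r) (full : KeyTuple κ V → ℝ) : CountsSpec₂ p full .nil .nil
  | node {p i : Fin r} {full : KeyTuple κ V → ℝ} {cs rest : Forest (Fin r)} {b : Counts₂ r κ V}
      {cs' rest' : Forest (Counts₂ r κ V)} (idx : b.idx = i)
      (rowsPerKey : ∀ x, b.rowsPerKey.get x = (group S i x).card)
      (down : ∀ y, b.down.get y = (joinShared S p i cs y).card)
      (up : ∀ y, b.up.get y = upCount S p i cs full y)
      (circ : ∀ x, b.circ.get x = fullCount S p i cs full x / (group S i x).card)
      (children : CountsSpec₂ i (fullCount S p i cs full) cs cs')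
      (siblings : CountsSpec₂ p full rest rest') :
      CountsSpec₂ p full (.node i cs rest) (.node b cs' rest')

theorem sumOver_divide_val {p i : Fin r} {cs : Forest (Fin r)} {full : KeyTuple κ V → ℝ}
    {d e : KeyDict κ V ℝ} (hd : d.Represents (keyTuples S p) full)
    (he : ∀ y, e.get y = (joinShared S p i cs y).card) :
    (divide (sumOver (σ.key i) d).val e).val.Represents
      ((keyTuples S p).image (restrict (σ.key i))) (upCount S p i cs full) := by
  refine divide_val (sumOver_val (σ.key i) hd) (fun y hy => ?_) he
  refine Finset.sum_eq_zero fun x hx => ?_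
  rw [Finset.mem_filter] at hx
  exact absurd (Finset.mem_image.2 ⟨x, hx⟩) hy

theorem pass₂_val {p : Fin r} {full : KeyTuple κ V → ℝ} {d : KeyDict κ V ℝ}
    {F : Forest (Fin r)} {G : Forest (Counts₁ r κ V)}
    (hd : d.Represents (keyTuples S p) full) (h : CountsSpec₁ S p F G) :
    CountsSpec₂ S p full F (pass₂ σ p d G).val := by
  induction h generalizing full d with
  | nil p => exact .nil p full
  | @node p i cs rest b cs' rest' idx rowsPerKey theta down _ _ ih_children ih_siblings =>
    subst idx
    have tree_eq_zero : ∀ x ∉ keyTuples S b.idx, ((joinTree S b.idx cs x).card : ℝ) = 0 :=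
      fun x hx => by simp [joinTree_eq_zero S cs hx]
    have up := sumOver_divide_val S hd down.get_eq
    have full' := applyUp_val (σ.key p) theta tree_eq_zero up.get_eq
    have circ := divide_val full' (fun x hx => by simp [tree_eq_zero x hx]) rowsPerKey.get_eq
    exact .node rfl rowsPerKey.get_eq down.get_eq up.get_eq circ.get_eq (ih_children full')
      (ih_siblings hd)

theorem computeCounts_val (τ : RootedTree (Fin r)) :
    (computeCounts S τ).val.root.idx = τ.root ∧
    (∀ x, (computeCounts S τ).val.root.rowsPerKey.get x = (group S τ.root x).card) ∧
    (∀ x, (computeCounts S τ).val.root.circ.get x =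
      (joinTree S τ.root τ.children x).card / (group S τ.root x).card) ∧
    CountsSpec₂ S τ.root (fun x => ((joinTree S τ.root τ.children x).card : ℝ)) τ.children
      (computeCounts S τ).val.children := by
  have rowsPerKey := countRows_val S τ.root
  have children := pass₁_val S τ.root τ.children
  have theta := computeTheta_val S children rowsPerKey
  have circ := divide_val theta (fun x hx => by simp [joinTree_eq_zero S τ.children hx])
    rowsPerKey.get_eq
  exact ⟨rfl, rowsPerKey.get_eq, circ.get_eq, pass₂_val S theta children⟩

end Counts

/-! ## Grouping and projecting at a node -/

theorem Dict.represents_foldl_push {α K β : Type} [DecidableEq K] (key : α → K) (f : α → β)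
    (l : List α) :
    (l.foldl (fun d a => (d.insert (key a) (d.get (key a) ++ [f a])).val)
      (empty ([] : List β))).Represents
      (l.map key).toFinset fun k => (l.filter (key · = k)).map f :=
  ((represents_empty ([] : List β)).foldl_insert key (fun a b => b ++ [f a]) l).congr (by simp)
    fun k => by rw [foldl_append_singleton, List.nil_append]

section ReduceGroups

variable [Fintype κ] [DecidableEq V] {σ : Schema r κ}

/-- The entries of `data` and `scales` are the scaled sums and the square roots of the sizes of
the families `T x`. This is the invariant of the working state. -/
structure StateSpec (data : KeyDict κ V σ.Row) (scales : KeyDict κ V ℝ)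
    (s : Finset (KeyTuple κ V)) (T : KeyTuple κ V → Multiset σ.Row) : Prop where
  data : data.Represents s fun x => (√(T x).card)⁻¹ • (T x).sum
  scales : scales.Represents s fun x => √(T x).card

/-- The effect of one iteration of `reduceGroups` on the state, where `g x` is the group with key
tuple `x`. -/
noncomputable def reduceStep (g : KeyTuple κ V → List (ℝ × σ.Row))
    (tailCount headCount : KeyTuple κ V → ℝ) (st : State σ V) (x : KeyTuple κ V) : State σ V :=
  ⟨(st.data.insert x (headTail √(tailCount x) (g x) st.out).val.1).val,
    (st.scales.insert x √(headCount x)).val,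
    (headTail √(tailCount x) (g x) st.out).val.2⟩

section ReduceStep

variable (g : KeyTuple κ V → List (ℝ × σ.Row)) (tailCount headCount : KeyTuple κ V → ℝ)
  (l : List (KeyTuple κ V)) (st : State σ V)

theorem foldl_reduceStep_data :
    (l.foldl (reduceStep g tailCount headCount) st).data =
      l.foldl (fun d x => (d.insert x ((√(weightSq (g x)))⁻¹ • weightedSum (g x))).val)
        st.data := by
  induction l generalizing st with
  | nil => rfl
  | cons x l ih => rw [List.foldl_cons, ih, List.foldl_cons, ← headTail_val_fst]; rfl

theorem foldl_reduceStep_scales :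
    (l.foldl (reduceStep g tailCount headCount) st).scales =
      l.foldl (fun d x => (d.insert x √(headCount x)).val) st.scales := by
  induction l generalizing st with
  | nil => rfl
  | cons x l ih => rw [List.foldl_cons, ih]; rfl

variable {g}

theorem foldl_reduceStep_appends (hpos : ∀ x, ∀ p ∈ g x, 0 < p.1) :
    Appends st.out (l.foldl (reduceStep g tailCount headCount) st).out
      (l.map fun x => (g x).length - 1).sum fun f => (l.map fun x => √(tailCount x) ^ 2 *
        (sumSq f (unweighted (g x)) - f (weightedSum (g x)) ^ 2 / weightSq (g x))).sum := by
  induction l generalizing st with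
  | nil => exact Appends.refl _
  | cons x l ih => exact (headTail_appends √(tailCount x) (g x) (hpos x) st.out).trans (ih _)

end ReduceStep

theorem reduceGroups_val {groups : KeyDict κ V (List (ℝ × σ.Row))} {s : Finset (KeyTuple κ V)}
    {g : KeyTuple κ V → List (ℝ × σ.Row)} {T : KeyTuple κ V → Multiset σ.Row}
    (hg : groups.Represents s g) (hpos : ∀ x, ∀ p ∈ g x, 0 < p.1)
    (weightSq_eq : ∀ x, weightSq (g x) = (T x).card)
    (weightedSum_eq : ∀ x, weightedSum (g x) = (T x).sum) (T_eq_zero : ∀ x ∉ s, T x = 0)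
    {tailCount headCount : KeyDict κ V ℝ} (tailCount_nonneg : ∀ x, 0 ≤ tailCount.get x)
    (headCount_eq : ∀ x, headCount.get x = (T x).card) (out : List σ.Row) :
    let st := (reduceGroups groups tailCount headCount out).val
    StateSpec st.data st.scales s T ∧
    Appends out st.out (∑ x ∈ s, ((g x).length - 1)) fun f => ∑ x ∈ s, tailCount.get x *
      (sumSq f (unweighted (g x)) - f (T x).sum ^ 2 / (T x).card) := by
  have val_eq : (reduceGroups groups tailCount headCount out).val =
      groups.keys.foldl (reduceStep g tailCount.get headCount.get)
        ⟨Dict.empty (fun _ _ => 0), Dict.empty 0, out⟩ := by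
    rw [reduceGroups, loop_val]
    simp only [Timed.val_bind, Dict.val_lookup, val_sqrt, Timed.val_pure, hg.get_eq]
    rfl
  simp only [val_eq]
  refine ⟨⟨?_, ?_⟩, ?_⟩
  · simp only [foldl_reduceStep_data, weightSq_eq, weightedSum_eq]
    refine Dict.represents_foldl_set _ hg.nodup _ _ s hg.mem_keys fun x hx => ?_
    rw [T_eq_zero x hx, Multiset.sum_zero, smul_zero]
    rfl
  · simp only [foldl_reduceStep_scales, headCount_eq]
    exact Dict.represents_foldl_set _ hg.nodup _ _ s hg.mem_keys fun x hx => by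
      simp [T_eq_zero x hx]
  · refine (foldl_reduceStep_appends tailCount.get headCount.get groups.keys
      ⟨Dict.empty (fun _ _ => 0), Dict.empty 0, out⟩ hpos).congr (hg.sum_keys _) fun f => ?_
    simp only [hg.sum_keys, Real.sq_sqrt (tailCount_nonneg _), weightSq_eq, weightedSum_eq]

end ReduceGroups

section UnitWeights

variable {E : Type*}

theorem weightSq_map_one (l : List E) : weightSq (l.map fun w => ((1 : ℝ), w)) = l.length := by
  simp [weightSq, Function.comp_def]

theorem unweighted_map_one (l : List E) : unweighted (l.map fun w => ((1 : ℝ), w)) = l := by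
  simp [unweighted, Function.comp_def]

theorem weightedSum_map_one [AddCommGroup E] [Module ℝ E] (l : List E) :
    weightedSum (l.map fun w => ((1 : ℝ), w)) = l.sum := by
  simp [weightedSum, Function.comp_def]

end UnitWeights

section HeadsAndTails

variable [Fintype κ] [DecidableEq κ] [DecidableEq V] {σ : Schema r κ} (S : σ.Database V)

theorem groupRows_val (i : Fin r) :
    (groupRows S i).val.Represents (keyTuples S i)
      fun x => (((S i).filter (keyTuple · = x)).map embed).map fun w => (1, w) := by
  rw [groupRows, loop_val]
  exact (Dict.represents_foldl_push (keyTuple (σ := σ) (i := i)) (fun t => (1, embed t))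
    (S i)).congr rfl fun x => by simp

theorem headsAndTails_val {i : Fin r} {b : Counts₂ r κ V} (hi : b.idx = i)
    (rowsPerKey : ∀ x, b.rowsPerKey.get x = (group S i x).card)
    (circ_nonneg : ∀ x, 0 ≤ b.circ.get x) (out : List σ.Row) :
    let st := (headsAndTails S b out).val
    StateSpec st.data st.scales (keyTuples S i) (group S i) ∧
    Appends out st.out ((S i).length - (keyTuples S i).card) fun f =>
      ∑ x ∈ keyTuples S i, b.circ.get x * ((group S i x).card * variance f (group S i x)) := by
  subst hi
  obtain ⟨state, appends⟩ := reduceGroups_val (groupRows_val S b.idx)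
    (by simp only [List.mem_map]; rintro x p ⟨w, -, rfl⟩; exact one_pos)
    (fun x => weightSq_map_one _) (fun x => weightedSum_map_one _)
    (fun x hx => group_eq_zero S hx) circ_nonneg rowsPerKey out
  refine ⟨state, appends.congr ?_ fun f => ?_⟩
  · have one_le : ∀ x ∈ keyTuples S b.idx, 1 ≤ (group S b.idx x).card :=
      fun x hx => card_group_pos S hx
    rw [← sum_card_group S b.idx, Finset.card_eq_sum_ones, ← Finset.sum_tsub_distrib _ one_le]
    simp [group]
  · simp only [unweighted_map_one, card_mul_variance]
    rfl

end HeadsAndTails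

section ProjectAway

variable [Fintype κ] [DecidableEq κ] [DecidableEq V] {σ : Schema r κ}

/-- The rows of `data` whose key tuples project to `y`, weighted by `scales`. -/
def scaledFiber (data : KeyDict κ V σ.Row) (scales : KeyDict κ V ℝ) (X : Finset κ)
    (y : KeyTuple κ V) : List (ℝ × σ.Row) :=
  (data.keys.filter (restrict X · = y)).map fun x => (scales.get x, data.get x)

namespace StateSpec

variable {data : KeyDict κ V σ.Row} {scales : KeyDict κ V ℝ} {s : Finset (KeyTuple κ V)}
  {T : KeyTuple κ V → Multiset σ.Row} (h : StateSpec data scales s T)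

include h

theorem sum_map_filter_keys {M : Type*} [AddCommMonoid M] (X : Finset κ) (y : KeyTuple κ V)
    (φ : KeyTuple κ V → M) :
    ((data.keys.filter (restrict X · = y)).map φ).sum = ∑ x ∈ s with restrict X x = y, φ x := by
  rw [← List.sum_toFinset _ (h.data.nodup.filter _), List.toFinset_filter, h.data.toFinset]
  simp

theorem length_scaledFiber (X : Finset κ) (y : KeyTuple κ V) :
    (scaledFiber data scales X y).length = (s.filter (restrict X · = y)).card := by
  rw [Finset.card_eq_sum_ones, ← h.sum_map_filter_keys]
  simp [scaledFiber]

theorem weightSq_scaledFiber (X : Finset κ) (y : KeyTuple κ V) :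
    weightSq (scaledFiber data scales X y) = (∑ x ∈ s with restrict X x = y, T x).card := by
  simp [weightSq, scaledFiber, Function.comp_def, h.sum_map_filter_keys, h.scales.get_eq]

theorem sumSq_unweighted_scaledFiber (f : σ.Row →ₗ[ℝ] ℝ) (X : Finset κ) (y : KeyTuple κ V) :
    sumSq f (unweighted (scaledFiber data scales X y)) =
      ∑ x ∈ s with restrict X x = y, f (T x).sum ^ 2 / (T x).card := by
  simp only [unweighted, sumSq, scaledFiber, List.map_map, Multiset.map_coe, Multiset.sum_coe,
    Function.comp_def, h.sum_map_filter_keys, h.data.get_eq]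
  refine Finset.sum_congr rfl fun x _ => ?_
  rw [map_smul, smul_eq_mul, mul_pow, inv_pow, Real.sq_sqrt (Nat.cast_nonneg _)]
  ring

variable (hT : ∀ x ∈ s, (T x).card ≠ 0)

include hT

theorem scaledFiber_pos (X : Finset κ) (y : KeyTuple κ V) :
    ∀ p ∈ scaledFiber data scales X y, 0 < p.1 := by
  simp only [scaledFiber, List.mem_map, List.mem_filter]
  rintro p ⟨x, ⟨hx, -⟩, rfl⟩
  rw [h.scales.get_eq, Real.sqrt_pos]
  exact_mod_cast Nat.pos_of_ne_zero (hT x ((h.data.mem_keys x).1 hx))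

theorem weightedSum_scaledFiber (X : Finset κ) (y : KeyTuple κ V) :
    weightedSum (scaledFiber data scales X y) = (∑ x ∈ s with restrict X x = y, T x).sum := by
  simp only [weightedSum, scaledFiber, List.map_map, Function.comp_def, h.sum_map_filter_keys,
    h.scales.get_eq, h.data.get_eq, Multiset.sum_sum]
  refine Finset.sum_congr rfl fun x hx => ?_
  have card_pos : (0 : ℝ) < (T x).card := by
    exact_mod_cast Nat.pos_of_ne_zero (hT x (Finset.mem_filter.1 hx).1)
  rw [smul_smul, mul_inv_cancel₀ (Real.sqrt_pos.2 card_pos).ne', one_smul]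

end StateSpec

variable (S : σ.Database V)

theorem joinShared_eq_zero {p i : Fin r} (cs : Forest (Fin r)) {y : KeyTuple κ V}
    (h : y ∉ sharedTuples S p i) : joinShared S p i cs y = 0 := by
  refine Finset.sum_eq_zero fun x hx => absurd ?_ h
  exact Finset.mem_image.2 ⟨x, Finset.mem_filter.1 hx⟩

theorem sum_card_fiber_sub_one (p i : Fin r) :
    ∑ y ∈ sharedTuples S p i, (((keyTuples S i).filter (restrict (σ.key p) · = y)).card - 1) =
      (keyTuples S i).card - (sharedTuples S p i).card := by
  have one_le : ∀ y ∈ sharedTuples S p i,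
      1 ≤ ((keyTuples S i).filter (restrict (σ.key p) · = y)).card := fun y hy => by
    obtain ⟨x, hx⟩ := Finset.mem_image.1 hy
    exact Finset.card_pos.2 ⟨x, Finset.mem_filter.2 hx⟩
  have card_eq : (keyTuples S i).card = _ := Finset.card_eq_sum_card_image (restrict (σ.key p)) _
  rw [Finset.sum_tsub_distrib _ one_le, ← Finset.card_eq_sum_ones, card_eq]
  rfl

theorem projectAway_val {p i : Fin r} {cs : Forest (Fin r)} {b : Counts₂ r κ V}
    (down : ∀ y, b.down.get y = (joinShared S p i cs y).card)
    (up_nonneg : ∀ y, 0 ≤ b.up.get y)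
    (card_ne_zero : ∀ x ∈ keyTuples S i, (joinTree S i cs x).card ≠ 0)
    {st : State σ V} (h : StateSpec st.data st.scales (keyTuples S i) (joinTree S i cs)) :
    let st' := (projectAway p b st).val
    StateSpec st'.data st'.scales (sharedTuples S p i) (joinShared S p i cs) ∧
    Appends st.out st'.out ((keyTuples S i).card - (sharedTuples S p i).card) fun f =>
      ∑ y ∈ sharedTuples S p i, b.up.get y *
        ((joinShared S p i cs y).card * variance f (joinShared S p i cs y) -
          ∑ x ∈ keyTuples S i with restrict (σ.key p) x = y,
            (joinTree S i cs x).card * variance f (joinTree S i cs x)) := by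
  have groups := (Dict.represents_foldl_push (restrict (σ.key p))
    (fun x => (st.scales.get x, st.data.get x)) st.data.keys).congr
      (t := sharedTuples S p i) (g := scaledFiber st.data st.scales (σ.key p))
      (by rw [sharedTuples, ← h.data.toFinset]; ext; simp) fun _ => rfl
  obtain ⟨state, appends⟩ := reduceGroups_val groups
    (h.scaledFiber_pos card_ne_zero _) (h.weightSq_scaledFiber _)
    (h.weightedSum_scaledFiber card_ne_zero _) (fun y hy => joinShared_eq_zero S cs hy)
    up_nonneg down st.out
  simp only [projectAway, Timed.val_bind, loop_val]
  refine ⟨state, appends.congr ?_ fun f => ?_⟩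
  · simp only [h.length_scaledFiber, sum_card_fiber_sub_one]
  · refine Finset.sum_congr rfl fun y _ => ?_
    simp only [h.sumSq_unweighted_scaledFiber, card_mul_variance, Finset.sum_sub_distrib,
      ← sumSq_sum]
    rw [joinShared]
    ring

end ProjectAway

theorem collectNodes_val {σ : Schema r κ} (i : Fin r) (bs : List (Result σ V)) :
    (collectNodes i bs).val = i :: bs.flatMap Result.nodes := by
  have push_all (l m : List (Fin r)) : (loop (fun l k => push l k) m l).val = l ++ m := by
    rw [loop_val]
    simpa using! foldl_append_singleton id m l
  have append_all (bs : List (Result σ V)) (l : List (Fin r)) :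
      bs.foldl (fun l b => l ++ b.nodes) l = l ++ bs.flatMap Result.nodes := by
    induction bs generalizing l with
    | nil => simp
    | cons b bs ih => simp [ih]
  rw [collectNodes, loop_val]
  simp only [push_all, append_all]
  rfl

section Mean

variable {E : Type*} [AddCommGroup E] [Module ℝ E]

/-- The mean of a finite family of vectors. At the empty family it is `0⁻¹ • 0 = 0`. -/
noncomputable def mean (T : Multiset E) : E := (T.card : ℝ)⁻¹ • T.sum

theorem mean_sumset {T U : Multiset E} (hT : T.card ≠ 0) (hU : U.card ≠ 0) :
    mean (sumset T U) = mean T + mean U := by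
  have hT₀ : (T.card : ℝ) ≠ 0 := by exact_mod_cast hT
  have hU₀ : (U.card : ℝ) ≠ 0 := by exact_mod_cast hU
  simp only [mean, sum_sumset, card_sumset, ← Nat.cast_smul_eq_nsmul ℝ, smul_add, smul_smul]
  push_cast
  congr 2 <;> field_simp

theorem inv_sqrt_card_sumset_smul_sum {T U : Multiset E} (hT : T.card ≠ 0) (hU : U.card ≠ 0) :
    (√(sumset T U).card)⁻¹ • (sumset T U).sum =
      (√U.card * (√T.card)⁻¹) • T.sum + (√T.card * √U.card) • mean U := by
  have hT₀ : (0 : ℝ) < T.card := by exact_mod_cast Nat.pos_of_ne_zero hT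
  have hU₀ : (0 : ℝ) < U.card := by exact_mod_cast Nat.pos_of_ne_zero hU
  have cancel_left : (√T.card * √U.card)⁻¹ * U.card = √U.card * (√T.card : ℝ)⁻¹ := by
    nth_rw 2 [← Real.mul_self_sqrt hU₀.le]
    field_simp
  have cancel_right : (√T.card * √U.card)⁻¹ * T.card = √T.card * √U.card * (U.card : ℝ)⁻¹ := by
    nth_rw 2 [← Real.mul_self_sqrt hT₀.le]
    nth_rw 3 [← Real.mul_self_sqrt hU₀.le]
    field_simp
  rw [mean, card_sumset, sum_sumset, Nat.cast_mul, Real.sqrt_mul hT₀.le, smul_add,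
    ← Nat.cast_smul_eq_nsmul ℝ, ← Nat.cast_smul_eq_nsmul ℝ, smul_smul, smul_smul, smul_smul,
    cancel_left, cancel_right]

end Mean

section Blocks

variable {σ : Schema r κ}

theorem foldl_update_apply (u w : σ.Row) (g : ℝ) (l : List (Fin r)) (k : Fin r) :
    l.foldl (fun w k => Function.update w k fun c => u k c * g) w k =
      if k ∈ l then fun c => u k c * g else w k := by
  induction l generalizing w with
  | nil => simp
  | cons a l ih =>
    rw [List.foldl_cons, ih]
    by_cases hl : k ∈ l
    · simp [hl]
    · by_cases ha : k = a
      · subst ha; simp [hl]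
      · simp [hl, ha]

theorem foldl_update_eq_add_smul_mean {T : Multiset σ.Row} (hT : T.card ≠ 0)
    {l : List (Fin r)} (hl : ∀ k ∉ l, T.sum k = 0) {w : σ.Row} (hw : ∀ k ∈ l, w k = 0) (a : ℝ) :
    l.foldl (fun w k => Function.update w k fun c =>
      ((√T.card)⁻¹ • T.sum) k c * (a / √T.card)) w = w + a • mean T := by
  have card_pos : (0 : ℝ) < T.card := by exact_mod_cast Nat.pos_of_ne_zero hT
  have inv_mul_inv : (√T.card : ℝ)⁻¹ * (√T.card)⁻¹ = (T.card : ℝ)⁻¹ := by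
    rw [← mul_inv, Real.mul_self_sqrt card_pos.le]
  funext k
  rw [foldl_update_apply, mean, ← inv_mul_inv]
  split_ifs with hk
  · funext c
    simp only [Pi.add_apply, Pi.smul_apply, smul_eq_mul, hw k hk, Pi.zero_apply, zero_add]
    ring
  · simp [hl k hk]

theorem sum_sum_apply_eq_zero {ι : Type*} (s : Finset ι) (T : ι → Multiset σ.Row) (k : Fin r)
    (h : ∀ x ∈ s, (T x).sum k = 0) : (∑ x ∈ s, T x).sum k = 0 := by
  rw [Multiset.sum_sum, Finset.sum_apply]
  exact Finset.sum_eq_zero h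

variable [Fintype κ] [DecidableEq κ] [DecidableEq V] (S : σ.Database V)

theorem sum_group_apply_eq_zero {i k : Fin r} (hk : k ≠ i) (x : KeyTuple κ V) :
    (group S i x).sum k = 0 := by
  have sum_map_embed (l : List (σ.Tuple V i)) : (l.map embed).sum k = 0 := by
    induction l with
    | nil => rfl
    | cons t l ih => simp [ih, embed, hk]
  exact sum_map_embed _

theorem sum_joinForest_apply_eq_zero (p : Fin r) (x : KeyTuple κ V) {F : Forest (Fin r)}
    {k : Fin r} (hk : k ∉ F.labels) : (joinForest S p x F).sum k = 0 := by
  induction F generalizing p x with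
  | nil => simp [joinForest_nil]
  | node i cs rest ih_children ih_siblings =>
    simp only [Forest.labels, List.mem_cons, List.mem_append, not_or] at hk
    have shared : (joinShared S p i cs (restrict (σ.key i) x)).sum k = 0 :=
      sum_sum_apply_eq_zero _ _ _ fun x _ => by
        simp [joinTree, sum_sumset, ih_children i x hk.2.1, sum_group_apply_eq_zero S hk.1]
    rw [joinForest_node, sum_sumset]
    simp [shared, ih_siblings p x hk.2.2]

theorem sum_joinShared_apply_eq_zero (p i : Fin r) (cs : Forest (Fin r)) (y : KeyTuple κ V)
    {k : Fin r} (hk : k ∉ i :: cs.labels) : (joinShared S p i cs y).sum k = 0 := by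
  simp only [List.mem_cons, not_or] at hk
  refine sum_sum_apply_eq_zero _ _ _ fun x _ => ?_
  simp [joinTree, sum_sumset, sum_joinForest_apply_eq_zero S i x hk.2,
    sum_group_apply_eq_zero S hk.1]

theorem update_smul_sum_group (i : Fin r) (x : KeyTuple κ V) (a b : ℝ) :
    (Function.update (a • (group S i x).sum) i fun c => (a • (group S i x).sum) i c * b) =
      (b * a) • (group S i x).sum := by
  funext k
  by_cases hk : k = i
  · subst hk
    funext c
    simp only [Function.update_self, Pi.smul_apply, smul_eq_mul]
    ring
  · simp [Function.update_of_ne hk, sum_group_apply_eq_zero S hk]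

end Blocks

section Results

variable [Fintype κ] [DecidableEq κ] [DecidableEq V] {σ : Schema r κ} (S : σ.Database V)

/-- The list of results is what the recursive calls should return for the trees of a forest with
parent `p`: one result per root, whose `data` and `scales` are those of the projected subtree
joins. -/
inductive ResultSpec : Fin r → Forest (Fin r) → List (Result σ V) → Prop
  | nil (p : Fin r) : ResultSpec p .nil []
  | node {p i : Fin r} {cs rest : Forest (Fin r)} {b : Result σ V} {bs : List (Result σ V)}
      (idx : b.idx = i) (nodes : b.nodes.Perm (i :: cs.labels))
      (scales : ∀ y, b.scales.get y = √(joinShared S p i cs y).card)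
      (data : ∀ y, b.data.get y =
        (√(joinShared S p i cs y).card)⁻¹ • (joinShared S p i cs y).sum)
      (siblings : ResultSpec p rest bs) : ResultSpec p (.node i cs rest) (b :: bs)

namespace ResultSpec

variable {S} {p : Fin r} {F : Forest (Fin r)} {bs : List (Result σ V)}

theorem nodes_perm (h : ResultSpec S p F bs) : (bs.flatMap Result.nodes).Perm F.labels := by
  induction h with
  | nil => rfl
  | node _ nodes _ _ _ ih => simpa [Forest.labels] using nodes.append ih

theorem foldl_scales (h : ResultSpec S p F bs) (x : KeyTuple κ V) (c : ℝ) :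
    bs.foldl (fun c b => c * b.scales.get (restrict (σ.key b.idx) x)) c =
      c * √(joinForest S p x F).card := by
  induction h generalizing c with
  | nil => simp [joinForest_nil]
  | node idx _ scales _ _ ih =>
    rw [List.foldl_cons, ih, scales, idx, joinForest_node, card_sumset, Nat.cast_mul,
      Real.sqrt_mul (Nat.cast_nonneg _), mul_assoc]

/-- Dividing `a` by the scale of a child and multiplying by its scaled sum leaves `a` times the
mean, and means add up under `sumset`. -/
theorem foldl_data (h : ResultSpec S p F bs) (hF : F.labels.Nodup) {x : KeyTuple κ V}
    (hx : (joinForest S p x F).card ≠ 0) (a : ℝ) {w : σ.Row} (hw : ∀ k ∈ F.labels, w k = 0) :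
    bs.foldl (fun w b => b.nodes.foldl (fun w k => Function.update w k fun c =>
        b.data.get (restrict (σ.key b.idx) x) k c *
          (a / b.scales.get (restrict (σ.key b.idx) x))) w) w =
      w + a • mean (joinForest S p x F) := by
  induction h generalizing w with
  | nil => simp [joinForest_nil, mean]
  | @node i cs rest b bs idx nodes scales data _ ih =>
    rw [joinForest_node, card_sumset] at hx
    have card_shared := left_ne_zero_of_mul hx
    have card_rest := right_ne_zero_of_mul hx
    change (i :: cs.labels ++ rest.labels).Nodup at hF
    change ∀ k ∈ i :: cs.labels ++ rest.labels, w k = 0 at hw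
    obtain ⟨-, nodup_rest, disjoint⟩ := List.nodup_append'.1 hF
    rw [List.foldl_cons, idx, data, scales, foldl_update_eq_add_smul_mean card_shared
      (fun k hk => sum_joinShared_apply_eq_zero S p i cs _ fun h => hk (nodes.mem_iff.2 h))
      (fun k hk => hw k (List.mem_append_left _ (nodes.mem_iff.1 hk))),
      ih nodup_rest card_rest, joinForest_node, mean_sumset card_shared card_rest, smul_add,
      add_assoc]
    intro k hk
    simp [hw k (List.mem_append_right _ hk), mean,
      sum_joinShared_apply_eq_zero S p i cs _ fun h => disjoint h hk]

end ResultSpec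

end Results

section JoinChildren

variable [Fintype κ] [DecidableEq V] {σ : Schema r κ}

theorem foldl_insert_state (A : KeyTuple κ V → ℝ → σ.Row → σ.Row) (B : KeyTuple κ V → ℝ → ℝ)
    {l : List (KeyTuple κ V)} (hl : l.Nodup) {st : State σ V} {s : Finset (KeyTuple κ V)}
    (hs : ∀ x ∈ l, x ∈ s) {f : KeyTuple κ V → σ.Row} {g : KeyTuple κ V → ℝ}
    (hf : st.data.Represents s f) (hg : st.scales.Represents s g) :
    let st' := l.foldl (fun (st : State σ V) x =>
      (⟨(st.data.insert x (A x (st.scales.get x) (st.data.get x))).val,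
        (st.scales.insert x (B x (st.scales.get x))).val, st.out⟩ : State σ V)) st
    st'.data.Represents s (fun x => if x ∈ l then A x (g x) (f x) else f x) ∧
    st'.scales.Represents s (fun x => if x ∈ l then B x (g x) else g x) ∧ st'.out = st.out := by
  induction l generalizing st f g with
  | nil => exact ⟨hf.congr rfl (by simp), hg.congr rfl (by simp), rfl⟩
  | cons a l ih =>
    have union_eq : s ∪ {a} = s := by simpa using hs a (by simp)
    obtain ⟨ha, hl⟩ := List.nodup_cons.1 hl
    obtain ⟨data, scales, out⟩ := ih hl (fun x hx => hs x (by simp [hx]))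
      (st := ⟨(st.data.insert a (A a (st.scales.get a) (st.data.get a))).val,
        (st.scales.insert a (B a (st.scales.get a))).val, st.out⟩)
      ((hf.insert a _).congr union_eq fun _ => rfl) ((hg.insert a _).congr union_eq fun _ => rfl)
    refine ⟨data.congr rfl fun x => ?_, scales.congr rfl fun x => ?_, out⟩
    all_goals
      by_cases hx : x = a
      · subst hx; simp [ha, hf.get_eq, hg.get_eq]
      · simp [hx]

variable [DecidableEq κ] {S : σ.Database V} {i : Fin r} {cs : Forest (Fin r)}
  {bs : List (Result σ V)}

/-- The row that `joinChildren` computes for the key tuple `x` from the scale `s` and the row `w`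
of `data`, where `a` is the product of the scales of all children. -/
noncomputable def joinedRow (i : Fin r) (bs : List (Result σ V)) (x : KeyTuple κ V) (a s : ℝ)
    (w : σ.Row) : σ.Row :=
  bs.foldl (fun w b => b.nodes.foldl (fun w k => Function.update w k fun c =>
      b.data.get (restrict (σ.key b.idx) x) k c *
        (s * a / b.scales.get (restrict (σ.key b.idx) x))) w)
    (Function.update w i fun c => w i c * a)

theorem ResultSpec.joinedRow_eq (h : ResultSpec S i cs bs) (hcs : (i :: cs.labels).Nodup)
    {x : KeyTuple κ V} (hx : x ∈ keyTuples S i) (hpos : (joinForest S i x cs).card ≠ 0) :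
    joinedRow i bs x √(joinForest S i x cs).card √(group S i x).card
        ((√(group S i x).card)⁻¹ • (group S i x).sum) =
      (√(joinTree S i cs x).card)⁻¹ • (joinTree S i cs x).sum := by
  obtain ⟨hi, nodup⟩ := List.nodup_cons.1 hcs
  rw [joinedRow, update_smul_sum_group, h.foldl_data nodup hpos, joinTree,
    inv_sqrt_card_sumset_smul_sum (card_group_pos S hx).ne' hpos]
  intro k hk
  have hki : k ≠ i := fun h => hi (h ▸ hk)
  simp [sum_group_apply_eq_zero S hki]

theorem ResultSpec.joinChildren_eq_foldl (h : ResultSpec S i cs bs) (st : State σ V) :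
    (joinChildren i bs st).val = st.data.keys.foldl (fun (st : State σ V) x =>
      (⟨(st.data.insert x (joinedRow i bs x √(joinForest S i x cs).card (st.scales.get x)
          (st.data.get x))).val,
        (st.scales.insert x (st.scales.get x * √(joinForest S i x cs).card)).val,
        st.out⟩ : State σ V)) st := by
  rw [joinChildren, loop_val]
  simp only [Timed.val_bind, loop_val, Dict.val_lookup, val_mul, val_project, val_div,
    val_setBlock, val_tabulate, val_cell, Timed.val_pure, h.foldl_scales, one_mul, joinedRow]

theorem joinChildren_val (h : ResultSpec S i cs bs) (hcs : (i :: cs.labels).Nodup)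
    (hpos : ∀ x ∈ keyTuples S i, (joinForest S i x cs).card ≠ 0) {st : State σ V}
    (hst : StateSpec st.data st.scales (keyTuples S i) (group S i)) :
    let st' := (joinChildren i bs st).val
    StateSpec st'.data st'.scales (keyTuples S i) (joinTree S i cs) ∧ st'.out = st.out := by
  obtain ⟨data, scales, out⟩ := foldl_insert_state
    (fun x s w => joinedRow i bs x √(joinForest S i x cs).card s w)
    (fun x s => s * √(joinForest S i x cs).card) hst.data.nodup
    (fun x hx => (hst.data.mem_keys x).1 hx) hst.data hst.scales
  simp only [h.joinChildren_eq_foldl st]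
  refine ⟨⟨data.congr rfl fun x => ?_, scales.congr rfl fun x => ?_⟩, out⟩
  all_goals
    simp only [hst.data.mem_keys]
    split_ifs with hx
  · exact h.joinedRow_eq hcs hx (hpos x hx)
  · simp [group_eq_zero S hx, joinTree_eq_zero S cs hx]
  · rw [joinTree, card_sumset, Nat.cast_mul, Real.sqrt_mul (Nat.cast_nonneg _)]
  · simp [group_eq_zero S hx, joinTree_eq_zero S cs hx]

end JoinChildren

/-! ## The rows output by FiGaRo -/

section Restrict

variable [DecidableEq κ] {σ : Schema r κ}

theorem restrict_keyTuple {X : Finset κ} {i : Fin r} (h : σ.key i ⊆ X) (t : σ.Tuple V i) :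
    restrict X (keyTuple t) = keyTuple t := by
  funext a
  change (if a ∈ X then _ else _) = _
  split_ifs with ha
  · rfl
  · exact .symm (dif_neg (c := a ∈ σ.key i) fun h' => ha (h h'))

variable [Fintype κ] [DecidableEq V] (S : σ.Database V)

theorem restrict_eq_self {X : Finset κ} {i : Fin r} (h : σ.key i ⊆ X) {x : KeyTuple κ V}
    (hx : x ∈ keyTuples S i) : restrict X x = x := by
  obtain ⟨t, -, rfl⟩ := (mem_keyTuples S).1 hx
  exact restrict_keyTuple h t

theorem filter_restrict_eq {X : Finset κ} {i : Fin r} (h : σ.key i ⊆ X) {y : KeyTuple κ V}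
    (hy : y ∈ keyTuples S i) : {x ∈ keyTuples S i | restrict X x = y} = {y} := by
  rw [Finset.filter_congr fun x hx => by rw [restrict_eq_self S h hx], Finset.filter_eq',
    if_pos hy]

theorem sharedTuples_eq_keyTuples {p i : Fin r} (h : σ.key i ⊆ σ.key p) :
    sharedTuples S p i = keyTuples S i :=
  (Finset.image_congr fun _ hx => restrict_eq_self S h hx).trans Finset.image_id

theorem joinTree_nil (i : Fin r) (x : KeyTuple κ V) : joinTree S i .nil x = group S i x := by
  simp [joinTree, joinForest_nil]

theorem joinShared_nil {p i : Fin r} (h : σ.key i ⊆ σ.key p) (y : KeyTuple κ V) :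
    joinShared S p i .nil y = group S i y := by
  by_cases hy : y ∈ keyTuples S i
  · rw [joinShared, filter_restrict_eq S h hy, Finset.sum_singleton, joinTree_nil]
  · rw [joinShared_eq_zero S .nil (by rwa [sharedTuples_eq_keyTuples S h]), group_eq_zero S hy]

theorem card_sharedTuples_le (p i : Fin r) :
    (sharedTuples S p i).card ≤ (keyTuples S i).card := Finset.card_image_le

end Restrict

section Consistency

/-- Every tuple of a relation agrees with some tuple of every other relation on the key attributes
that the two relations share. This is the consequence of full reduction that makes all counts
positive. -/
def PairwiseConsistent [DecidableEq κ] {σ : Schema r κ} (S : σ.Database V) : Prop :=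
  ∀ i j, ∀ t ∈ S i, ∃ t' ∈ S j, restrict (σ.key i) (keyTuple t') = restrict (σ.key j) (keyTuple t)

variable [Fintype κ] [DecidableEq κ] [DecidableEq V] {σ : Schema r κ} {S : σ.Database V}

theorem card_joinShared_ne_zero {p i : Fin r} {cs : Forest (Fin r)}
    (hcs : ∀ x ∈ keyTuples S i, (joinTree S i cs x).card ≠ 0) {y : KeyTuple κ V}
    (hy : y ∈ sharedTuples S p i) : (joinShared S p i cs y).card ≠ 0 := by
  obtain ⟨x, hx, hxy⟩ := Finset.mem_image.1 hy
  rw [joinShared, Multiset.card_sum, ← Nat.pos_iff_ne_zero]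
  exact Finset.sum_pos' (fun _ _ => Nat.zero_le _)
    ⟨x, Finset.mem_filter.2 ⟨hx, hxy⟩, Nat.pos_of_ne_zero (hcs x hx)⟩

namespace PairwiseConsistent

variable (hS : PairwiseConsistent S)
include hS

theorem restrict_mem {p : Fin r} (i : Fin r) {x : KeyTuple κ V} (hx : x ∈ keyTuples S p) :
    restrict (σ.key i) x ∈ sharedTuples S p i := by
  obtain ⟨t, ht, rfl⟩ := (mem_keyTuples S).1 hx
  obtain ⟨t', ht', h⟩ := hS p i t ht
  exact Finset.mem_image.2 ⟨_, (mem_keyTuples S).2 ⟨t', ht', rfl⟩, h⟩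

theorem sharedTuples_comm (p i : Fin r) : sharedTuples S p i = sharedTuples S i p :=
  Finset.Subset.antisymm (Finset.image_subset_iff.2 fun _ => hS.restrict_mem p)
    (Finset.image_subset_iff.2 fun _ => hS.restrict_mem i)

theorem card_joinForest_ne_zero {p : Fin r} (F : Forest (Fin r)) {x : KeyTuple κ V}
    (hx : x ∈ keyTuples S p) : (joinForest S p x F).card ≠ 0 := by
  induction F generalizing p x with
  | nil => simp [joinForest_nil]
  | node i cs rest ih_children ih_siblings =>
    rw [joinForest_node, card_sumset]
    refine mul_ne_zero (card_joinShared_ne_zero (fun x' hx' => ?_) (hS.restrict_mem i hx))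
      (ih_siblings hx)
    rw [joinTree, card_sumset]
    exact mul_ne_zero (card_group_pos S hx').ne' (ih_children hx')

theorem card_joinTree_ne_zero {i : Fin r} (cs : Forest (Fin r)) {x : KeyTuple κ V}
    (hx : x ∈ keyTuples S i) : (joinTree S i cs x).card ≠ 0 := by
  rw [joinTree, card_sumset]
  exact mul_ne_zero (card_group_pos S hx).ne' (hS.card_joinForest_ne_zero cs hx)

theorem card_joinShared_ne_zero {p i : Fin r} (cs : Forest (Fin r)) {y : KeyTuple κ V}
    (hy : y ∈ sharedTuples S p i) : (joinShared S p i cs y).card ≠ 0 :=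
  Figaro.card_joinShared_ne_zero (fun _ hx => hS.card_joinTree_ne_zero cs hx) hy

end PairwiseConsistent

end Consistency

section CountIdentities

variable [Fintype κ] [DecidableEq κ] [DecidableEq V] {σ : Schema r κ}

theorem upCount_nonneg (S : σ.Database V) {p i : Fin r} {cs : Forest (Fin r)}
    {full : KeyTuple κ V → ℝ} (h : ∀ x, 0 ≤ full x) (y : KeyTuple κ V) :
    0 ≤ upCount S p i cs full y :=
  div_nonneg (Finset.sum_nonneg fun x _ => h x) (Nat.cast_nonneg _)

theorem fullCount_nonneg (S : σ.Database V) {p i : Fin r} {cs : Forest (Fin r)}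
    {full : KeyTuple κ V → ℝ} (h : ∀ x, 0 ≤ full x) (x : KeyTuple κ V) :
    0 ≤ fullCount S p i cs full x :=
  mul_nonneg (Nat.cast_nonneg _) (upCount_nonneg S h _)

theorem sum_fullCount_mul (S : σ.Database V) (p i : Fin r) (cs : Forest (Fin r))
    (full φ : KeyTuple κ V → ℝ) :
    ∑ x ∈ keyTuples S i, fullCount S p i cs full x * φ x =
      ∑ y ∈ sharedTuples S p i, upCount S p i cs full y *
        ∑ x ∈ keyTuples S i with restrict (σ.key p) x = y, (joinTree S i cs x).card * φ x := by
  rw [← Finset.sum_fiberwise_of_maps_to (t := sharedTuples S p i)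
    (g := fun x => restrict (σ.key p) x) fun x hx => Finset.mem_image_of_mem _ hx]
  refine Finset.sum_congr rfl fun y _ => ?_
  rw [Finset.mul_sum]
  refine Finset.sum_congr rfl fun x hx => ?_
  rw [fullCount, (Finset.mem_filter.1 hx).2]
  ring

namespace PairwiseConsistent

variable {S : σ.Database V} (hS : PairwiseConsistent S)
include hS

theorem sum_upCount_mul (p i : Fin r) (cs : Forest (Fin r)) (full φ : KeyTuple κ V → ℝ) :
    ∑ y ∈ sharedTuples S p i, upCount S p i cs full y * ((joinShared S p i cs y).card * φ y) =
      ∑ x ∈ keyTuples S p, full x * φ (restrict (σ.key i) x) := by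
  rw [← Finset.sum_fiberwise_of_maps_to (t := sharedTuples S p i)
    (g := fun x => restrict (σ.key i) x) fun x hx => hS.restrict_mem i hx]
  refine Finset.sum_congr rfl fun y hy => ?_
  have card_ne_zero : ((joinShared S p i cs y).card : ℝ) ≠ 0 := by
    exact_mod_cast hS.card_joinShared_ne_zero cs hy
  rw [upCount, ← mul_assoc, div_mul_cancel₀ _ card_ne_zero, Finset.sum_mul]
  exact Finset.sum_congr rfl fun x hx => by rw [(Finset.mem_filter.1 hx).2]

theorem sum_upCount_mul_sub (p i : Fin r) (cs : Forest (Fin r)) (full : KeyTuple κ V → ℝ)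
    (f : σ.Row →ₗ[ℝ] ℝ) :
    ∑ y ∈ sharedTuples S p i, upCount S p i cs full y *
        ((joinShared S p i cs y).card * variance f (joinShared S p i cs y) -
          ∑ x ∈ keyTuples S i with restrict (σ.key p) x = y,
            (joinTree S i cs x).card * variance f (joinTree S i cs x)) =
      ∑ x ∈ keyTuples S p, full x * variance f (joinShared S p i cs (restrict (σ.key i) x)) -
        ∑ x ∈ keyTuples S i, fullCount S p i cs full x * variance f (joinTree S i cs x) := by
  simp only [mul_sub, Finset.sum_sub_distrib]
  rw [hS.sum_upCount_mul p i cs full fun y => variance f (joinShared S p i cs y),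
    sum_fullCount_mul]

theorem sum_circ_mul_add {i : Fin r} (cs : Forest (Fin r)) (full : KeyTuple κ V → ℝ)
    (f : σ.Row →ₗ[ℝ] ℝ) :
    ∑ x ∈ keyTuples S i, full x / (group S i x).card *
        ((group S i x).card * variance f (group S i x)) +
      ∑ x ∈ keyTuples S i, full x * variance f (joinForest S i x cs) =
      ∑ x ∈ keyTuples S i, full x * variance f (joinTree S i cs x) := by
  rw [← Finset.sum_add_distrib]
  refine Finset.sum_congr rfl fun x hx => ?_
  have card_ne_zero : ((group S i x).card : ℝ) ≠ 0 := by
    exact_mod_cast (card_group_pos S hx).ne'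
  rw [joinTree, variance_sumset f (card_group_pos S hx).ne' (hS.card_joinForest_ne_zero cs hx),
    ← mul_assoc, div_mul_cancel₀ _ card_ne_zero, mul_add]

end PairwiseConsistent

end CountIdentities

section FinishNode

variable [Fintype κ] [DecidableEq κ] [DecidableEq V] {σ : Schema r κ}

/-- The computation at a node after the calls for its children, whose results are `bs` and whose
output is `out`; `processForest` contains it as a `match`. -/
noncomputable def finishNode (p : Fin r) (b : Counts₂ r κ V) (bs : List (Result σ V))
    (st : State σ V) (out : List σ.Row) : Timed (State σ V) :=
  match bs with
  | [] => pure st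
  | _ :: _ => do
    let st₁ ← joinChildren b.idx bs ⟨st.data, st.scales, out⟩
    projectAway p b st₁

theorem processForest_node (S : σ.Database V) (p : Fin r) (b : Counts₂ r κ V)
    (cs rest : Forest (Counts₂ r κ V)) (out : List σ.Row) :
    processForest S p (.node b cs rest) out = (do
      tick
      let st ← headsAndTails S b out
      let sub ← processForest S b.idx cs st.out
      let nodes ← collectNodes b.idx sub.1
      let st' ← finishNode p b sub.1 st sub.2
      let others ← processForest S p rest st'.out
      pure (⟨b.idx, nodes, st'.data, st'.scales⟩ :: others.1, others.2)) := by
  rw [processForest]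
  congr! 8 with _ st ⟨bs, out'⟩ nodes
  cases bs
  · rfl
  · exact (Timed.bind_assoc _ _ _).symm

variable {S : σ.Database V}

theorem finishNode_nil_val (hS : PairwiseConsistent S) {p i : Fin r} (hi : σ.key i ⊆ σ.key p)
    (full : KeyTuple κ V → ℝ) (b : Counts₂ r κ V) {st : State σ V}
    (hst : StateSpec st.data st.scales (keyTuples S i) (group S i)) :
    let st' := (finishNode p b [] st st.out).val
    StateSpec st'.data st'.scales (sharedTuples S p i) (joinShared S p i .nil) ∧
    Appends st.out st'.out ((keyTuples S i).card - (sharedTuples S p i).card) fun f =>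
      ∑ x ∈ keyTuples S p, full x * variance f (joinShared S p i .nil (restrict (σ.key i) x)) -
        ∑ x ∈ keyTuples S i, fullCount S p i .nil full x * variance f (joinTree S i .nil x) := by
  refine ⟨?_, (Appends.refl st.out).congr ?_ fun f => ?_⟩
  · rw [sharedTuples_eq_keyTuples S hi, funext (joinShared_nil S hi)]
    exact hst
  · rw [sharedTuples_eq_keyTuples S hi, Nat.sub_self]
  · rw [← hS.sum_upCount_mul_sub, sharedTuples_eq_keyTuples S hi]
    refine (Finset.sum_eq_zero fun y hy => ?_).symm
    rw [filter_restrict_eq S hi hy, Finset.sum_singleton, joinShared_nil S hi, joinTree_nil,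
      sub_self, mul_zero]

theorem finishNode_cons_val (hS : PairwiseConsistent S) {p i : Fin r} {cs : Forest (Fin r)}
    (nodup : (i :: cs.labels).Nodup) {full : KeyTuple κ V → ℝ} (full_nonneg : ∀ x, 0 ≤ full x)
    {b : Counts₂ r κ V} (idx : b.idx = i)
    (down : ∀ y, b.down.get y = (joinShared S p i cs y).card)
    (up : ∀ y, b.up.get y = upCount S p i cs full y)
    {b' : Result σ V} {bs : List (Result σ V)} (results : ResultSpec S i cs (b' :: bs))
    {st : State σ V} (hst : StateSpec st.data st.scales (keyTuples S i) (group S i))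
    (out : List σ.Row) :
    let st' := (finishNode p b (b' :: bs) st out).val
    StateSpec st'.data st'.scales (sharedTuples S p i) (joinShared S p i cs) ∧
    Appends out st'.out ((keyTuples S i).card - (sharedTuples S p i).card) fun f =>
      ∑ x ∈ keyTuples S p, full x * variance f (joinShared S p i cs (restrict (σ.key i) x)) -
        ∑ x ∈ keyTuples S i, fullCount S p i cs full x * variance f (joinTree S i cs x) := by
  subst idx
  obtain ⟨joined, out_eq⟩ := joinChildren_val results nodup
    (fun x hx => hS.card_joinForest_ne_zero cs hx) (st := ⟨st.data, st.scales, out⟩) hst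
  obtain ⟨spec, appends⟩ := projectAway_val S down
    (fun y => by rw [up]; exact upCount_nonneg S full_nonneg y)
    (fun x hx => hS.card_joinTree_ne_zero cs hx) joined
  rw [out_eq] at appends
  simp only [up, hS.sum_upCount_mul_sub] at appends
  exact ⟨spec, appends⟩

end FinishNode

section ProcessForest

/-- The leaves of a forest with parent `p` have no key attributes that their parents do not have.
The algorithm relies on this, since it does not project the result for a leaf. -/
def LeafKeys (σ : Schema r κ) : Fin r → Forest (Fin r) → Prop
  | _, .nil => True
  | p, .node i cs rest => (cs = .nil → σ.key i ⊆ σ.key p) ∧ LeafKeys σ i cs ∧ LeafKeys σ p rest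

variable [Fintype κ] [DecidableEq κ] [DecidableEq V] {σ : Schema r κ}

/-- The number of rows that are output for the relations in a forest with parent `p`. -/
def outLength (S : σ.Database V) : Fin r → Forest (Fin r) → ℕ
  | _, .nil => 0
  | p, .node i cs rest =>
    (S i).length + outLength S i cs - (sharedTuples S p i).card + outLength S p rest

variable {S : σ.Database V}

theorem CountsSpec₂.finishNode_val (hS : PairwiseConsistent S) {p i : Fin r}
    {cs : Forest (Fin r)} {cs' : Forest (Counts₂ r κ V)} {full full' : KeyTuple κ V → ℝ}
    (counts : CountsSpec₂ S i full' cs cs') (nodup : (i :: cs.labels).Nodup)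
    (leaf : cs = .nil → σ.key i ⊆ σ.key p) (full_nonneg : ∀ x, 0 ≤ full x)
    {b : Counts₂ r κ V} (idx : b.idx = i)
    (down : ∀ y, b.down.get y = (joinShared S p i cs y).card)
    (up : ∀ y, b.up.get y = upCount S p i cs full y) {st : State σ V}
    (hst : StateSpec st.data st.scales (keyTuples S i) (group S i))
    (results : ResultSpec S i cs (processForest S i cs' st.out).val.1) :
    let sub := (processForest S i cs' st.out).val
    let st' := (finishNode p b sub.1 st sub.2).val
    StateSpec st'.data st'.scales (sharedTuples S p i) (joinShared S p i cs) ∧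
    Appends sub.2 st'.out ((keyTuples S i).card - (sharedTuples S p i).card) fun f =>
      ∑ x ∈ keyTuples S p, full x * variance f (joinShared S p i cs (restrict (σ.key i) x)) -
        ∑ x ∈ keyTuples S i, fullCount S p i cs full x * variance f (joinTree S i cs x) := by
  cases counts with
  | nil => exact finishNode_nil_val hS (leaf rfl) full b hst
  | node =>
    rw [processForest_node] at results ⊢
    exact finishNode_cons_val hS nodup full_nonneg idx down up results hst _

theorem CountsSpec₂.processForest_val (hS : PairwiseConsistent S) {p : Fin r}
    {full : KeyTuple κ V → ℝ} {F : Forest (Fin r)} {G : Forest (Counts₂ r κ V)}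
    (counts : CountsSpec₂ S p full F G) (full_nonneg : ∀ x, 0 ≤ full x) (nodup : F.labels.Nodup)
    (leaf : LeafKeys σ p F) (out : List σ.Row) :
    ResultSpec S p F (processForest S p G out).val.1 ∧
    Appends out (processForest S p G out).val.2 (outLength S p F) fun f =>
      ∑ x ∈ keyTuples S p, full x * variance f (joinForest S p x F) := by
  induction counts generalizing out with
  | nil p full =>
    refine ⟨.nil p, (Appends.refl out).congr rfl fun f => ?_⟩
    simp [joinForest_nil, variance, sumSq]
  | @node p i full cs rest b cs' rest' idx rowsPerKey down up circ children _ ih_children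
      ih_siblings =>
    subst idx
    obtain ⟨leaf_node, leaf_children, leaf_siblings⟩ := leaf
    obtain ⟨nodup_tree, nodup_siblings, -⟩ :=
      List.nodup_append'.1 (show (b.idx :: cs.labels ++ rest.labels).Nodup from nodup)
    have full'_nonneg := fullCount_nonneg S (p := p) (i := b.idx) (cs := cs) full_nonneg
    obtain ⟨heads, appends_tails⟩ := headsAndTails_val S rfl rowsPerKey
      (fun x => by rw [circ]; exact div_nonneg (full'_nonneg x) (Nat.cast_nonneg _)) out
    obtain ⟨results_children, appends_children⟩ := ih_children full'_nonneg
      (List.nodup_cons.1 nodup_tree).2 leaf_children (headsAndTails S b out).val.out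
    obtain ⟨finished, appends_finish⟩ := children.finishNode_val hS (p := p) nodup_tree leaf_node
      full_nonneg rfl down up heads results_children
    rw [processForest_node]
    simp only [Timed.val_bind, Timed.val_pure]
    obtain ⟨results_siblings, appends_siblings⟩ := ih_siblings full_nonneg nodup_siblings
      leaf_siblings (finishNode p b _ _ _).val.out
    refine ⟨.node rfl ?_ finished.scales.get_eq finished.data.get_eq results_siblings,
      (((appends_tails.trans appends_children).trans appends_finish).trans
        appends_siblings).congr ?_ fun f => ?_⟩
    · rw [collectNodes_val]
      exact results_children.nodes_perm.cons _
    · have card_sharedTuples := card_sharedTuples_le S p b.idx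
      have card_keyTuples := card_keyTuples_le S b.idx
      rw [outLength]
      omega
    · simp only [circ]
      rw [hS.sum_circ_mul_add, add_sub_cancel, ← Finset.sum_add_distrib]
      refine Finset.sum_congr rfl fun x hx => ?_
      rw [joinForest_node, variance_sumset f
        (hS.card_joinShared_ne_zero cs (hS.restrict_mem b.idx hx))
        (hS.card_joinForest_ne_zero rest hx), mul_add]

end ProcessForest

section OutputRows

variable [Fintype κ] [DecidableEq κ] [DecidableEq V] {σ : Schema r κ}

/-- The data rows of the join of all relations, assembled along the rooted tree `τ`. -/
def joinRows (S : σ.Database V) (τ : RootedTree (Fin r)) : Multiset σ.Row :=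
  ∑ x ∈ keyTuples S τ.root, joinTree S τ.root τ.children x

variable {S : σ.Database V} {τ : RootedTree (Fin r)}

theorem exists_figaro_val_eq_append (hS : PairwiseConsistent S) (nodup : τ.labels.Nodup)
    (leaf : LeafKeys σ τ.root τ.children) :
    ∃ (out : List σ.Row) (data : KeyDict κ V σ.Row),
      (figaro S τ).val = out ++ data.keys.map data.get ∧
      Appends [] out ((S τ.root).length - (keyTuples S τ.root).card +
        outLength S τ.root τ.children) (fun f => ∑ x ∈ keyTuples S τ.root,
          (joinTree S τ.root τ.children x).card * variance f (joinTree S τ.root τ.children x)) ∧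
      data.Represents (keyTuples S τ.root) fun x =>
        (√(joinTree S τ.root τ.children x).card)⁻¹ • (joinTree S τ.root τ.children x).sum := by
  obtain ⟨idx, rowsPerKey, circ, counts⟩ := computeCounts_val S τ
  obtain ⟨heads, appends_tails⟩ := headsAndTails_val S idx rowsPerKey
    (fun x => by rw [circ]; positivity) []
  set t := (computeCounts S τ).val
  set st := (headsAndTails S t.root []).val
  obtain ⟨results, appends_children⟩ := counts.processForest_val hS (fun x => by positivity)
    (List.nodup_cons.1 nodup).2 leaf st.out
  rw [← idx] at results appends_children
  set sub := (processForest S t.root.idx t.children st.out).val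
  obtain ⟨joined, out_eq⟩ := joinChildren_val results (idx ▸ nodup)
    (fun x hx => hS.card_joinForest_ne_zero _ hx) (st := ⟨st.data, st.scales, sub.2⟩) (idx ▸ heads)
  set st' := (joinChildren t.root.idx sub.1 ⟨st.data, st.scales, sub.2⟩).val
  refine ⟨sub.2, st'.data, ?_,
    (appends_tails.trans appends_children).congr (by rw [idx]) fun f => ?_, ?_⟩
  · rw [show sub.2 = st'.out from out_eq.symm]
    simp only [figaro, Timed.val_bind, loop_val, Dict.val_lookup, val_push]
    exact foldl_append_singleton _ _ _
  · simp only [circ, idx]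
    exact hS.sum_circ_mul_add τ.children _ f
  · rw [← idx]
    exact joined.data

theorem length_figaro (hS : PairwiseConsistent S) (nodup : τ.labels.Nodup)
    (leaf : LeafKeys σ τ.root τ.children) :
    (figaro S τ).val.length = (S τ.root).length + outLength S τ.root τ.children := by
  obtain ⟨out, data, figaro_eq, ⟨new, rfl, length_new, -⟩, represents⟩ :=
    exists_figaro_val_eq_append hS nodup leaf
  have card_keyTuples := card_keyTuples_le S τ.root
  rw [figaro_eq, List.length_append, List.length_map, represents.length_keys, length_new]
  omega

theorem sumSq_figaro (hS : PairwiseConsistent S) (nodup : τ.labels.Nodup)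
    (leaf : LeafKeys σ τ.root τ.children) (f : σ.Row →ₗ[ℝ] ℝ) :
    sumSq f (figaro S τ).val = sumSq f (joinRows S τ) := by
  obtain ⟨out, data, figaro_eq, ⟨new, rfl, -, sumSq_new⟩, represents⟩ :=
    exists_figaro_val_eq_append hS nodup leaf
  have sumSq_data : sumSq f (data.keys.map data.get : List σ.Row) =
      ∑ x ∈ keyTuples S τ.root, f (joinTree S τ.root τ.children x).sum ^ 2 /
        (joinTree S τ.root τ.children x).card := by
    simp only [sumSq, Multiset.map_coe, Multiset.sum_coe, List.map_map]
    rw [represents.sum_keys]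
    refine Finset.sum_congr rfl fun x _ => ?_
    simp only [Function.comp, represents.get_eq, map_smul, smul_eq_mul, mul_pow, inv_pow,
      Real.sq_sqrt (Nat.cast_nonneg _)]
    ring
  rw [figaro_eq, ← Multiset.coe_add, sumSq_add, sumSq_new, sumSq_data, joinRows,
    sumSq_sum, ← Finset.sum_add_distrib]
  exact Finset.sum_congr rfl fun x _ => by rw [card_mul_variance, sub_add_cancel]

theorem PairwiseConsistent.card_keyTuples_root_le (hS : PairwiseConsistent S) :
    (keyTuples S τ.root).card ≤ (joinRows S τ).card := by
  rw [joinRows, Multiset.card_sum, Finset.card_eq_sum_ones]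
  exact Finset.sum_le_sum fun x hx => Nat.pos_of_ne_zero (hS.card_joinTree_ne_zero _ hx)

end OutputRows

section OutputLength

variable [Fintype κ] [DecidableEq κ] [DecidableEq V] {σ : Schema r κ}

theorem outLength_le (S : σ.Database V) (p : Fin r) (F : Forest (Fin r)) :
    outLength S p F ≤ (F.labels.map fun i => (S i).length).sum := by
  induction F generalizing p with
  | nil => simp [outLength]
  | node i cs rest ih_children ih_siblings =>
    have children_le := ih_children i
    have siblings_le := ih_siblings p
    simp only [outLength, Forest.labels, List.map_cons, List.sum_cons, List.map_append,
      List.sum_append]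
    omega

theorem sum_card_joinTree (S : σ.Database V) (p i : Fin r) (cs : Forest (Fin r)) :
    ∑ x ∈ keyTuples S i, (joinTree S i cs x).card =
      ∑ y ∈ sharedTuples S p i, (joinShared S p i cs y).card := by
  rw [← Finset.sum_fiberwise_of_maps_to (t := sharedTuples S p i)
    (g := fun x => restrict (σ.key p) x) fun x hx => Finset.mem_image_of_mem _ hx]
  simp [joinShared]

theorem sum_image_le_sum_comp {α β : Type*} [DecidableEq β] (s : Finset α) (g : α → β)
    (φ : β → ℕ) : ∑ y ∈ s.image g, φ y ≤ ∑ x ∈ s, φ (g x) := by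
  rw [Finset.sum_comp φ g]
  refine Finset.sum_le_sum fun y hy => Nat.le_mul_of_pos_left _ (Finset.card_pos.2 ?_)
  obtain ⟨x, hx, rfl⟩ := Finset.mem_image.1 hy
  exact ⟨x, Finset.mem_filter.2 ⟨hx, rfl⟩⟩

theorem add_le_mul_add_one {a b : ℕ} (ha : a ≠ 0) (hb : b ≠ 0) : a + b ≤ a * b + 1 := by
  obtain ⟨a, rfl⟩ := Nat.exists_eq_succ_of_ne_zero ha
  obtain ⟨b, rfl⟩ := Nat.exists_eq_succ_of_ne_zero hb
  simp only [Nat.succ_eq_add_one]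
  nlinarith [Nat.zero_le (a * b)]

namespace PairwiseConsistent

variable {S : σ.Database V} (hS : PairwiseConsistent S)
include hS

theorem length_add_outLength_le {i : Fin r} {cs : Forest (Fin r)}
    (h : outLength S i cs + (keyTuples S i).card ≤
      ∑ x ∈ keyTuples S i, (joinForest S i x cs).card) :
    (S i).length + outLength S i cs ≤ ∑ x ∈ keyTuples S i, (joinTree S i cs x).card := by
  have sum_le := Finset.sum_le_sum fun x hx => (add_le_mul_add_one (card_group_pos S hx).ne'
    (hS.card_joinForest_ne_zero cs hx)).trans_eq
      (congrArg (· + 1) (card_sumset (group S i x) (joinForest S i x cs)).symm)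
  simp only [Finset.sum_add_distrib, sum_card_group, ← Finset.card_eq_sum_ones] at sum_le
  change _ ≤ ∑ x ∈ keyTuples S i, (sumset _ _).card
  omega

theorem sum_card_joinTree_add_le (p i : Fin r) (cs rest : Forest (Fin r)) :
    ∑ x ∈ keyTuples S i, (joinTree S i cs x).card +
        ∑ x ∈ keyTuples S p, (joinForest S p x rest).card ≤
      ∑ x ∈ keyTuples S p, (joinForest S p x (.node i cs rest)).card +
        (sharedTuples S p i).card := by
  have sum_shared_le : ∑ y ∈ sharedTuples S p i, ((joinShared S p i cs y).card - 1) ≤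
      ∑ x ∈ keyTuples S p, ((joinShared S p i cs (restrict (σ.key i) x)).card - 1) := by
    rw [hS.sharedTuples_comm]
    exact sum_image_le_sum_comp _ _ fun y => (joinShared S p i cs y).card - 1
  have sum_sub_one : ∑ y ∈ sharedTuples S p i, ((joinShared S p i cs y).card - 1) +
      (sharedTuples S p i).card = ∑ x ∈ keyTuples S i, (joinTree S i cs x).card := by
    rw [sum_card_joinTree S p, Finset.card_eq_sum_ones, ← Finset.sum_add_distrib]
    exact Finset.sum_congr rfl fun y hy =>
      Nat.succ_pred_eq_of_ne_zero (hS.card_joinShared_ne_zero cs hy)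
  have sum_forest_le : ∑ x ∈ keyTuples S p,
        ((joinShared S p i cs (restrict (σ.key i) x)).card - 1) +
        ∑ x ∈ keyTuples S p, (joinForest S p x rest).card ≤
      ∑ x ∈ keyTuples S p, (joinForest S p x (.node i cs rest)).card := by
    rw [← Finset.sum_add_distrib]
    refine Finset.sum_le_sum fun x hx => ?_
    have shared_ne_zero := hS.card_joinShared_ne_zero cs (hS.restrict_mem i hx)
    have := add_le_mul_add_one shared_ne_zero (hS.card_joinForest_ne_zero rest hx)
    rw [joinForest_node, card_sumset]
    omega
  omega

theorem outLength_add_card_keyTuples_le (p : Fin r) (F : Forest (Fin r)) :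
    outLength S p F + (keyTuples S p).card ≤
      ∑ x ∈ keyTuples S p, (joinForest S p x F).card := by
  induction F generalizing p with
  | nil => simp [outLength, joinForest_nil]
  | node i cs rest ih_children ih_siblings =>
    have tree_le := hS.length_add_outLength_le (ih_children i)
    have siblings_le := ih_siblings p
    have sum_le := hS.sum_card_joinTree_add_le p i cs rest
    have card_sharedTuples := card_sharedTuples_le S p i
    have card_keyTuples := card_keyTuples_le S i
    rw [outLength]
    omega

end PairwiseConsistent

variable {S : σ.Database V} {τ : RootedTree (Fin r)}

theorem length_figaro_le_card_joinRows (hS : PairwiseConsistent S) (nodup : τ.labels.Nodup)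
    (leaf : LeafKeys σ τ.root τ.children) :
    (figaro S τ).val.length ≤ (joinRows S τ).card := by
  rw [length_figaro hS nodup leaf, joinRows, Multiset.card_sum]
  exact hS.length_add_outLength_le (hS.outLength_add_card_keyTuples_le _ _)

theorem figaro_val_eq_singleton (hS : PairwiseConsistent S) (nodup : τ.labels.Nodup)
    (leaf : LeafKeys σ τ.root τ.children) (h : (joinRows S τ).card = 1) :
    (figaro S τ).val = [(joinRows S τ).sum] := by
  have length_le := h ▸ length_figaro_le_card_joinRows hS nodup leaf
  obtain ⟨out, data, figaro_eq, -, represents⟩ := exists_figaro_val_eq_append hS nodup leaf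
  have card_keyTuples : (keyTuples S τ.root).card = 1 := by
    refine le_antisymm (h ▸ hS.card_keyTuples_root_le) (Finset.card_pos.2 ?_)
    rw [Finset.nonempty_iff_ne_empty]
    intro h_empty
    simp [joinRows, h_empty] at h
  obtain ⟨x, hx⟩ := Finset.card_eq_one.1 card_keyTuples
  have keys_eq : data.keys = [x] := by
    obtain ⟨a, ha⟩ := List.length_eq_one_iff.1 (represents.length_keys.trans card_keyTuples)
    have mem_iff := represents.mem_keys a
    rw [ha, hx] at mem_iff
    rw [ha, show a = x by simpa using mem_iff]
  have out_eq : out = [] := by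
    rw [figaro_eq, keys_eq] at length_le
    simpa using length_le
  rw [joinRows, hx, Finset.sum_singleton] at h ⊢
  simp [figaro_eq, out_eq, keys_eq, represents.get_eq, h]

end OutputLength

/-! ## Join trees and the natural join -/

namespace Forest

variable {α : Type}

theorem map_snd_edges (p : α) (F : Forest α) : (F.edges p).map Prod.snd = F.labels := by
  induction F generalizing p with
  | nil => rfl
  | node i cs rest ih_children ih_siblings => simp [edges, labels, ih_children, ih_siblings]

theorem snd_mem_labels {p : α} {F : Forest α} {e : α × α} (h : e ∈ F.edges p) :
    e.2 ∈ F.labels := by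
  rw [← map_snd_edges p F]
  exact List.mem_map_of_mem h

theorem fst_eq_or_mem_labels {p : α} {F : Forest α} {e : α × α} (h : e ∈ F.edges p) :
    e.1 = p ∨ e.1 ∈ F.labels := by
  induction F generalizing p with
  | nil => simp [edges] at h
  | node i cs rest ih_children ih_siblings =>
    simp only [edges, labels, List.mem_cons, List.mem_append] at h ⊢
    rcases h with rfl | h | h
    · exact .inl rfl
    · have := ih_children h
      tauto
    · have := ih_siblings h
      tauto

theorem eq_of_mem_edges {p q q' i : α} {F : Forest α} (nodup : F.labels.Nodup)
    (h : (q, i) ∈ F.edges p) (h' : (q', i) ∈ F.edges p) : q = q' :=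
  congrArg Prod.fst (List.inj_on_of_nodup_map (map_snd_edges p F ▸ nodup) h h' rfl)

theorem reachable_of_edges (G : SimpleGraph α) {p : α} {F : Forest α}
    (h : ∀ e ∈ F.edges p, G.Reachable e.1 e.2) {k : α} (hk : k ∈ F.labels) :
    G.Reachable p k := by
  induction F generalizing p with
  | nil => simp [labels] at hk
  | node i cs rest ih_children ih_siblings =>
    simp only [edges, labels, List.mem_cons, List.mem_append] at h hk
    have reachable : G.Reachable p i := h (p, i) (.inl rfl)
    rcases hk with rfl | hk | hk
    · exact reachable
    · exact reachable.trans (ih_children (fun e he => h e (.inr (.inl he))) hk)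
    · exact ih_siblings (fun e he => h e (.inr (.inr he))) hk

end Forest

theorem leafKeys_of_edges {σ : Schema r κ} {p : Fin r} {F : Forest (Fin r)}
    (nodup : (p :: F.labels).Nodup)
    (h : ∀ e ∈ F.edges p, (∀ e' ∈ F.edges p, e'.1 ≠ e.2) → σ.key e.2 ⊆ σ.key e.1) :
    LeafKeys σ p F := by
  induction F generalizing p with
  | nil => trivial
  | node i cs rest ih_children ih_siblings =>
    simp only [Forest.labels, Forest.edges, List.nodup_cons, List.mem_cons, List.mem_append,
      not_or, List.nodup_append'] at h nodup
    obtain ⟨⟨p_ne, p_notMem_cs, p_notMem_rest⟩, ⟨i_notMem_cs, i_notMem_rest⟩, nodup_cs,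
      nodup_rest, disjoint⟩ := nodup
    refine ⟨?_, ih_children (List.nodup_cons.2 ⟨i_notMem_cs, nodup_cs⟩) fun e he leaf => ?_,
      ih_siblings (List.nodup_cons.2 ⟨p_notMem_rest, nodup_rest⟩) fun e he leaf => ?_⟩
    · rintro rfl
      refine h (p, i) (.inl rfl) ?_
      rintro e' (rfl | he' | he')
      · exact p_ne
      · simp [Forest.edges] at he'
      · have := Forest.fst_eq_or_mem_labels he'
        grind
    · refine h e (.inr (.inl he)) ?_
      have := Forest.snd_mem_labels he
      rintro e' (rfl | he' | he')
      · grind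
      · exact leaf e' he'
      · have := Forest.fst_eq_or_mem_labels he'
        grind [List.Disjoint]
    · refine h e (.inr (.inr he)) ?_
      have := Forest.snd_mem_labels he
      rintro e' (rfl | he' | he')
      · grind
      · have := Forest.fst_eq_or_mem_labels he'
        grind [List.Disjoint]
      · exact leaf e' he'

section JoinTree

variable [DecidableEq κ] {σ : Schema r κ}

theorem restrict_keyTuple_apply (X : Finset κ) {i : Fin r} (t : σ.Tuple V i) (a : κ) :
    restrict X (keyTuple t) a =
      if a ∈ X then (if h : a ∈ σ.key i then some (t.1 ⟨a, h⟩) else none) else none := rfl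

theorem restrict_keyTuple_eq_iff {i j : Fin r} (t : σ.Tuple V i) (t' : σ.Tuple V j) :
    restrict (σ.key i) (keyTuple t') = restrict (σ.key j) (keyTuple t) ↔
      ∀ a (hi : a ∈ σ.key i) (hj : a ∈ σ.key j), t'.1 ⟨a, hj⟩ = t.1 ⟨a, hi⟩ := by
  rw [funext_iff]
  refine forall_congr' fun a => ?_
  by_cases hi : a ∈ σ.key i <;> by_cases hj : a ∈ σ.key j <;>
    simp [restrict_keyTuple_apply, hi, hj]

theorem FullyReduced.pairwiseConsistent {S : σ.Database V} (h : FullyReduced S) :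
    PairwiseConsistent S := by
  intro i j t ht
  obtain ⟨u, hu, rfl⟩ := h i t ht
  exact ⟨_, hu j, (restrict_keyTuple_eq_iff _ _).2 fun a _ _ => rfl⟩

namespace IsJoinTree

variable {τ : RootedTree (Fin r)} (hτ : IsJoinTree σ τ)
include hτ

theorem reachable (i j : Fin r) : τ.graph.Reachable i j := by
  have reachable_root (k : Fin r) : τ.graph.Reachable τ.root k := by
    rcases List.mem_cons.1 (show k ∈ τ.root :: τ.children.labels from hτ.mem_labels k)
      with rfl | hk
    · exact .rfl
    · refine Forest.reachable_of_edges _ (fun e he => ?_) hk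
      by_cases hne : e.1 = e.2
      · rw [hne]
      · exact ((SimpleGraph.fromRel_adj _ _ _).2 ⟨hne, .inl he⟩).reachable
  exact (reachable_root i).symm.trans (reachable_root j)

/-- An attribute of a leaf occurs in another relation, and the path to that relation starts with
the parent of the leaf. -/
theorem key_subset_of_leaf {p i : Fin r} (h : (p, i) ∈ τ.children.edges τ.root)
    (leaf : ∀ e ∈ τ.children.edges τ.root, e.1 ≠ i) : σ.key i ⊆ σ.key p := by
  intro a ha
  obtain ⟨j, hj, haj⟩ : ∃ j, j ≠ i ∧ a ∈ σ.key j := by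
    obtain ⟨j, j', hjj', haj, haj'⟩ := σ.shared a
    by_cases hji : j = i
    · exact ⟨j', fun h' => hjj' (hji.trans h'.symm), haj'⟩
    · exact ⟨j, hji, haj⟩
  obtain ⟨w, hw⟩ := (hτ.reachable i j).exists_isPath
  have mem_key := hτ.path i j w hw
  cases w with
  | nil => exact absurd rfl hj
  | @cons _ v _ hadj w =>
    obtain ⟨-, hv | hv⟩ := (SimpleGraph.fromRel_adj _ _ _).1 hadj
    · exact absurd rfl (leaf _ hv)
    · obtain rfl := Forest.eq_of_mem_edges (List.nodup_cons.1 hτ.nodup).2 hv h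
      exact mem_key v (by simp) (Finset.mem_inter.2 ⟨ha, haj⟩)

theorem leafKeys : LeafKeys σ τ.root τ.children :=
  leafKeys_of_edges hτ.nodup fun _ he leaf => hτ.key_subset_of_leaf he leaf

theorem consistent_of_edges {f : ∀ i, σ.Tuple V i}
    (hf : ∀ e ∈ τ.children.edges τ.root,
      restrict (σ.key e.1) (keyTuple (f e.2)) = restrict (σ.key e.2) (keyTuple (f e.1)))
    (i j : Fin r) (a : κ) (hi : a ∈ σ.key i) (hj : a ∈ σ.key j) :
    (f i).1 ⟨a, hi⟩ = (f j).1 ⟨a, hj⟩ := by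
  obtain ⟨w, hw⟩ := (hτ.reachable i j).exists_isPath
  have mem_key : ∀ k ∈ w.support, a ∈ σ.key k := fun k hk =>
    hτ.path i j w hw k hk (Finset.mem_inter.2 ⟨hi, hj⟩)
  clear hw
  induction w with
  | nil => rfl
  | @cons u v _ hadj w ih =>
    have hv : a ∈ σ.key v := mem_key v (by simp)
    rw [← ih hv hj fun k hk => mem_key k (by simp [hk])]
    obtain ⟨-, he | he⟩ := (SimpleGraph.fromRel_adj _ _ _).1 hadj
    · exact ((restrict_keyTuple_eq_iff _ _).1 (hf _ he) a hi hv).symm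
    · exact (restrict_keyTuple_eq_iff _ _).1 (hf _ he) a hv hi

end IsJoinTree

end JoinTree

section Selections

/-- The data row that is assembled from the chosen rows `f` of the relations in `l`. -/
def dataRow {σ : Schema r κ} (l : List (Fin r)) (f : ∀ i, σ.Tuple V i) : σ.Row :=
  (l.map fun k => embed (f k)).sum

theorem dataRow_congr {σ : Schema r κ} {l : List (Fin r)} {f g : ∀ i, σ.Tuple V i}
    (h : ∀ k ∈ l, f k = g k) : dataRow l f = dataRow l g :=
  congrArg List.sum (List.map_congr_left fun k hk => by rw [h k hk])

theorem dataRow_of_forall_mem {σ : Schema r κ} {l : List (Fin r)} (nodup : l.Nodup)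
    (mem : ∀ i, i ∈ l) (f : ∀ i, σ.Tuple V i) : dataRow l f = fun i => (f i).2 := by
  rw [dataRow, ← List.sum_toFinset _ nodup, show l.toFinset = Finset.univ by ext; simp [mem]]
  exact Finset.univ_sum_single fun i => (f i).2

variable [DecidableEq κ] {σ : Schema r κ} (S : σ.Database V)

/-- `g` chooses rows of the relations in the forest `F` that match along its edges, where the
roots have to match the row chosen for their parent `p`. -/
def IsSelection (p : Fin r) (F : Forest (Fin r)) (g : ∀ i, σ.Tuple V i) : Prop :=
  (∀ k ∈ F.labels, g k ∈ S k) ∧ ∀ e ∈ F.edges p,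
    restrict (σ.key e.1) (keyTuple (g e.2)) = restrict (σ.key e.2) (keyTuple (g e.1))

variable {S}

theorem isSelection_nil (p : Fin r) (g : ∀ i, σ.Tuple V i) : IsSelection S p .nil g := by
  simp [IsSelection, Forest.labels, Forest.edges]

theorem isSelection_node {p i : Fin r} {cs rest : Forest (Fin r)} {g : ∀ i, σ.Tuple V i} :
    IsSelection S p (.node i cs rest) g ↔
      (g i ∈ S i ∧ restrict (σ.key p) (keyTuple (g i)) = restrict (σ.key i) (keyTuple (g p))) ∧
        IsSelection S i cs g ∧ IsSelection S p rest g := by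
  simp only [IsSelection, Forest.labels, Forest.edges, List.forall_mem_cons, List.forall_mem_append]
  tauto

theorem IsSelection.congr {p : Fin r} {F : Forest (Fin r)} {g g' : ∀ i, σ.Tuple V i}
    (hg : IsSelection S p F g) (h : ∀ k, k = p ∨ k ∈ F.labels → g k = g' k) :
    IsSelection S p F g' := by
  refine ⟨fun k hk => h k (.inr hk) ▸ hg.1 k hk, fun e he => ?_⟩
  rw [← h e.1 (Forest.fst_eq_or_mem_labels he), ← h e.2 (.inr (Forest.snd_mem_labels he))]
  exact hg.2 e he

variable [Fintype κ] [DecidableEq V] (S)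

/-- The list of all selections of rows for a forest with parent `p`; outside the forest the
chosen rows are those of `f`. -/
def selections : Fin r → (∀ i, σ.Tuple V i) → Forest (Fin r) → List (∀ i, σ.Tuple V i)
  | _, f, .nil => [f]
  | p, f, .node i cs rest =>
    ((S i).filter fun t =>
        restrict (σ.key p) (keyTuple t) = restrict (σ.key i) (keyTuple (f p))).flatMap fun t =>
      (selections i (Function.update f i t) cs).flatMap fun g => selections p g rest

variable {S}

theorem nodup_cons_labels_node {p i : Fin r} {cs rest : Forest (Fin r)}
    (nodup : (p :: (Forest.node i cs rest).labels).Nodup) :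
    (i :: cs.labels).Nodup ∧ (p :: rest.labels).Nodup ∧ p ≠ i ∧ p ∉ cs.labels ∧
      i ∉ rest.labels ∧ List.Disjoint cs.labels rest.labels := by
  simp only [Forest.labels, List.nodup_cons, List.mem_cons, List.mem_append, not_or,
    List.nodup_append'] at nodup ⊢
  tauto

theorem mem_selections {p : Fin r} {F : Forest (Fin r)} (nodup : (p :: F.labels).Nodup)
    {f g : ∀ i, σ.Tuple V i} :
    g ∈ selections S p f F ↔ (∀ k ∉ F.labels, g k = f k) ∧ IsSelection S p F g := by
  induction F generalizing p f g with
  | nil => simp [selections, isSelection_nil, Forest.labels, funext_iff]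
  | node i cs rest ih_children ih_siblings =>
    obtain ⟨nodup_cs, nodup_rest, p_ne, p_notMem_cs, i_notMem_rest, disjoint⟩ :=
      nodup_cons_labels_node nodup
    have p_notMem_rest := (List.nodup_cons.1 nodup_rest).1
    have i_notMem_cs := (List.nodup_cons.1 nodup_cs).1
    simp only [selections, List.mem_flatMap, List.mem_filter, decide_eq_true_eq, isSelection_node,
      ih_children nodup_cs, ih_siblings nodup_rest, Forest.labels, List.mem_cons, List.mem_append,
      not_or]
    constructor
    · rintro ⟨t, ht, g', ⟨g'_eq, children⟩, g_eq, siblings⟩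
      have g_i : g i = t := by rw [g_eq i i_notMem_rest, g'_eq i i_notMem_cs, Function.update_self]
      have g_p : g p = f p := by
        rw [g_eq p p_notMem_rest, g'_eq p p_notMem_cs, Function.update_of_ne p_ne]
      refine ⟨fun k ⟨k_ne, k_notMem_cs, k_notMem_rest⟩ => ?_, by rwa [g_i, g_p],
        children.congr fun k hk => (g_eq k ?_).symm, siblings⟩
      · rw [g_eq k k_notMem_rest, g'_eq k k_notMem_cs, Function.update_of_ne k_ne]
      · rcases hk with rfl | hk
        exacts [i_notMem_rest, disjoint hk]
    · rintro ⟨g_eq, root, children, siblings⟩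
      rw [g_eq p ⟨p_ne, p_notMem_cs, p_notMem_rest⟩] at root
      have eq_piecewise (k : Fin r) (hk : k ∉ rest.labels) :
          g k = if k ∈ rest.labels then f k else g k := (if_neg hk).symm
      refine ⟨g i, root, fun k => if k ∈ rest.labels then f k else g k, ⟨fun k hk => ?_,
        children.congr fun k hk => eq_piecewise k ?_⟩, eq_piecewise, siblings⟩
      · by_cases k_eq : k = i
        · subst k_eq
          simp [i_notMem_rest]
        · rw [Function.update_of_ne k_eq]
          dsimp only
          split_ifs with hkr
          exacts [rfl, g_eq k ⟨k_eq, hk, hkr⟩]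
      · rcases hk with rfl | hk
        exacts [i_notMem_rest, disjoint hk]

theorem nodup_selections (hS : ∀ i, (S i).Nodup) {p : Fin r} {F : Forest (Fin r)}
    (nodup : (p :: F.labels).Nodup) (f : ∀ i, σ.Tuple V i) : (selections S p f F).Nodup := by
  induction F generalizing p f with
  | nil => simp [selections]
  | node i cs rest ih_children ih_siblings =>
    obtain ⟨nodup_cs, nodup_rest, -, -, i_notMem_rest, disjoint⟩ := nodup_cons_labels_node nodup
    have i_notMem_cs := (List.nodup_cons.1 nodup_cs).1
    rw [selections, List.nodup_flatMap]
    refine ⟨fun t _ => List.nodup_flatMap.2 ⟨fun g _ => ih_siblings nodup_rest g,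
      (ih_children nodup_cs _).pairwise_of_forall_ne fun g hg g' hg' hne h hhg hhg' => ?_⟩,
      ((hS i).filter _).pairwise_of_forall_ne fun t _ t' _ hne h ht ht' => ?_⟩
    · rw [mem_selections nodup_cs] at hg hg'
      rw [mem_selections nodup_rest] at hhg hhg'
      refine hne (funext fun k => ?_)
      by_cases hk : k ∈ rest.labels
      · have k_notMem_cs : k ∉ cs.labels := fun h' => disjoint h' hk
        rw [hg.1 k k_notMem_cs, hg'.1 k k_notMem_cs]
      · rw [← hhg.1 k hk, ← hhg'.1 k hk]
    · have h_i {t : σ.Tuple V i} (ht : h ∈ (selections S i (Function.update f i t) cs).flatMap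
          fun g => selections S p g rest) : h i = t := by
        obtain ⟨g, hg, hh⟩ := List.mem_flatMap.1 ht
        rw [((mem_selections nodup_rest).1 hh).1 i i_notMem_rest,
          ((mem_selections nodup_cs).1 hg).1 i i_notMem_cs, Function.update_self]
      exact hne ((h_i ht).symm.trans (h_i ht'))

end Selections

section JoinRows

theorem sum_sumset_filter {α K M : Type*} [DecidableEq K] [AddCommMonoid M] (key : α → K)
    (row : α → M) (s : Finset K) (J : K → Multiset M) (l : List α) :
    ∑ x ∈ s, sumset (((l.filter (key · = x)).map row : List M) : Multiset M) (J x) =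
      ((l.filter (key · ∈ s) : List α) : Multiset α).bind fun t => (J (key t)).map (row t + ·) := by
  induction l with
  | nil => simp
  | cons t l ih =>
    have sumset_cons (x : K) :
        sumset ((((t :: l).filter (key · = x)).map row : List M) : Multiset M) (J x) =
          (if key t = x then (J x).map (row t + ·) else 0) +
            sumset (((l.filter (key · = x)).map row : List M) : Multiset M) (J x) := by
      by_cases hx : key t = x
      · simp [hx, ← Multiset.cons_coe]
      · simp [hx]
    simp only [sumset_cons, Finset.sum_add_distrib, ih, Finset.sum_ite_eq]
    by_cases ht : key t ∈ s
    · simp [ht, ← Multiset.cons_coe]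
    · simp [ht]

variable [Fintype κ] [DecidableEq κ] [DecidableEq V] {σ : Schema r κ} (S : σ.Database V)

theorem joinShared_eq_bind (p i : Fin r) (cs : Forest (Fin r)) (y : KeyTuple κ V) :
    joinShared S p i cs y =
      (((S i).filter fun t => restrict (σ.key p) (keyTuple t) = y : List _) :
        Multiset (σ.Tuple V i)).bind
          fun t => (joinForest S i (keyTuple t) cs).map (embed t + ·) := by
  refine (sum_sumset_filter keyTuple embed _ (fun x => joinForest S i x cs) (S i)).trans ?_
  congr 2
  refine List.filter_congr fun t ht => ?_
  have mem : keyTuple t ∈ keyTuples S i := (mem_keyTuples S).2 ⟨t, ht, rfl⟩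
  simp [mem]

theorem joinRows_eq_bind (τ : RootedTree (Fin r)) :
    joinRows S τ = ((S τ.root : List _) : Multiset (σ.Tuple V τ.root)).bind
      fun t => (joinForest S τ.root (keyTuple t) τ.children).map (embed t + ·) := by
  refine (sum_sumset_filter keyTuple embed _ (fun x => joinForest S τ.root x τ.children)
    (S τ.root)).trans ?_
  congr 2
  exact List.filter_eq_self.2 fun t ht => decide_eq_true ((mem_keyTuples S).2 ⟨t, ht, rfl⟩)

variable {S}

theorem map_dataRow_selections {p : Fin r} {F : Forest (Fin r)} (nodup : (p :: F.labels).Nodup)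
    (f : ∀ i, σ.Tuple V i) :
    ((selections S p f F).map (dataRow F.labels) : Multiset σ.Row) =
      joinForest S p (keyTuple (f p)) F := by
  induction F generalizing p f with
  | nil => simp [selections, joinForest_nil, dataRow, Forest.labels]
  | node i cs rest ih_children ih_siblings =>
    obtain ⟨nodup_cs, nodup_rest, p_ne, p_notMem_cs, i_notMem_rest, disjoint⟩ :=
      nodup_cons_labels_node nodup
    have i_notMem_cs := (List.nodup_cons.1 nodup_cs).1
    rw [joinForest_node, joinShared_eq_bind, selections, ← Multiset.map_coe, ← Multiset.coe_bind,
      Multiset.map_bind, sumset, Multiset.bind_assoc]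
    refine Multiset.bind_congr fun t _ => ?_
    have children_eq := ih_children nodup_cs (Function.update f i t)
    rw [Function.update_self] at children_eq
    rw [← Multiset.coe_bind, Multiset.map_bind, Multiset.bind_map, ← children_eq,
      ← Multiset.map_coe, Multiset.bind_map]
    refine Multiset.bind_congr fun g hg => ?_
    have g_eq := ((mem_selections nodup_cs).1 hg).1
    have g_p : g p = f p := by rw [g_eq p p_notMem_cs, Function.update_of_ne p_ne]
    have g_i : g i = t := by rw [g_eq i i_notMem_cs, Function.update_self]
    rw [← g_p, ← ih_siblings nodup_rest g, ← Multiset.map_coe, Multiset.map_map]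
    refine Multiset.map_congr rfl fun h hh => ?_
    have h_eq := ((mem_selections nodup_rest).1 hh).1
    rw [Function.comp_apply, dataRow_congr fun k hk => (h_eq k (disjoint hk)).symm]
    simp [dataRow, Forest.labels, h_eq i i_notMem_rest, g_i, add_assoc]

end JoinRows

section NatJoin

theorem proj_injective (σ : Schema r κ) :
    Function.Injective (Schema.JoinTuple.proj : σ.JoinTuple V → ∀ i, σ.Tuple V i) := by
  intro u u' h
  refine Prod.ext (funext fun a => ?_) (funext fun i => congrArg Prod.snd (congrFun h i))
  obtain ⟨i, _, _, hi, _⟩ := σ.shared a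
  exact congrFun (congrArg Prod.fst (congrFun h i)) ⟨a, hi⟩

variable [DecidableEq κ] {σ : Schema r κ}

theorem IsJoinTree.exists_proj_eq {τ : RootedTree (Fin r)} (hτ : IsJoinTree σ τ)
    {S : σ.Database V} {f : ∀ i, σ.Tuple V i} (f_mem : ∀ i, f i ∈ S i)
    (hf : IsSelection S τ.root τ.children f) :
    ∃ u : natJoin S, Schema.JoinTuple.proj u.1 = f := by
  choose ι _ _ mem_key _ using σ.shared
  have proj_eq : Schema.JoinTuple.proj
      ((fun a => (f (ι a)).1 ⟨a, mem_key a⟩, fun i => (f i).2) : σ.JoinTuple V) = f :=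
    funext fun i => Prod.ext
      (funext fun a => hτ.consistent_of_edges hf.2 _ _ a.1 (mem_key a.1) a.2) rfl
  exact ⟨⟨_, fun i => (congrFun proj_eq i).symm ▸ f_mem i⟩, proj_eq⟩

variable [Fintype κ] [DecidableEq V]

/-- The list of all selections of matching rows for all relations of a join tree. As a selection is
a total function, its recursive construction starts from arbitrary rows `f`. -/
def treeSelections (S : σ.Database V) (τ : RootedTree (Fin r)) (f : ∀ i, σ.Tuple V i) :
    List (∀ i, σ.Tuple V i) :=
  (S τ.root).flatMap fun t => selections S τ.root (Function.update f τ.root t) τ.children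

namespace IsJoinTree

variable {τ : RootedTree (Fin r)} (hτ : IsJoinTree σ τ) {S : σ.Database V}
include hτ

theorem mem_treeSelections {f g : ∀ i, σ.Tuple V i} :
    g ∈ treeSelections S τ f ↔ (∀ k, g k ∈ S k) ∧ IsSelection S τ.root τ.children g := by
  have root_notMem := (List.nodup_cons.1 hτ.nodup).1
  have mem_labels (k : Fin r) : k = τ.root ∨ k ∈ τ.children.labels :=
    List.mem_cons.1 (hτ.mem_labels k)
  simp only [treeSelections, List.mem_flatMap, mem_selections hτ.nodup]
  constructor
  · rintro ⟨t, ht, g_eq, hg⟩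
    refine ⟨fun k => ?_, hg⟩
    rcases mem_labels k with rfl | hk
    · rwa [g_eq _ root_notMem, Function.update_self]
    · exact hg.1 k hk
  · rintro ⟨g_mem, hg⟩
    refine ⟨g τ.root, g_mem _, fun k hk => ?_, hg⟩
    obtain rfl := (mem_labels k).resolve_right hk
    rw [Function.update_self]

theorem nodup_treeSelections (hS : ∀ i, (S i).Nodup) (f : ∀ i, σ.Tuple V i) :
    (treeSelections S τ f).Nodup := by
  have root_notMem := (List.nodup_cons.1 hτ.nodup).1
  refine List.nodup_flatMap.2 ⟨fun t _ => nodup_selections hS hτ.nodup _,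
    (hS _).pairwise_of_forall_ne fun t _ t' _ hne g ht ht' => hne ?_⟩
  have g_root := ((mem_selections hτ.nodup).1 ht).1 _ root_notMem
  have g_root' := ((mem_selections hτ.nodup).1 ht').1 _ root_notMem
  rw [Function.update_self] at g_root g_root'
  exact g_root.symm.trans g_root'

theorem map_treeSelections (f : ∀ i, σ.Tuple V i) :
    ((treeSelections S τ f).map fun g => (fun i => (g i).2 : σ.Row) : Multiset σ.Row) =
      joinRows S τ := by
  rw [joinRows_eq_bind, ← Multiset.map_coe, treeSelections, ← Multiset.coe_bind,
    Multiset.map_bind]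
  refine Multiset.bind_congr fun t _ => ?_
  have children_eq := map_dataRow_selections (S := S) hτ.nodup (Function.update f τ.root t)
  rw [Function.update_self] at children_eq
  rw [← children_eq, ← Multiset.map_coe, Multiset.map_map]
  refine Multiset.map_congr rfl fun g hg => ?_
  have g_root := ((mem_selections hτ.nodup).1 hg).1 _ (List.nodup_cons.1 hτ.nodup).1
  rw [Function.update_self] at g_root
  rw [← dataRow_of_forall_mem hτ.nodup hτ.mem_labels]
  simp [dataRow, RootedTree.labels, g_root]

theorem ofFn_proj_perm_treeSelections (hS : ∀ i, (S i).Nodup) {m : ℕ} (e : Fin m ≃ natJoin S)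
    (f : ∀ i, σ.Tuple V i) :
    (List.ofFn fun a => Schema.JoinTuple.proj (e a).1).Perm (treeSelections S τ f) := by
  refine (List.perm_ext_iff_of_nodup (List.nodup_ofFn.2
    ((proj_injective σ).comp (Subtype.val_injective.comp e.injective)))
    (hτ.nodup_treeSelections hS f)).2 fun g => ?_
  rw [hτ.mem_treeSelections, List.mem_ofFn]
  constructor
  · rintro ⟨a, rfl⟩
    exact ⟨(e a).2, fun k _ => (e a).2 k,
      fun _ _ => (restrict_keyTuple_eq_iff _ _).2 fun _ _ _ => rfl⟩
  · rintro ⟨g_mem, hg⟩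
    obtain ⟨u, rfl⟩ := hτ.exists_proj_eq g_mem hg
    exact ⟨e.symm u, by simp⟩

theorem map_natJoin (nodup : ∀ i, (S i).Nodup) (reduced : FullyReduced S) {m : ℕ}
    (e : Fin m ≃ natJoin S) :
    (Finset.univ.val.map fun a => (e a).1.2 : Multiset σ.Row) = joinRows S τ := by
  obtain empty | ⟨u, -⟩ := (natJoin S).eq_empty_or_nonempty
  · have root_eq_nil : S τ.root = [] := List.eq_nil_iff_forall_not_mem.2 fun t ht => by
      obtain ⟨u, hu, -⟩ := reduced _ t ht
      rwa [empty] at hu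
    have : IsEmpty (Fin m) := e.isEmpty_congr.2 (Set.isEmpty_coe_sort.2 empty)
    rw [joinRows_eq_bind, root_eq_nil]
    simp
  · have perm := hτ.ofFn_proj_perm_treeSelections nodup e (Schema.JoinTuple.proj u)
    rw [← hτ.map_treeSelections (Schema.JoinTuple.proj u), ← Multiset.map_coe,
      ← Multiset.coe_eq_coe.2 perm, Multiset.map_coe, List.map_ofFn, Fin.univ_val_map]
    rfl

end IsJoinTree

end NatJoin

/-! ## Orthogonal matrices and Givens rotations -/

section Orthogonal

open Matrix

theorem exists_linearIsometry_apply_eq {𝕜 E F : Type*} [RCLike 𝕜] [AddCommGroup E] [Module 𝕜 E]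
    [NormedAddCommGroup F] [InnerProductSpace 𝕜 F] [FiniteDimensional 𝕜 F] {f g : E →ₗ[𝕜] F}
    (norm_eq : ∀ z, ‖f z‖ = ‖g z‖) : ∃ L : F →ₗᵢ[𝕜] F, ∀ z, L (g z) = f z := by
  obtain ⟨s, hs⟩ := g.rangeRestrict.exists_rightInverse_of_surjective g.range_rangeRestrict
  have apply_section : ∀ y, g (s y) = y := fun y => congrArg Subtype.val (LinearMap.congr_fun hs y)
  let L : g.range →ₗᵢ[𝕜] F :=
    ⟨f ∘ₗ s, fun y => by rw [LinearMap.comp_apply, norm_eq, apply_section, Submodule.coe_norm]⟩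
  refine ⟨L.extend, fun z => ?_⟩
  calc L.extend (g z) = f (s ⟨g z, LinearMap.mem_range_self g z⟩) := L.extend_apply ⟨g z, _⟩
    _ = f z := by
      rw [← sub_eq_zero, ← map_sub, ← norm_eq_zero, norm_eq, map_sub, apply_section, sub_self,
        norm_zero]

variable {n : Type*} [Fintype n] [DecidableEq n]

theorem exists_mem_orthogonalGroup_mul_eq {ι : Type*} [Fintype ι] {A B : Matrix n ι ℝ}
    (h : ∀ z : ι → ℝ, ∑ a, (A *ᵥ z) a ^ 2 = ∑ a, (B *ᵥ z) a ^ 2) :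
    ∃ Q ∈ Matrix.orthogonalGroup n ℝ, A = Q * B := by
  classical
  let f (D : Matrix n ι ℝ) : (ι → ℝ) →ₗ[ℝ] EuclideanSpace ℝ n :=
    (WithLp.linearEquiv 2 ℝ (n → ℝ)).symm.toLinearMap ∘ₗ D.mulVecLin
  obtain ⟨L, hL⟩ := exists_linearIsometry_apply_eq (f := f A) (g := f B) fun z => by
    simpa [f, EuclideanSpace.norm_eq] using congrArg Real.sqrt (h z)
  let b := EuclideanSpace.basisFun n ℝ
  refine ⟨(L.toLinearIsometryEquiv rfl).toMatrix b.toBasis b.toBasis,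
    LinearIsometryEquiv.toMatrix_mem_unitaryGroup _ _ _, Matrix.ext_of_mulVec_single fun i => ?_⟩
  have hi := congrArg WithLp.ofLp (hL (Pi.single i 1))
  rw [← Matrix.mulVec_mulVec]
  change A *ᵥ Pi.single i 1 = LinearMap.toMatrix b.toBasis b.toBasis L.toLinearMap *ᵥ
    b.toBasis.repr (f B (Pi.single i 1))
  rw [LinearMap.toMatrix_mulVec_repr]
  exact hi.symm

theorem mem_orthogonalGroup_of_dotProduct {Q : Matrix n n ℝ}
    (h : ∀ u v, (Q *ᵥ u) ⬝ᵥ (Q *ᵥ v) = u ⬝ᵥ v) : Q ∈ Matrix.orthogonalGroup n ℝ := by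
  rw [Matrix.mem_orthogonalGroup_iff']
  ext a b
  have := h (Pi.single a 1) (Pi.single b 1)
  rw [Matrix.mulVec_single_one, Matrix.mulVec_single_one] at this
  rw [Matrix.mul_apply, Matrix.one_apply]
  simpa [dotProduct, Matrix.col, Pi.single_apply, eq_comm] using this

theorem col_dotProduct_col {U : Matrix n n ℝ} (hU : U ∈ Matrix.orthogonalGroup n ℝ) (j k : n) :
    U.col j ⬝ᵥ U.col k = (1 : Matrix n n ℝ) j k := by
  rw [← (Matrix.mem_orthogonalGroup_iff' n ℝ).1 hU]
  simp [Matrix.mul_apply, dotProduct]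

theorem apply_eq_zero_of_col_eq_single {U : Matrix n n ℝ} (hU : U ∈ Matrix.orthogonalGroup n ℝ)
    {j k : n} (hjk : j ≠ k) (h : U.col j = Pi.single j 1) : U j k = 0 := by
  simpa [h, Matrix.one_apply, hjk] using col_dotProduct_col hU j k

theorem apply_self_eq_one_or_neg_one {U : Matrix n n ℝ} (hU : U ∈ Matrix.orthogonalGroup n ℝ)
    {k : n} (h : ∀ a ≠ k, U a k = 0) : U k k = 1 ∨ U k k = -1 := by
  have := col_dotProduct_col hU k k
  rw [dotProduct, Fintype.sum_eq_single k fun a ha => by simp [h a ha]] at this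
  exact mul_self_eq_one_iff.1 (by simpa using this)

theorem eq_one_or_eq_diagonal {U : Matrix n n ℝ} (hU : U ∈ Matrix.orthogonalGroup n ℝ) {l : n}
    (h : ∀ j ≠ l, U.col j = Pi.single j 1) :
    U = 1 ∨ U = diagonal (Function.update 1 l (-1)) := by
  have hl : ∀ a ≠ l, U a l = 0 := fun a ha => apply_eq_zero_of_col_eq_single hU ha (h a ha)
  have eq_diagonal : U = diagonal (Function.update 1 l (U l l)) := by
    ext a b
    rcases eq_or_ne b l with rfl | hb
    · rcases eq_or_ne a b with rfl | ha
      · simp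
      · simp [ha, hl a ha]
    · have := congrFun (h b hb) a
      rcases eq_or_ne a b with rfl | ha
      · simpa [hb] using this
      · simpa [ha] using this
  refine (apply_self_eq_one_or_neg_one hU hl).imp (fun h' => ?_) fun h' => ?_ <;>
    rw [h'] at eq_diagonal
  · simpa using eq_diagonal
  · exact eq_diagonal

end Orthogonal

section Givens

open Matrix

variable {m : ℕ}

theorem givens_mulVec {i j : Fin m} (hij : i ≠ j) (θ : ℝ) (u : Fin m → ℝ) (a : Fin m) :
    (givens i j θ *ᵥ u) a =
      if a = i then Real.cos θ * u i - Real.sin θ * u j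
      else if a = j then Real.sin θ * u i + Real.cos θ * u j else u a := by
  rw [Matrix.mulVec, dotProduct]
  by_cases hi : a = i
  · subst hi
    rw [if_pos rfl, Fintype.sum_eq_add a j hij]
    · simp [givens, hij, hij.symm, sub_eq_add_neg]
    · rintro b ⟨hb, hb'⟩
      simp [givens, hij, hb, hb', Ne.symm hb]
  · by_cases hj : a = j
    · subst hj
      rw [if_neg hi, if_pos rfl, Fintype.sum_eq_add i a hij]
      · simp [givens, hij, hi]
      · rintro b ⟨hb, hb'⟩
        simp [givens, hi, hb, hb', Ne.symm hb']
    · rw [if_neg hi, if_neg hj, Fintype.sum_eq_single a]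
      · simp [givens, hi, hj]
      · intro b hb
        simp [givens, hi, hj, Ne.symm hb]

theorem givens_mem_orthogonalGroup {i j : Fin m} (hij : i ≠ j) (θ : ℝ) :
    givens i j θ ∈ Matrix.orthogonalGroup (Fin m) ℝ := by
  refine mem_orthogonalGroup_of_dotProduct fun u v => ?_
  rw [← sub_eq_zero, dotProduct, dotProduct, ← Finset.sum_sub_distrib,
    Fintype.sum_eq_add i j hij]
  · simp only [givens_mulVec hij, if_true, hij.symm, if_false]
    linear_combination (u i * v i + u j * v j) * Real.sin_sq_add_cos_sq θ
  · rintro a ⟨hi, hj⟩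
    simp [givens_mulVec hij, hi, hj]

theorem givens_pi_div_two_mul_diagonal {i j : Fin m} (hij : i ≠ j) :
    givens i j (Real.pi / 2) * diagonal (Function.update 1 j (-1)) =
      (Equiv.swap i j).permMatrix ℝ := by
  refine Matrix.ext fun a b => ?_
  calc (givens i j (Real.pi / 2) *ᵥ (diagonal (Function.update 1 j (-1))).col b) a
    _ = if Equiv.swap i j a = b then 1 else 0 := by
      rw [givens_mulVec hij, Real.cos_pi_div_two, Real.sin_pi_div_two]
      rcases eq_or_ne a i with rfl | hi
      · simp [diagonal_apply, hij, neg_ite]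
      · rcases eq_or_ne a j with rfl | hj
        · simp [diagonal_apply, hi, hij]
        · simp [diagonal_apply, hi, hj, Equiv.swap_apply_of_ne_of_ne hi hj]
    _ = (Equiv.swap i j).permMatrix ℝ a b := by simp [PEquiv.toMatrix_apply, eq_comm]

/-- The matrices that are products of Givens rotations in two distinct coordinates. -/
def IsGivensProduct (P : Matrix (Fin m) (Fin m) ℝ) : Prop :=
  ∃ G : List (Matrix (Fin m) (Fin m) ℝ),
    (∀ g ∈ G, ∃ (i j : Fin m) (θ : ℝ), i ≠ j ∧ g = givens i j θ) ∧ G.prod = P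

theorem isGivensProduct_one : IsGivensProduct (1 : Matrix (Fin m) (Fin m) ℝ) :=
  ⟨[], by simp, rfl⟩

theorem isGivensProduct_givens {i j : Fin m} (hij : i ≠ j) (θ : ℝ) :
    IsGivensProduct (givens i j θ) :=
  ⟨[givens i j θ], by simpa using ⟨i, j, hij, θ, rfl⟩, by simp⟩

theorem IsGivensProduct.mul {P P' : Matrix (Fin m) (Fin m) ℝ} (h : IsGivensProduct P)
    (h' : IsGivensProduct P') : IsGivensProduct (P * P') := by
  obtain ⟨G, hG, rfl⟩ := h
  obtain ⟨G', hG', rfl⟩ := h'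
  exact ⟨G ++ G', fun g hg => (List.mem_append.1 hg).elim (hG g) (hG' g), List.prod_append⟩

theorem IsGivensProduct.mem_orthogonalGroup {P : Matrix (Fin m) (Fin m) ℝ}
    (h : IsGivensProduct P) : P ∈ Matrix.orthogonalGroup (Fin m) ℝ := by
  obtain ⟨G, hG, rfl⟩ := h
  refine Submonoid.list_prod_mem _ fun g hg => ?_
  obtain ⟨i, j, θ, hij, rfl⟩ := hG g hg
  exact givens_mem_orthogonalGroup hij θ

theorem exists_rotation (x y : ℝ) :
    ∃ θ : ℝ, Real.sin θ * x + Real.cos θ * y = 0 ∧ 0 ≤ Real.cos θ * x - Real.sin θ * y := by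
  set ρ := ‖(⟨x, y⟩ : ℂ)‖
  set φ := Complex.arg ⟨x, y⟩
  have hx : ρ * Real.cos φ = x := Complex.norm_mul_cos_arg ⟨x, y⟩
  have hy : ρ * Real.sin φ = y := Complex.norm_mul_sin_arg ⟨x, y⟩
  refine ⟨-φ, ?_, ?_⟩ <;> rw [← hx, ← hy, Real.sin_neg, Real.cos_neg]
  · ring
  · calc 0 ≤ ρ := norm_nonneg _
      _ = Real.cos φ * (ρ * Real.cos φ) - -Real.sin φ * (ρ * Real.sin φ) := by
        linear_combination -ρ * Real.sin_sq_add_cos_sq φ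

theorem exists_givens_annihilate (u : Fin m → ℝ) {k : Fin m} {s : Finset (Fin m)} (hk : k ∉ s) :
    ∃ P, IsGivensProduct P ∧ (∀ i ∈ s, (P *ᵥ u) i = 0) ∧
      (∀ i, i ∉ s → i ≠ k → (P *ᵥ u) i = u i) ∧ (s.Nonempty → 0 ≤ (P *ᵥ u) k) ∧
      ∀ v : Fin m → ℝ, v k = 0 → (∀ i ∈ s, v i = 0) → P *ᵥ v = v := by
  induction s using Finset.induction_on with
  | empty => exact ⟨1, isGivensProduct_one, by simp, by simp, by simp, by simp⟩
  | insert i s his ih =>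
    rw [Finset.mem_insert, not_or] at hk
    obtain ⟨P, hP, zero, unchanged, -, fixed⟩ := ih hk.2
    obtain ⟨θ, hθ, hθ'⟩ := exists_rotation ((P *ᵥ u) k) ((P *ᵥ u) i)
    refine ⟨givens k i θ * P, (isGivensProduct_givens hk.1 θ).mul hP, fun j hj => ?_,
      fun j hj hjk => ?_, fun _ => ?_, fun v hv hv' => ?_⟩ <;>
      rw [← Matrix.mulVec_mulVec]
    · rw [givens_mulVec hk.1]
      rcases Finset.mem_insert.1 hj with rfl | hj
      · rw [if_neg (Ne.symm hk.1), if_pos rfl, hθ]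
      · rw [if_neg (ne_of_mem_of_not_mem hj hk.2), if_neg (ne_of_mem_of_not_mem hj his), zero j hj]
    · rw [Finset.mem_insert, not_or] at hj
      rw [givens_mulVec hk.1, if_neg hjk, if_neg hj.1, unchanged j hj.2 hjk]
    · rw [givens_mulVec hk.1, if_pos rfl]
      exact hθ'
    · rw [Finset.forall_mem_insert] at hv'
      rw [fixed v hv hv'.2]
      funext j
      rw [givens_mulVec hk.1, hv, hv'.1]
      split_ifs with h h'
      · simp [h, hv]
      · simp [h', hv'.1]
      · rfl

theorem exists_givens_col {U : Matrix (Fin m) (Fin m) ℝ}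
    (hU : U ∈ Matrix.orthogonalGroup (Fin m) ℝ) {k : Fin m} (hk : (Finset.Ioi k).Nonempty)
    (h : ∀ j < k, U.col j = Pi.single j 1) :
    ∃ P, IsGivensProduct P ∧ ∀ j ≤ k, (P * U).col j = Pi.single j 1 := by
  obtain ⟨P, hP, zero, unchanged, nonneg, fixed⟩ :=
    exists_givens_annihilate (U.col k) (Finset.notMem_Ioi_self (b := k))
  have off_diagonal : ∀ a ≠ k, (P * U) a k = 0 := fun a ha => by
    rcases lt_or_gt_of_ne ha with ha' | ha'
    · exact (unchanged a (by simpa using ha'.le) ha).trans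
        (apply_eq_zero_of_col_eq_single hU ha (h a ha'))
    · exact zero a (by simpa using ha')
  refine ⟨P, hP, fun j hj => ?_⟩
  rcases hj.lt_or_eq with hj | rfl
  · change P *ᵥ U.col j = _
    rw [h j hj]
    refine fixed _ (Pi.single_eq_of_ne hj.ne' _) fun i hi => ?_
    exact Pi.single_eq_of_ne (hj.trans (Finset.mem_Ioi.1 hi)).ne' _
  · funext a
    rcases eq_or_ne a j with rfl | ha
    · have := apply_self_eq_one_or_neg_one (mul_mem hP.mem_orthogonalGroup hU) off_diagonal
      have hpos : 0 ≤ (P * U) a a := nonneg hk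
      rw [Pi.single_eq_same, Matrix.col_apply]
      exact this.resolve_right fun h' => by linarith
    · rw [Pi.single_eq_of_ne ha, Matrix.col_apply, off_diagonal a ha]

theorem exists_givens_cols {Q : Matrix (Fin m) (Fin m) ℝ}
    (hQ : Q ∈ Matrix.orthogonalGroup (Fin m) ℝ) {n : ℕ} (hn : n < m) :
    ∃ P, IsGivensProduct P ∧ ∀ j : Fin m, (j : ℕ) < n → (P * Q).col j = Pi.single j 1 := by
  induction n with
  | zero => exact ⟨1, isGivensProduct_one, by simp⟩
  | succ n ih =>
    obtain ⟨P, hP, hcol⟩ := ih (by omega)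
    obtain ⟨P', hP', hcol'⟩ := exists_givens_col (mul_mem hP.mem_orthogonalGroup hQ)
      (k := ⟨n, by omega⟩) ⟨⟨n + 1, hn⟩, by simp [Fin.lt_def]⟩ fun j hj => hcol j hj
    refine ⟨P' * P, hP'.mul hP, fun j hj => ?_⟩
    rw [Matrix.mul_assoc]
    exact hcol' j (Nat.lt_succ_iff.1 hj)

theorem exists_givens_permMatrix (hm : m ≠ 1) {Q : Matrix (Fin m) (Fin m) ℝ}
    (hQ : Q ∈ Matrix.orthogonalGroup (Fin m) ℝ) :
    ∃ (P : Matrix (Fin m) (Fin m) ℝ) (π : Equiv.Perm (Fin m)), IsGivensProduct P ∧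
      P * Q = π.permMatrix ℝ := by
  obtain _ | _ | k := m
  · exact ⟨1, 1, isGivensProduct_one, Subsingleton.elim _ _⟩
  · exact absurd rfl hm
  obtain ⟨P, hP, hcol⟩ := exists_givens_cols hQ (Nat.lt_succ_self (k + 1))
  have col_eq : ∀ j ≠ Fin.last (k + 1), (P * Q).col j = Pi.single j 1 := fun j hj =>
    hcol j (Fin.val_lt_last hj)
  rcases eq_one_or_eq_diagonal (mul_mem hP.mem_orthogonalGroup hQ) col_eq with h | h
  · exact ⟨P, 1, hP, by simpa using h⟩
  · have hne : (0 : Fin (k + 2)) ≠ Fin.last (k + 1) := (Fin.last_pos).ne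
    refine ⟨givens 0 (Fin.last _) (Real.pi / 2) * P, Equiv.swap 0 (Fin.last _),
      (isGivensProduct_givens hne _).mul hP, ?_⟩
    rw [Matrix.mul_assoc, h, givens_pi_div_two_mul_diagonal hne]

theorem exists_givens_eq_submatrix {ι : Type*} (hm : m ≠ 1) {Q : Matrix (Fin m) (Fin m) ℝ}
    (hQ : Q ∈ Matrix.orthogonalGroup (Fin m) ℝ) (B : Matrix (Fin m) ι ℝ) :
    ∃ (G : List (Matrix (Fin m) (Fin m) ℝ)) (π : Equiv.Perm (Fin m)),
      (∀ g ∈ G, ∃ (i j : Fin m) (θ : ℝ), i ≠ j ∧ g = givens i j θ) ∧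
      G.prod * (Q * B) = B.submatrix π id := by
  obtain ⟨P, π, ⟨G, hG, rfl⟩, h⟩ := exists_givens_permMatrix hm hQ
  exact ⟨G, π, hG, by rw [← Matrix.mul_assoc, h, PEquiv.toMatrix_toPEquiv_mul]⟩

end Givens

/-! ## Running time -/

theorem Forest.length_roots_le {α : Type} (F : Forest α) : F.roots.length ≤ F.labels.length := by
  induction F with
  | nil => simp [roots]
  | node a cs rest _ ih =>
    simp only [roots, labels, List.length_cons, List.length_append]
    omega

theorem length_roots_le_of_nodup {F : Forest (Fin r)} (h : F.labels.Nodup) :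
    F.roots.length ≤ r :=
  F.length_roots_le.trans (by simpa using h.length_le_card)

theorem width_le_numCols (σ : Schema r κ) (i : Fin r) : σ.width i ≤ numCols σ :=
  Finset.single_le_sum (f := σ.width) (fun _ _ => Nat.zero_le _) (Finset.mem_univ i)

theorem sum_width_le (σ : Schema r κ) {l : List (Fin r)} (hl : l.Nodup) :
    (l.map σ.width).sum ≤ numCols σ := by
  rw [← List.sum_toFinset _ hl]
  exact Finset.sum_le_univ_sum_of_nonneg fun _ => Nat.zero_le _

theorem length_le_numRows {σ : Schema r κ} (S : σ.Database V) (i : Fin r) :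
    (S i).length ≤ numRows S :=
  Finset.single_le_sum (f := fun i => (S i).length) (fun _ _ => Nat.zero_le _) (Finset.mem_univ i)

section HeadTail

variable {σ : Schema r κ}

theorem steps_headTailLoop_le (hr : 0 < r) (k : ℝ) (l : List (ℝ × σ.Row)) (q : ℝ) (s : σ.Row)
    (out : List σ.Row) :
    (headTailLoop k l q s out).steps ≤
      6 * (numCols σ + r) + 22 * (numCols σ + r) * l.length := by
  induction l generalizing q s out with
  | nil =>
    simp only [headTailLoop, Timed.steps_bind, steps_tick, steps_sqrt, Timed.steps_pure]
    rw [steps_tabulate_tabulate _ 2 fun _ _ => by simp]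
    simp only [List.length_nil]
    omega
  | cons p l ih =>
    simp only [headTailLoop, Timed.steps_bind, steps_tick, steps_sqrt, steps_mul, steps_add,
      steps_push]
    rw [steps_tabulate_tabulate _ 8 fun _ _ => by simp,
      steps_tabulate_tabulate _ 4 fun _ _ => by simp]
    grw [ih]
    rw [List.length_cons, Nat.mul_succ]
    omega

theorem steps_headTail_le (hr : 0 < r) (k : ℝ) (l : List (ℝ × σ.Row)) (out : List σ.Row) :
    (headTail k l out).steps ≤ 1 + 22 * (numCols σ + r) * l.length := by
  cases l with
  | nil => simp [headTail]
  | cons p l =>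
    simp only [headTail, Timed.steps_bind, steps_tick, steps_mul]
    rw [steps_tabulate_tabulate _ 2 fun _ _ => by simp]
    grw [steps_headTailLoop_le hr]
    rw [List.length_cons, Nat.mul_succ]
    omega

theorem steps_padRow_le (hr : 0 < r) {i : Fin r} (t : σ.Tuple V i) :
    (padRow t).steps ≤ 6 * (numCols σ + r) := by
  have := width_le_numCols σ i
  simp only [padRow, Timed.steps_bind, steps_setBlock]
  rw [steps_tabulate_tabulate _ 0 fun _ _ => by simp]
  simp only [steps_tabulate, Finset.sum_const, Finset.card_univ, Fintype.card_fin, smul_eq_mul]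
  omega

theorem steps_collectNodes_le (i : Fin r) (bs : List (Result σ V)) :
    (collectNodes i bs).steps ≤ 1 + 2 * bs.length + 2 * (bs.flatMap Result.nodes).length := by
  refine (loop_steps_le_sum (fun b : Result σ V => 1 + b.nodes.length * (1 + 1)) _ bs _
    fun b _ l => loop_steps_le_const 1 _ _ _ fun k _ m => le_rfl).trans ?_
  induction bs with
  | nil => simp
  | cons b bs ih =>
    simp only [List.map_cons, List.sum_cons, List.length_cons, List.flatMap_cons,
      List.length_append] at ih ⊢
    omega

end HeadTail

section Dictionaries

variable [Fintype κ] [DecidableEq V]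

theorem steps_divide_le (d e : KeyDict κ V ℝ) : (divide d e).steps ≤ 1 + 5 * d.keys.length := by
  grw [divide, loop_steps_le_const 4 _ _ _ fun _ _ _ => by simp]
  omega

theorem steps_reduceGroups_le {σ : Schema r κ} (hr : 0 < r)
    (groups : KeyDict κ V (List (ℝ × σ.Row))) (tailCount headCount : KeyDict κ V ℝ)
    (out : List σ.Row) :
    (reduceGroups groups tailCount headCount out).steps ≤ 1 + 9 * groups.keys.length +
      22 * (numCols σ + r) * (groups.keys.map fun x => (groups.get x).length).sum := by
  refine (loop_steps_le_sum
    (fun x => 8 + 22 * (numCols σ + r) * (groups.get x).length) _ _ _ fun x _ st => ?_).trans ?_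
  · simp only [Timed.steps_bind, Dict.steps_lookup, steps_sqrt, Dict.steps_insert, Dict.val_lookup,
      val_sqrt, Timed.steps_pure]
    grw [steps_headTail_le hr]
    omega
  · induction groups.keys with
    | nil => simp
    | cons x l ih =>
      simp only [List.map_cons, List.sum_cons, List.length_cons, mul_add] at ih ⊢
      omega

variable [DecidableEq κ]

theorem steps_sumOver_le (X : Finset κ) (d : KeyDict κ V ℝ) :
    (sumOver X d).steps ≤ 1 + 6 * d.keys.length := by
  grw [sumOver, loop_steps_le_const 5 _ _ _ fun _ _ _ => by simp]
  omega

theorem steps_applyUp_le (X : Finset κ) (up theta : KeyDict κ V ℝ) :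
    (applyUp X up theta).steps ≤ 1 + 6 * theta.keys.length := by
  grw [applyUp, loop_steps_le_const 5 _ _ _ fun _ _ _ => by simp]
  omega

theorem steps_computeTheta_le (σ : Schema r κ) (d : KeyDict κ V ℝ) (bs : List (Counts₁ r κ V)) :
    (computeTheta σ d bs).steps ≤ 1 + d.keys.length * (4 + 4 * bs.length) := by
  refine (loop_steps_le_const (3 + 4 * bs.length) _ _ _ fun x _ d' => ?_).trans_eq (by ring)
  simp only [Timed.steps_bind, Dict.steps_lookup, Dict.steps_insert]
  grw [loop_steps_le_const 3 _ _ _ fun _ _ _ => by simp]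
  omega

end Dictionaries

section Counts

variable [Fintype κ] [DecidableEq κ] [DecidableEq V] {σ : Schema r κ} (S : σ.Database V)

theorem steps_countRows_le (i : Fin r) : (countRows S i).steps ≤ 1 + 5 * (S i).length := by
  grw [countRows, loop_steps_le_const 4 _ _ _ fun _ _ _ => by simp]
  omega

variable {S}

theorem CountsSpec₁.length_roots {p : Fin r} {F : Forest (Fin r)} {G : Forest (Counts₁ r κ V)}
    (h : CountsSpec₁ S p F G) : G.roots.length = F.roots.length := by
  induction h with
  | nil => rfl
  | node _ _ _ _ _ _ _ ih => simp [Forest.roots, ih]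

theorem CountsSpec₁.steps_computeTheta_le {i : Fin r} {cs : Forest (Fin r)}
    {cs' : Forest (Counts₁ r κ V)} (h : CountsSpec₁ S i cs cs') (hcs : cs.labels.Nodup)
    {d : KeyDict κ V ℝ} {g : KeyTuple κ V → ℝ} (hd : d.Represents (keyTuples S i) g) :
    (computeTheta σ d cs'.roots).steps ≤ 1 + 8 * ((S i).length * (numCols σ + r)) := by
  have := length_roots_le_of_nodup hcs
  have := i.pos
  grw [Figaro.steps_computeTheta_le, hd.length_keys, h.length_roots, card_keyTuples_le S i,
    show 4 + 4 * cs.roots.length ≤ 8 * (numCols σ + r) by omega]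
  exact (by ring : _ = _).le

variable (S)

theorem steps_pass₁_le (hS : ∀ i, 0 < (S i).length) (p : Fin r) {F : Forest (Fin r)}
    (hF : F.labels.Nodup) :
    (pass₁ S p F).steps ≤
      1 + (F.labels.map fun i => 24 * ((S i).length * (numCols σ + r))).sum := by
  induction F generalizing p with
  | nil => simp [pass₁]
  | node i cs rest ih_children ih_siblings =>
    obtain ⟨nodup_tree, nodup_rest, -⟩ := (List.nodup_append' (l₁ := i :: cs.labels)).1 hF
    have nodup_children := nodup_tree.of_cons
    have counts := pass₁_val S i cs
    have theta := computeTheta_val S counts (countRows_val S i)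
    have r_pos := i.pos
    have one_le : 1 ≤ (S i).length * (numCols σ + r) := Nat.mul_pos (hS i) (by omega)
    have length_le : (S i).length ≤ (S i).length * (numCols σ + r) :=
      Nat.le_mul_of_pos_right _ (by omega)
    simp only [pass₁, Timed.steps_bind, steps_tick, Timed.steps_pure, Forest.labels, List.map_cons,
      List.sum_cons, List.map_append, List.sum_append]
    grw [ih_children i nodup_children, steps_countRows_le,
      counts.steps_computeTheta_le nodup_children (countRows_val S i), steps_sumOver_le,
      theta.length_keys, card_keyTuples_le, ih_siblings p nodup_rest]
    omega

variable {S}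

theorem CountsSpec₁.steps_pass₂_le {p : Fin r} {full : KeyTuple κ V → ℝ} {d : KeyDict κ V ℝ}
    {F : Forest (Fin r)} {G : Forest (Counts₁ r κ V)} (h : CountsSpec₁ S p F G)
    (hd : d.Represents (keyTuples S p) full) :
    (pass₂ σ p d G).steps ≤ 1 + F.labels.length * (6 + 22 * numRows S) := by
  induction h generalizing full d with
  | nil => simp [pass₂]
  | @node p i cs rest b cs' rest' idx rowsPerKey theta down _ _ ih_children ih_siblings =>
    subst idx
    have tree_eq_zero : ∀ x ∉ keyTuples S b.idx, ((joinTree S b.idx cs x).card : ℝ) = 0 :=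
      fun x hx => by simp [joinTree_eq_zero S cs hx]
    have sums := sumOver_val (σ.key b.idx) hd
    have up := sumOver_divide_val S hd down.get_eq
    have full' := applyUp_val (σ.key p) theta tree_eq_zero up.get_eq
    have card_le : ∀ i, (keyTuples S i).card ≤ numRows S := fun i =>
      (card_keyTuples_le S i).trans (length_le_numRows S i)
    have card_image_le := Finset.card_image_le (s := keyTuples S p) (f := restrict (σ.key b.idx))
    simp only [pass₂, Timed.steps_bind, steps_tick, Timed.steps_pure, Forest.labels,
      List.length_cons, List.length_append, add_mul, one_mul]
    grw [steps_sumOver_le, steps_divide_le, steps_applyUp_le, steps_divide_le, ih_children full',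
      ih_siblings hd, hd.length_keys, sums.length_keys, theta.length_keys, full'.length_keys,
      card_image_le, card_le p, card_le b.idx]
    omega

end Counts

theorem steps_copyBlocks_le {σ : Schema r κ} (u : σ.Row) (g : ℝ) (nodes : List (Fin r))
    (w : σ.Row) :
    (loop (fun w k => do
      let blk ← tabulate fun c => do
        let a ← cell u k c
        mul a g
      setBlock w k blk) nodes w).steps ≤ 1 + 3 * nodes.length + 3 * (nodes.map σ.width).sum := by
  refine (loop_steps_le_sum (fun k => 2 + 3 * σ.width k) _ _ _ fun k _ w => ?_).trans ?_
  · simp only [Timed.steps_bind, steps_tabulate, steps_cell, steps_mul, Finset.sum_const,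
      Finset.card_univ, Fintype.card_fin, smul_eq_mul, steps_setBlock]
    omega
  · simp only [List.sum_map_add, List.sum_map_mul_left, List.map_const', List.sum_replicate,
      smul_eq_mul]
    omega

theorem steps_copyChildren_le [DecidableEq κ] {σ : Schema r κ} (x : KeyTuple κ V) (sp : ℝ)
    (bs : List (Result σ V)) (w : σ.Row) :
    (loop (fun w (b : Result σ V) => do
      let y ← project (σ.key b.idx) x
      let f ← b.scales.lookup y
      let g ← div sp f
      let u ← b.data.lookup y
      loop (fun w k => do
        let blk ← tabulate fun c => do
          let a ← cell u k c
          mul a g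
        setBlock w k blk) b.nodes w) bs w).steps ≤
      1 + 6 * bs.length + 3 * (bs.flatMap Result.nodes).length +
        3 * ((bs.flatMap Result.nodes).map σ.width).sum := by
  refine (loop_steps_le_sum (fun b : Result σ V => 5 + 3 * b.nodes.length +
    3 * (b.nodes.map σ.width).sum) _ _ _ fun b _ w => ?_).trans ?_
  · simp only [Timed.steps_bind, steps_project, Dict.steps_lookup, steps_div]
    grw [steps_copyBlocks_le]
    omega
  · induction bs with
    | nil => simp
    | cons b bs ih =>
      simp only [List.map_cons, List.sum_cons, List.length_cons, List.flatMap_cons,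
        List.length_append, List.map_append, List.sum_append] at ih ⊢
      omega

section Algorithm

variable [Fintype κ] [DecidableEq κ] [DecidableEq V] {σ : Schema r κ} (S : σ.Database V)

theorem sum_length_groupRows (i : Fin r) :
    ((groupRows S i).val.keys.map fun x => ((groupRows S i).val.get x).length).sum =
      (S i).length := by
  rw [(groupRows_val S i).sum_keys, ← sum_length_filter_eq (keyTuple (σ := σ) (i := i)) (S i)]
  simp [(groupRows_val S i).get_eq, keyTuples]

theorem steps_groupRows_le (hr : 0 < r) (i : Fin r) :
    (groupRows S i).steps ≤ 1 + (S i).length * (5 + 6 * (numCols σ + r)) := by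
  refine (loop_steps_le_const (4 + 6 * (numCols σ + r)) _ _ _ fun t _ d => ?_).trans_eq (by ring)
  simp only [Timed.steps_bind, Dict.steps_lookup, steps_keyOf, Dict.steps_insert, steps_push]
  grw [steps_padRow_le hr]
  omega

theorem steps_headsAndTails_le (b : Counts₂ r κ V) (hS : 0 < (S b.idx).length)
    (out : List σ.Row) :
    (headsAndTails S b out).steps ≤ 44 * ((S b.idx).length * (numCols σ + r)) := by
  have r_pos := b.idx.pos
  have length_le : (S b.idx).length ≤ (S b.idx).length * (numCols σ + r) :=
    Nat.le_mul_of_pos_right _ (by omega)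
  simp only [headsAndTails, Timed.steps_bind]
  grw [steps_groupRows_le S r_pos, steps_reduceGroups_le r_pos, sum_length_groupRows,
    (groupRows_val S b.idx).length_keys, card_keyTuples_le]
  linarith

theorem steps_projectAway_le (p : Fin r) (b : Counts₂ r κ V) (st : State σ V) :
    (projectAway p b st).steps ≤ 2 + 38 * (st.data.keys.length * (numCols σ + r)) := by
  have r_pos := p.pos
  set groups : Timed (KeyDict κ V (List (ℝ × σ.Row))) := loop (fun d x => do
    let y ← project (σ.key p) x
    let v ← st.scales.lookup x
    let w ← st.data.lookup x
    let g ← d.lookup y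
    let g' ← push g (v, w)
    d.insert y g') st.data.keys (Dict.empty ([] : List (ℝ × σ.Row))) with groups_def
  have groups_val : groups.val.Represents (st.data.keys.map (restrict (σ.key p))).toFinset
      fun y => (st.data.keys.filter (restrict (σ.key p) · = y)).map
        fun x => (st.scales.get x, st.data.get x) := by
    rw [groups_def, loop_val]
    exact Dict.represents_foldl_push (restrict (σ.key p))
      (fun x => (st.scales.get x, st.data.get x)) st.data.keys
  have groups_steps : groups.steps ≤ 1 + st.data.keys.length * 7 :=
    loop_steps_le_const 6 _ _ _ fun _ _ _ => by simp
  have sum_length : (groups.val.keys.map fun x => (groups.val.get x).length).sum =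
      st.data.keys.length := by
    rw [groups_val.sum_keys, ← sum_length_filter_eq (restrict (σ.key p)) st.data.keys]
    simp only [groups_val.get_eq, List.length_map]
  have length_keys_le : groups.val.keys.length ≤ st.data.keys.length := by
    rw [groups_val.length_keys]
    simpa using List.toFinset_card_le (st.data.keys.map (restrict (σ.key p)))
  have length_le : st.data.keys.length ≤ st.data.keys.length * (numCols σ + r) :=
    Nat.le_mul_of_pos_right _ (by omega)
  have steps_eq : (projectAway p b st).steps =
      groups.steps + (reduceGroups groups.val b.up b.down st.out).steps := rfl
  rw [steps_eq]
  grw [steps_reduceGroups_le r_pos, groups_steps, sum_length, length_keys_le]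
  linarith

theorem steps_joinChildren_le (i : Fin r) {bs : List (Result σ V)}
    (hbs : (bs.flatMap Result.nodes).Nodup) (hlen : bs.length ≤ r) (st : State σ V) :
    (joinChildren i bs st).steps ≤ 1 + 23 * (st.data.keys.length * (numCols σ + r)) := by
  have r_pos := i.pos
  have length_nodes_le : (bs.flatMap Result.nodes).length ≤ r := by simpa using hbs.length_le_card
  have sum_width_le := sum_width_le σ hbs
  have width_le := width_le_numCols σ i
  grw [joinChildren, loop_steps_le_const (22 * (numCols σ + r)) _ _ _ fun x _ st' => ?_]
  · grw [show 1 + 22 * (numCols σ + r) ≤ 23 * (numCols σ + r) by omega]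
    exact (by ring : _ = _).le
  · simp only [Timed.steps_bind, Dict.steps_lookup, steps_mul, steps_setBlock, Dict.steps_insert,
      Timed.steps_pure, steps_tabulate, steps_cell, Finset.sum_const, Finset.card_univ,
      Fintype.card_fin, smul_eq_mul]
    grw [loop_steps_le_const 3 _ _ _ fun _ _ _ => by simp, steps_copyChildren_le]
    omega

variable {S}

namespace ResultSpec

theorem length_eq {p : Fin r} {F : Forest (Fin r)} {bs : List (Result σ V)}
    (h : ResultSpec S p F bs) : bs.length = F.roots.length := by
  induction h with
  | nil => rfl
  | node _ _ _ _ _ ih => simp [Forest.roots, ih]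

variable {i : Fin r} {cs : Forest (Fin r)} {bs : List (Result σ V)}

theorem steps_collectNodes_le (h : ResultSpec S i cs bs) (hcs : cs.labels.Nodup) :
    (collectNodes i bs).steps ≤ 1 + 4 * r := by
  have length_roots_le := length_roots_le_of_nodup hcs
  have length_labels_le : cs.labels.length ≤ r := by simpa using hcs.length_le_card
  grw [Figaro.steps_collectNodes_le, h.length_eq, h.nodes_perm.length_eq]
  omega

theorem steps_joinChildren_le (h : ResultSpec S i cs bs) (hcs : cs.labels.Nodup)
    {st : State σ V} (hst : st.data.keys.length ≤ (S i).length) :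
    (joinChildren i bs st).steps ≤ 1 + 23 * ((S i).length * (numCols σ + r)) := by
  grw [Figaro.steps_joinChildren_le i (h.nodes_perm.nodup_iff.2 hcs)
    (h.length_eq.trans_le (length_roots_le_of_nodup hcs)), hst]

theorem steps_finishNode_le (h : ResultSpec S i cs bs) (hS : PairwiseConsistent S) (p : Fin r)
    {b : Counts₂ r κ V} (idx : b.idx = i) (hcs : (i :: cs.labels).Nodup) {st : State σ V}
    (hst : StateSpec st.data st.scales (keyTuples S i) (group S i)) (out : List σ.Row) :
    (finishNode p b bs st out).steps ≤ 3 + 61 * ((S i).length * (numCols σ + r)) := by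
  subst idx
  cases bs with
  | nil => simp [finishNode]
  | cons b' bs =>
    have joined := (joinChildren_val h hcs (fun x hx => hS.card_joinForest_ne_zero cs hx)
      (st := ⟨st.data, st.scales, out⟩) hst).1
    have length_keys_le : st.data.keys.length ≤ (S b.idx).length :=
      hst.data.length_keys.trans_le (card_keyTuples_le S b.idx)
    simp only [finishNode, Timed.steps_bind]
    grw [h.steps_joinChildren_le hcs.of_cons (st := ⟨st.data, st.scales, out⟩) length_keys_le,
      steps_projectAway_le, joined.data.length_keys, card_keyTuples_le]
    omega

end ResultSpec

theorem CountsSpec₂.steps_processForest_le (hS : PairwiseConsistent S)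
    (length_pos : ∀ i, 0 < (S i).length) {p : Fin r} {full : KeyTuple κ V → ℝ}
    {F : Forest (Fin r)} {G : Forest (Counts₂ r κ V)} (counts : CountsSpec₂ S p full F G)
    (full_nonneg : ∀ x, 0 ≤ full x) (nodup : F.labels.Nodup) (leaf : LeafKeys σ p F)
    (out : List σ.Row) :
    (processForest S p G out).steps ≤
      1 + (F.labels.map fun i => 116 * ((S i).length * (numCols σ + r))).sum := by
  induction counts generalizing out with
  | nil => simp [processForest]
  | @node p i full cs rest b cs' rest' idx rowsPerKey down up circ counts _ ih_children
      ih_siblings =>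
    obtain ⟨leaf_tree, leaf_children, leaf_rest⟩ := leaf
    obtain ⟨nodup_tree, nodup_rest, -⟩ := (List.nodup_append' (l₁ := i :: cs.labels)).1 nodup
    have nodup_children := nodup_tree.of_cons
    have full'_nonneg := fullCount_nonneg S (p := p) (i := i) (cs := cs) full_nonneg
    have circ_nonneg : ∀ x, 0 ≤ b.circ.get x := fun x => by
      rw [circ]
      exact div_nonneg (full'_nonneg x) (Nat.cast_nonneg _)
    have state := (headsAndTails_val S idx rowsPerKey circ_nonneg out).1
    have results := (counts.processForest_val hS full'_nonneg nodup_children leaf_children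
      (headsAndTails S b out).val.out).1
    subst idx
    have one_le_length := length_pos b.idx
    have width_le : numCols σ + r ≤ (S b.idx).length * (numCols σ + r) :=
      Nat.le_mul_of_pos_left _ one_le_length
    have r_pos := b.idx.pos
    rw [processForest_node]
    simp only [Timed.steps_bind, steps_tick, Timed.steps_pure, Forest.labels, List.map_cons,
      List.sum_cons, List.map_append, List.sum_append]
    grw [steps_headsAndTails_le S b one_le_length,
      ih_children full'_nonneg nodup_children leaf_children,
      results.steps_collectNodes_le nodup_children,
      results.steps_finishNode_le hS p rfl nodup_tree state,
      ih_siblings full_nonneg nodup_rest leaf_rest]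
    omega

end Algorithm

theorem root_add_sum_labels {τ : RootedTree (Fin r)} (nodup : τ.labels.Nodup)
    (mem_labels : ∀ i, i ∈ τ.labels) (f : Fin r → ℕ) :
    f τ.root + (τ.children.labels.map f).sum = ∑ i, f i := by
  rw [← show τ.labels.toFinset = Finset.univ by ext; simp [mem_labels], List.sum_toFinset _ nodup]
  rfl

theorem sum_labels_length_mul {σ : Schema r κ} {S : σ.Database V} {τ : RootedTree (Fin r)}
    (nodup : τ.labels.Nodup) (mem_labels : ∀ i, i ∈ τ.labels) (c w : ℕ) :
    c * ((S τ.root).length * w) + (τ.children.labels.map fun i => c * ((S i).length * w)).sum =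
      c * (numRows S * w) := by
  rw [root_add_sum_labels nodup mem_labels fun i => c * ((S i).length * w), ← Finset.mul_sum,
    ← Finset.sum_mul, numRows]

section RunningTime

variable [Fintype κ] [DecidableEq κ] [DecidableEq V] {σ : Schema r κ} {S : σ.Database V}
  {τ : RootedTree (Fin r)}

theorem steps_computeCounts_le (length_pos : ∀ i, 0 < (S i).length) (nodup : τ.labels.Nodup)
    (mem_labels : ∀ i, i ∈ τ.labels) :
    (computeCounts S τ).steps ≤ 80 * (numRows S * (numCols σ + r)) := by
  have rowsPerKey := countRows_val S τ.root
  have counts := pass₁_val S τ.root τ.children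
  have theta := computeTheta_val S counts rowsPerKey
  have nodup_children : τ.children.labels.Nodup := List.Nodup.of_cons (a := τ.root) nodup
  have length_labels_le : τ.children.labels.length ≤ r := by
    simpa using nodup_children.length_le_card
  have length_le := length_le_numRows S τ.root
  have numRows_pos := (length_pos τ.root).trans_le length_le
  have r_pos := τ.root.pos
  have one_le : 1 ≤ numRows S * (numCols σ + r) := Nat.mul_pos numRows_pos (by omega)
  have numRows_le : numRows S ≤ numRows S * (numCols σ + r) :=
    Nat.le_mul_of_pos_right _ (by omega)
  have sum_eq := sum_labels_length_mul (S := S) nodup mem_labels 24 (numCols σ + r)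
  have pass₂_le : τ.children.labels.length * (6 + 22 * numRows S) ≤
      28 * (numRows S * (numCols σ + r)) := by
    grw [length_labels_le, show 6 + 22 * numRows S ≤ 28 * numRows S by omega]
    linarith [Nat.zero_le (numRows S * numCols σ)]
  simp only [computeCounts, Timed.steps_bind, steps_tick, Timed.steps_pure]
  grw [steps_pass₁_le S length_pos _ nodup_children, steps_countRows_le,
    counts.steps_computeTheta_le nodup_children rowsPerKey, steps_divide_le, theta.length_keys,
    card_keyTuples_le, counts.steps_pass₂_le theta, pass₂_le, length_le]
  omega

theorem steps_figaro_le (hS : PairwiseConsistent S) (length_pos : ∀ i, 0 < (S i).length)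
    (nodup : τ.labels.Nodup) (mem_labels : ∀ i, i ∈ τ.labels)
    (leaf : LeafKeys σ τ.root τ.children) :
    (figaro S τ).steps ≤ 300 * (numRows S * (numCols σ + r)) := by
  obtain ⟨idx, rowsPerKey, circ, counts⟩ := computeCounts_val S τ
  have computeCounts_le := steps_computeCounts_le length_pos nodup mem_labels
  have nodup_children : τ.children.labels.Nodup := List.Nodup.of_cons (a := τ.root) nodup
  set t := (computeCounts S τ).val with t_def
  set st := (headsAndTails S t.root []).val with st_def
  have heads := (headsAndTails_val S idx rowsPerKey (fun x => by rw [circ]; positivity) []).1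
  have results := (counts.processForest_val hS (fun x => by positivity) nodup_children leaf
    st.out).1
  set sub := processForest S τ.root t.children st.out with sub_def
  have joined := (joinChildren_val results nodup
    (fun x hx => hS.card_joinForest_ne_zero _ hx) (st := ⟨st.data, st.scales, sub.val.2⟩) heads).1
  have length_keys_le : st.data.keys.length ≤ (S τ.root).length :=
    heads.data.length_keys.trans_le (card_keyTuples_le S τ.root)
  have r_pos := τ.root.pos
  have one_le : 1 ≤ (S τ.root).length * (numCols σ + r) :=
    Nat.mul_pos (length_pos τ.root) (by omega)
  have length_le : (S τ.root).length ≤ (S τ.root).length * (numCols σ + r) :=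
    Nat.le_mul_of_pos_right _ (by omega)
  have sum_eq := sum_labels_length_mul (S := S) nodup mem_labels 116 (numCols σ + r)
  have heads_le := steps_headsAndTails_le S t.root (length_pos _) []
  rw [congrArg (fun i => (S i).length) idx] at heads_le
  simp only [figaro, Timed.steps_bind, steps_tick, ← t_def, ← st_def]
  grw [computeCounts_le, heads_le]
  simp only [idx, ← sub_def]
  grw [counts.steps_processForest_le hS length_pos (fun x => by positivity) nodup_children leaf,
    results.steps_joinChildren_le nodup_children (st := ⟨st.data, st.scales, sub.val.2⟩)
      length_keys_le,
    loop_steps_le_const 2 _ _ _ fun _ _ _ => by simp, joined.data.length_keys, card_keyTuples_le]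
  omega

end RunningTime

/-! ## The decomposition of the join matrix -/

section Output

variable {σ : Schema r κ}

/-- The value at the coefficient vector `z` of a row, as a linear functional of the row: entry `a`
of the product of a matrix with `z` is this functional at row `a`. -/
def rowFunctional (z : σ.Col → ℝ) : σ.Row →ₗ[ℝ] ℝ where
  toFun w := ∑ c : σ.Col, w c.1 c.2 * z c
  map_add' v w := by simp [add_mul, Finset.sum_add_distrib]
  map_smul' a w := by simp [Finset.mul_sum, mul_assoc]

theorem sum_stackZero_mulVec_sq {R : List σ.Row} {m : ℕ} (h : R.length ≤ m) (z : σ.Col → ℝ) :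
    ∑ a, ((stackZero R m).mulVec z a) ^ 2 = sumSq (rowFunctional z) R := by
  obtain ⟨n, rfl⟩ := Nat.exists_eq_add_of_le h
  rw [Fin.sum_univ_add, add_eq_left.2]
  · simp only [sumSq, Multiset.map_coe, Multiset.sum_coe]
    rw [← Fin.sum_univ_fun_getElem R fun w => rowFunctional z w ^ 2]
    refine Finset.sum_congr rfl fun a _ => ?_
    simp [Matrix.mulVec, dotProduct, stackZero, rowFunctional]
  · refine Finset.sum_eq_zero fun a _ => ?_
    simp [Matrix.mulVec, dotProduct, stackZero]

theorem sum_joinMatrix_mulVec_sq {S : σ.Database V} {m : ℕ} (e : Fin m ≃ natJoin S)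
    (z : σ.Col → ℝ) :
    ∑ a, ((joinMatrix e).mulVec z a) ^ 2 =
      sumSq (rowFunctional z) (Finset.univ.val.map fun a => (e a).1.2) := by
  rw [sumSq, Multiset.map_map]
  rfl

theorem FullyReduced.length_pos {S : σ.Database V} (reduced : FullyReduced S)
    (h : 0 < numRows S) (i : Fin r) : 0 < (S i).length := by
  obtain ⟨j, -, length_ne_zero⟩ := Finset.exists_ne_zero_of_sum_ne_zero h.ne'
  obtain ⟨t, ht⟩ := List.exists_mem_of_length_pos (Nat.pos_of_ne_zero length_ne_zero)
  obtain ⟨u, hu, -⟩ := reduced j t ht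
  exact List.length_pos_of_mem (hu i)

theorem le_numCols (h : ∀ i, 0 < σ.width i) : r ≤ numCols σ :=
  calc r = ∑ _i : Fin r, 1 := by simp
    _ ≤ numCols σ := Finset.sum_le_sum fun i _ => h i

variable [Fintype κ] [DecidableEq κ] [DecidableEq V] {S : σ.Database V} {τ : RootedTree (Fin r)}

theorem IsJoinTree.length_figaro_le_numRows (tree : IsJoinTree σ τ) (hS : PairwiseConsistent S) :
    (figaro S τ).val.length ≤ numRows S := by
  rw [length_figaro hS tree.nodup tree.leafKeys]
  grw [outLength_le]
  exact (root_add_sum_labels tree.nodup tree.mem_labels fun i => (S i).length).le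

variable {m : ℕ}

theorem IsJoinTree.card_joinRows (tree : IsJoinTree σ τ) (nodup : ∀ i, (S i).Nodup)
    (reduced : FullyReduced S) (e : Fin m ≃ natJoin S) : (joinRows S τ).card = m := by
  simp [← tree.map_natJoin nodup reduced e]

theorem IsJoinTree.length_figaro_le (tree : IsJoinTree σ τ) (nodup : ∀ i, (S i).Nodup)
    (reduced : FullyReduced S) (e : Fin m ≃ natJoin S) : (figaro S τ).val.length ≤ m :=
  (length_figaro_le_card_joinRows reduced.pairwiseConsistent tree.nodup tree.leafKeys).trans_eq
    (tree.card_joinRows nodup reduced e)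

theorem IsJoinTree.exists_orthogonal_mul_stackZero_figaro (tree : IsJoinTree σ τ)
    (nodup : ∀ i, (S i).Nodup) (reduced : FullyReduced S) (e : Fin m ≃ natJoin S) :
    ∃ Q ∈ Matrix.orthogonalGroup (Fin m) ℝ,
      joinMatrix e = Q * stackZero (figaro S τ).val m :=
  exists_mem_orthogonalGroup_mul_eq fun z => by
    rw [sum_joinMatrix_mulVec_sq, sum_stackZero_mulVec_sq (tree.length_figaro_le nodup reduced e),
      tree.map_natJoin nodup reduced,
      sumSq_figaro reduced.pairwiseConsistent tree.nodup tree.leafKeys]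

theorem IsJoinTree.joinMatrix_eq_stackZero_figaro (tree : IsJoinTree σ τ)
    (nodup : ∀ i, (S i).Nodup) (reduced : FullyReduced S) (e : Fin 1 ≃ natJoin S) :
    joinMatrix e = stackZero (figaro S τ).val 1 := by
  rw [figaro_val_eq_singleton reduced.pairwiseConsistent tree.nodup tree.leafKeys
    (tree.card_joinRows nodup reduced e), ← tree.map_natJoin nodup reduced e]
  ext a c
  simp [joinMatrix, stackZero, Subsingleton.elim a 0]

theorem IsJoinTree.exists_givens_mul_joinMatrix (tree : IsJoinTree σ τ)
    (nodup : ∀ i, (S i).Nodup) (reduced : FullyReduced S) (e : Fin m ≃ natJoin S) :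
    ∃ (G : List (Matrix (Fin m) (Fin m) ℝ)) (π : Equiv.Perm (Fin m)),
      (∀ g ∈ G, ∃ (i j : Fin m) (θ : ℝ), i ≠ j ∧ g = givens i j θ) ∧
      G.prod * joinMatrix e = (stackZero (figaro S τ).val m).submatrix π id := by
  obtain rfl | hm := eq_or_ne m 1
  · refine ⟨[], Equiv.refl _, by simp, ?_⟩
    simpa using tree.joinMatrix_eq_stackZero_figaro nodup reduced e
  · obtain ⟨Q, hQ, joinMatrix_eq⟩ :=
      tree.exists_orthogonal_mul_stackZero_figaro nodup reduced e
    rw [joinMatrix_eq]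
    exact exists_givens_eq_submatrix hm hQ _

end Output

end Figaro

theorem mainTheorem1 :
    ∃ C : ℕ, ∀ (r : ℕ) (κ V : Type) [Fintype κ] [DecidableEq κ] [DecidableEq V]
      (σ : Figaro.Schema r κ) (S : σ.Database V) (τ : Figaro.RootedTree (Fin r)),
      (∀ i, (S i).Nodup) →
      Figaro.FullyReduced S →
      Figaro.IsJoinTree σ τ →
      let R₀ := (Figaro.figaro S τ).val
      let time := (Figaro.figaro S τ).steps
      let M := Figaro.numRows S
      let N := Figaro.numCols σ
      -- the running time
      (0 < M →
        time ≤ C * (M * (N + r)) ∧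
        (0 < N → time ≤ C * r * (M * N)) ∧
        ((∀ i, 0 < σ.width i) → time ≤ C * (M * N))) ∧
      -- the number of rows
      R₀.length ≤ M ∧
      -- the decomposition, for the rows of the join output in any order `e`
      ∀ (m : ℕ) (e : Fin m ≃ Figaro.natJoin S),
        R₀.length ≤ m ∧
        (∃ Q ∈ Matrix.orthogonalGroup (Fin m) ℝ,
          Figaro.joinMatrix e = Q * Figaro.stackZero R₀ m) ∧
        ∃ (G : List (Matrix (Fin m) (Fin m) ℝ)) (π : Equiv.Perm (Fin m)),
          (∀ g ∈ G, ∃ (i j : Fin m) (θ : ℝ), i ≠ j ∧ g = Figaro.givens i j θ) ∧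
          G.prod * Figaro.joinMatrix e = (Figaro.stackZero R₀ m).submatrix π id := by
  refine ⟨600, fun r κ V _ _ _ σ S τ nodup reduced tree => ?_⟩
  intro R₀ time M N
  have consistent := reduced.pairwiseConsistent
  refine ⟨fun M_pos => ?_, tree.length_figaro_le_numRows consistent, fun m e =>
    ⟨tree.length_figaro_le nodup reduced e,
      tree.exists_orthogonal_mul_stackZero_figaro nodup reduced e,
      tree.exists_givens_mul_joinMatrix nodup reduced e⟩⟩
  have time_le : time ≤ 300 * (M * (N + r)) := Figaro.steps_figaro_le consistent
    (reduced.length_pos M_pos) tree.nodup tree.mem_labels tree.leafKeys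
  refine ⟨by grw [time_le]; gcongr; norm_num, fun N_pos => ?_, fun width_pos => ?_⟩
  · have r_pos : 0 < r := τ.root.pos
    calc time ≤ 300 * (M * (N + r)) := time_le
      _ ≤ 300 * (M * (2 * (r * N))) := by gcongr; nlinarith
      _ = 600 * r * (M * N) := by ring
  · calc time ≤ 300 * (M * (N + r)) := time_le
      _ ≤ 300 * (M * (N + N)) := by gcongr; exact Figaro.le_numCols width_pos
      _ = 600 * (M * N) := by ring
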